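/- **Notation.** Fix an integer $N\ge 1$ and complex numbers $\eta,\omega,\delta,\lambda$. Put $q=e^{\eta}$, $q^u=e^{\eta u}$ and $[u]=\frac{q^u-q^{-u}}{q-q^{-1}}$ (with $[u]=u$ if $\eta=0$); $q=-1$, and $q=1$ with $\eta\neq0$, are excluded. Assume $[k]\ne 0$ for $2\le k\le N$ and $[\omega+1]\neq 0$. Put $k(u,\mu)=[\tfrac{\omega+\mu}2+u]\,[\tfrac{\omega-\mu}2+u]$. *Ballot paths.* A Ballot path of length $N$ is a vector $\alpha=(\alpha_0,\dots,\alpha_N)$ of integers $\alpha_i\ge 0$ with $\alpha_{i+1}-\alpha_i=\pm1$ and $\alpha_N=0$; the maximal one is $\Omega^{\rm B}=(N,N-1,\dots,1,0)$. The generators $e_0,\dots,e_{N-1}$ of the one-boundary Temperley–Lieb (blob) algebra act on the complex vector space with basis the states $|\alpha\rangle$ as follows. For $1\le i\le N-1$: * if $\alpha$ has a local minimum at $i$, then $e_i|\alpha\rangle$ is the state with $\alpha_i$ replaced by $\alpha_i+2$; * if $\alpha$ has a local maximum at $i$, then $e_i|\alpha\rangle=-[2]\,|\alpha\rangle$; *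 if $\alpha_{i-1}<\alpha_i<\alpha_{i+1}$ and $j>i$ is minimal with $\alpha_j=\alpha_i$, then $e_i|\alpha\rangle$ is the state with $\alpha_l$ replaced by $\alpha_l-2$ for $i<l<j$; * if $\alpha_{i-1}>\alpha_i>\alpha_{i+1}$ and there is a $k<i$ with $\alpha_k=\alpha_i$, take the maximal such $k$; then $e_i|\alpha\rangle$ is the state with $\alpha_l$ replaced by $\alpha_l-2$ for $k<l<i$; * if $\alpha_{i-1}>\alpha_i>\alpha_{i+1}$ and $\alpha_k>\alpha_i$ for all $k<i$, then $e_i|\alpha\rangle$ is $c$ times the state with $\alpha_l$ replaced by $\alpha_l-2$ for all $l<i$, where $c=1$ if $i$ is odd and $c=-[\omega]/[\omega+1]$ if $i$ is even. If $\alpha_0<\alpha_1$, then $e_0|\alpha\rangle$ is the state with $\alpha_0$ replaced by $\alpha_0+2$; if $\alpha_0>\alpha_1$, then $e_0|\alpha\rangle=-\frac{[\omega]}{[\omega+1]}|\alpha\rangle$. Put $$R_i(u)=\frac{[1-u]-[u]e_i}{[1+u]},\qquad K_0(u)=\frac{k(u,\delta)+[2u][\omega+1]e_0}{k(-u,\delta)}.$$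 *The qKZ equation.* For functions $f$ of $x=(x_1,\dots,x_N)$ let $\pi_i$ ($1\le i\le N-1$) exchange the arguments $x_i$ and $x_{i+1}$, let $\pi_0$ replace $x_1$ by $-x_1$ and $\pi_N$ replace $x_N$ by $-\lambda-x_N$. Let $D\subseteq\mathbb C^N$ be stable under these $N+1$ transformations of the arguments, and such that $[x_i-x_{i+1}]$, $[1+x_i-x_{i+1}]$ ($1\le i\le N-1$), $[2x_1]$ and $k(x_1,\delta)$ vanish nowhere on $D$. A vector $|\Psi\rangle=\sum_\alpha\psi_\alpha|\alpha\rangle$ of complex functions $\psi_\alpha$ is a solution of the type B qKZ equation on $D$ if on $D$ $$R_i(x_i-x_{i+1})|\Psi\rangle=\pi_i|\Psi\rangle\ (1\le i\le N-1),\qquad K_0(-x_1)|\Psi\rangle=\pi_0|\Psi\rangle,\qquad |\Psi\rangle=\pi_N|\Psi\rangle .$$ *Tiles.* On functions of $x$ define $s_i=\frac{[x_i-x_{i+1}+1]}{[x_i-x_{i+1}]}(1-\pi_i)$ and $h_i(u)=s_i-\frac{[u-1]}{[u]}$ for $1\le i\le N-1$, and $s_0=\frac{k(x_1,\delta)}{[2x_1][\omega+1]}(1-\pi_0)$,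 $h_0(u)=s_0-\frac{k(u/2,\nu)}{[u][\omega+1]}$, and let $\bar h_0(u)$, for an integer $u\geq 1$, be $h_0(u)$ with the auxiliary parameter fixed as $\nu=\omega+(u\bmod 2)$. For a Ballot path $\alpha$, fill the half-Young diagram between $\alpha$ and $\Omega^{\rm B}$ with tiles, half-tiles if $i=0$: there is a tile with centre $(i,j)$ for all integers $0\le i<N$ and $j$ with $\alpha_i<j<N-i$ and $i+j\equiv N+1 \pmod 2$. Give it the content $u_{i,j}=1$ if there is no tile with centre $(i\pm1,j-1)$; otherwise let $u_{i,j}$ be $1$ plus the maximum of the contents of those of these (one or two) tiles that exist. Let $H_\alpha$ be the product over all these tiles of the operators $h_i(u_{i,j})$ (for $i\ge1$) and $\bar h_0(u_{0,j})$ (for $i=0$), in any order such that the contents do not decrease when reading from left to right. **Theorem 2.** If $|\Psi\rangle=\sum_\alpha\psi_\alpha|\alpha\rangle$ is a solution of the type B qKZ equation on $D$, then for each Ballot path $\alpha$ of length $N$ $$\psi_\alpha=H_\alpha\,\psi_{\Omega^{\rm B}}\qquad\text{on } D .$$ -/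

import Mathlib

namespace QKZ

noncomputable section

open scoped Classical

/-! ### q-numbers -/

/-- The q-number `[u] = (q^u - q^(-u)) / (q - q⁻¹)`, where `q = exp η` and `q^u = exp (η u)`;
for `η = 0`, that is `q = 1`, it is the limit `[u] = u`. -/
def qnum (η u : ℂ) : ℂ :=
  if η = 0 then u
  else (Complex.exp (η * u) - Complex.exp (-(η * u))) / (Complex.exp η - Complex.exp (-η))

/-- `k(u, δ) = [(ω + δ)/2 + u] [(ω - δ)/2 + u]`. -/
def kfun (η ω u δ : ℂ) : ℂ :=
  qnum η ((ω + δ) / 2 + u) * qnum η ((ω - δ) / 2 + u)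

/-! ### Ballot paths and the path representation -/

/-- A Ballot path of length `N`: heights `α₀, …, α_N ≥ 0` with steps `± 1` and `α_N = 0`.
The height function is extended by `0` beyond `N`, so that it is determined by the path. -/
@[ext]
structure BallotPath (N : ℕ) where
  ht : ℕ → ℤ
  nonneg : ∀ i, 0 ≤ ht i
  step : ∀ i, i < N → ht (i + 1) = ht i + 1 ∨ ht (i + 1) = ht i - 1
  tail : ∀ i, N ≤ i → ht i = 0

/-- The maximal Ballot path `(N, N - 1, …, 1, 0)`. -/
def maxPath (N : ℕ) : BallotPath N where
  ht i := ((N - i : ℕ) : ℤ)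
  nonneg i := by positivity
  step i hi := by right; omega
  tail i hi := by omega

/-- The vector space spanned by the states `|α⟩`, `α` a Ballot path of length `N`. -/
abbrev PathSpace (N : ℕ) := BallotPath N →₀ ℂ

/-- The state of the Ballot path with height function `f` (and `0` if there is none; in the
formulas below `f` always is the height function of a Ballot path). -/
def ket (N : ℕ) (f : ℕ → ℤ) : PathSpace N :=
  if h : ∃ β : BallotPath N, β.ht = f then Finsupp.single h.choose 1 else 0

/-- The vector `e_i |α⟩`. In the case of an uphill slope at `i`, the heights strictly between `i`
and the first return `j > i` to the height `α_i` are lowered by `2`. In the case of a downhill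
slope, the heights strictly between the last earlier visit `k < i` of the height `α_i` and `i` are
lowered by `2`, or all the heights to the left of `i` if there is no such `k`; in the latter case
there is a factor `-[ω]/[ω+1]` if `i` is even. -/
def genKet (η ω : ℂ) {N : ℕ} (i : ℕ) (α : BallotPath N) : PathSpace N :=
  if i = 0 then
    if α.ht 0 < α.ht 1 then
      ket N (fun m => if m = 0 then α.ht m + 2 else α.ht m)
    else
      (-(qnum η ω / qnum η (ω + 1))) • Finsupp.single α 1
  else if α.ht i < α.ht (i - 1) ∧ α.ht i < α.ht (i + 1) then
    ket N (fun m => if m = i then α.ht m + 2 else α.ht m)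
  else if α.ht (i - 1) < α.ht i ∧ α.ht (i + 1) < α.ht i then
    (-(qnum η 2)) • Finsupp.single α 1
  else if α.ht (i - 1) < α.ht i then
    ket N (fun m => if i < m ∧ (∀ l, i < l → l ≤ m → α.ht i < α.ht l)
      then α.ht m - 2 else α.ht m)
  else
    (if (∀ k, k < i → α.ht i < α.ht k) ∧ Even i then -(qnum η ω / qnum η (ω + 1)) else 1) •
      ket N (fun m => if m < i ∧ (∀ l, m ≤ l → l < i → α.ht i < α.ht l)
        then α.ht m - 2 else α.ht m)

/-- The generator `e_i`, `0 ≤ i < N`, of the one-boundary Temperley-Lieb algebra, acting on the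
space spanned by the Ballot paths. -/
def gen (η ω : ℂ) (N i : ℕ) : Module.End ℂ (PathSpace N) :=
  Finsupp.linearCombination ℂ (genKet η ω i)

/-- The R-matrix `R_i(u) = ([1 - u] - [u] e_i) / [1 + u]`. -/
def Rmat (η ω : ℂ) (N i : ℕ) (u : ℂ) : Module.End ℂ (PathSpace N) :=
  (qnum η (1 - u) / qnum η (1 + u)) • (1 : Module.End ℂ (PathSpace N))
    - (qnum η u / qnum η (1 + u)) • gen η ω N i

/-- The reflection matrix `K₀(u) = (k(u, δ) + [2u] [ω + 1] e₀) / k(-u, δ)`. -/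
def Kmat (η ω δ : ℂ) (N : ℕ) (u : ℂ) : Module.End ℂ (PathSpace N) :=
  (kfun η ω u δ / kfun η ω (-u) δ) • (1 : Module.End ℂ (PathSpace N))
    + (qnum η (2 * u) * qnum η (ω + 1) / kfun η ω (-u) δ) • gen η ω N 0

/-! ### The qKZ equation of type B

A point `x : Fin N → ℂ` has the coordinates `x₁ = x 0, …, x_N = x (N - 1)`. For `i : Fin N` with
`i ≠ 0`, the coordinates `x_i`, `x_{i+1}` are therefore `x (i - 1)` and `x i`. -/

/-- The action on points that underlies `π_i`: for `i = 0` the sign of the first coordinate `x₁` is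
changed, for `i ≥ 1` the coordinates `x_i` and `x_{i+1}` are exchanged. -/
def reflect {N : ℕ} [NeZero N] (i : Fin N) (x : Fin N → ℂ) : Fin N → ℂ :=
  if i = 0 then Function.update x 0 (-x 0) else x ∘ Equiv.swap (i - 1) i

/-- The action on points that underlies `π_N`: the last coordinate `x_N` becomes `-lam - x_N`. -/
def reflectLast {N : ℕ} (lam : ℂ) (x : Fin N → ℂ) : Fin N → ℂ :=
  fun j => if (j : ℕ) + 1 = N then -lam - x j else x j

/-- `D` is a set of points that is stable under the permutation and the reflections of the
arguments, and on which no denominator of the qKZ equation (`[1 + x_i - x_{i+1}]`, `k(x₁, δ)`) and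
of the operators `s_i` (`[x_i - x_{i+1}]`, `[2 x₁]`) vanishes. -/
structure IsRegularDomain (η ω δ lam : ℂ) {N : ℕ} [NeZero N] (D : Set (Fin N → ℂ)) : Prop where
  reflect_mem : ∀ x ∈ D, ∀ i : Fin N, reflect i x ∈ D
  reflectLast_mem : ∀ x ∈ D, reflectLast lam x ∈ D
  sub_ne : ∀ x ∈ D, ∀ i : Fin N, i ≠ 0 → qnum η (x (i - 1) - x i) ≠ 0
  one_add_ne : ∀ x ∈ D, ∀ i : Fin N, i ≠ 0 → qnum η (1 + (x (i - 1) - x i)) ≠ 0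
  two_mul_ne : ∀ x ∈ D, qnum η (2 * x 0) ≠ 0
  kfun_ne : ∀ x ∈ D, kfun η ω (x 0) δ ≠ 0

/-- The vector-valued function `Ψ = ∑_α ψ_α |α⟩`, `ψ_α x = Ψ x α`, solves the qKZ equation of
type B on `D`:
`R_i(x_i - x_{i+1}) Ψ = π_i Ψ` for `1 ≤ i ≤ N - 1`, `K₀(-x₁) Ψ = π₀ Ψ`, and `Ψ = π_N Ψ`. -/
structure IsSolution (η ω δ lam : ℂ) {N : ℕ} [NeZero N] (D : Set (Fin N → ℂ))
    (Ψ : (Fin N → ℂ) → PathSpace N) : Prop where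
  bulk : ∀ x ∈ D, ∀ i : Fin N, i ≠ 0 →
    Rmat η ω N i (x (i - 1) - x i) (Ψ x) = Ψ (reflect i x)
  left : ∀ x ∈ D, Kmat η ω δ N (-x 0) (Ψ x) = Ψ (reflect 0 x)
  right : ∀ x ∈ D, Ψ x = Ψ (reflectLast lam x)

/-! ### The operators on functions -/

/-- The functions of `N` complex variables. -/
abbrev Fun (N : ℕ) := (Fin N → ℂ) → ℂ

/-- `(π_i f)(x) = f(π_i x)`. -/
def piOp {N : ℕ} [NeZero N] (i : Fin N) : Module.End ℂ (Fun N) :=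
  LinearMap.funLeft ℂ ℂ (reflect i)

/-- The operators `s₀ = k(x₁, δ) / ([2x₁] [ω + 1]) (1 - π₀)` and
`s_i = [x_i - x_{i+1} + 1] / [x_i - x_{i+1}] (1 - π_i)`, `i ≥ 1`. -/
def sOp (η ω δ : ℂ) {N : ℕ} [NeZero N] (i : Fin N) : Module.End ℂ (Fun N) :=
  LinearMap.mulLeft ℂ (fun x : Fin N → ℂ =>
    if i = 0 then kfun η ω (x 0) δ / (qnum η (2 * x 0) * qnum η (ω + 1))
    else qnum η (x (i - 1) - x i + 1) / qnum η (x (i - 1) - x i)) * (1 - piOp i)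

/-- The Baxterised element `h_i(u) = s_i - [u - 1] / [u]`, `i ≥ 1`. -/
def hOp (η ω δ : ℂ) {N : ℕ} [NeZero N] (i : Fin N) (u : ℂ) : Module.End ℂ (Fun N) :=
  sOp η ω δ i - (qnum η (u - 1) / qnum η u) • (1 : Module.End ℂ (Fun N))

/-- The boundary Baxterised element `h₀(u) = s₀ - k(u/2, ν) / ([u] [ω + 1])`. -/
def hZeroOp (η ω δ ν : ℂ) {N : ℕ} [NeZero N] (u : ℂ) : Module.End ℂ (Fun N) :=
  sOp η ω δ 0 - (kfun η ω (u / 2) ν / (qnum η u * qnum η (ω + 1))) • (1 : Module.End ℂ (Fun N))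

/-- The boundary half-tile `h̄₀(u)`, `u` an integer: `h₀(u)` at `ν = ω + (u mod 2)`. -/
def hBarOp (η ω δ : ℂ) {N : ℕ} [NeZero N] (u : ℕ) : Module.End ℂ (Fun N) :=
  hZeroOp η ω δ (ω + ((u % 2 : ℕ) : ℂ)) u

/-- The operator of a tile at horizontal position `i` with content `u`. -/
def tileOp (η ω δ : ℂ) {N : ℕ} [NeZero N] (i : Fin N) (u : ℕ) : Module.End ℂ (Fun N) :=
  if i = 0 then hBarOp η ω δ u else hOp η ω δ i u

/-! ### The tiles between a Ballot path and the maximal one, and their contents -/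

/-- There is an added tile (a half-tile for `i = 0`) with centre `(i, j)` between `α` and the
maximal path. The tile has the top and bottom vertices `(i, j + 1)`, `(i, j - 1)` and lateral
vertices `(i ± 1, j)`; its centre lies strictly between the two paths, and its parity is such that
the vertices are lattice points that Ballot paths of length `N` can visit. -/
def IsTile {N : ℕ} (α : BallotPath N) (i j : ℕ) : Prop :=
  α.ht i < (j : ℤ) ∧ i + j < N ∧ Odd (i + j + N)

/-- The content `u_{i,j}` of the added tile with centre `(i, j)`; it is set to `0` if there is no
such tile. Hence it is `1` if there is no tile at `(i ± 1, j - 1)`, and otherwise `1` plus the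
maximum of the contents of those of these tiles that exist. The half-tiles (`i = 0`) have a lower
neighbour on the right only. -/
def content {N : ℕ} (α : BallotPath N) : (i j : ℕ) → ℕ
  | _, 0 => 0
  | 0, j + 1 => if IsTile α 0 (j + 1) then content α 1 j + 1 else 0
  | i + 1, j + 1 =>
      if IsTile α (i + 1) (j + 1) then max (content α (i + 2) j) (content α i j) + 1 else 0
termination_by structural _ j => j

/-- The finite set of all added tiles. -/
def tiles {N : ℕ} (α : BallotPath N) : Finset (Fin N × ℕ) :=
  (Finset.univ ×ˢ Finset.range N).filter (fun t => IsTile α t.1 t.2)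

/-- `L` is a list of all the added tiles, each of them once, such that the contents do not decrease
from left to right. -/
def IsAdmissibleOrder {N : ℕ} (α : BallotPath N) (L : List (Fin N × ℕ)) : Prop :=
  (L : Multiset (Fin N × ℕ)) = (tiles α).val ∧
    L.Pairwise (fun s t => content α s.1 s.2 ≤ content α t.1 t.2)

/-- The ordered product `H_α` of the (half-)tiles, for an order `L` of the added tiles. -/
def Hprod (η ω δ : ℂ) {N : ℕ} [NeZero N] (α : BallotPath N) (L : List (Fin N × ℕ)) :
    Module.End ℂ (Fun N) :=
  (L.map (fun t => tileOp η ω δ t.1 (content α t.1 t.2))).prod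

/-- There always is an admissible order of the added tiles. -/
theorem exists_isAdmissibleOrder {N : ℕ} (α : BallotPath N) :
    ∃ L : List (Fin N × ℕ), IsAdmissibleOrder α L := by
  let r : Fin N × ℕ → Fin N × ℕ → Prop := fun s t => content α s.1 s.2 ≤ content α t.1 t.2
  have : Std.Total r := ⟨fun s t => le_total _ _⟩
  have : IsTrans (Fin N × ℕ) r := ⟨fun _ _ _ => le_trans⟩
  refine ⟨(tiles α).toList.insertionSort r, ?_, List.pairwise_insertionSort r _⟩
  rw [← Finset.coe_toList]
  exact Multiset.coe_eq_coe.mpr (List.perm_insertionSort r _)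

end

end QKZ

/-!
The equations of a solution `Ψ` express `π_i Ψ` through the generator `e_i`. On a function of the
form `x ↦ w (Ψ x)`, with `w` a linear form on the path space, `s_i` therefore acts as the transpose
of `e_i` plus a constant, and so do the tiles: `h_i(u)` as `e_i + [u + 1] / [u]`, and the half-tile
as `e_0` plus a constant that involves `k(u/2, ν)` (`tileOp_apply`). The functions disappear, and
what has to be shown is that the product of the tiles of `α` maps the linear form that reads off
the coefficient of the maximal path to the one that reads off the coefficient of `α`
(`tileProd_single`).

This goes by induction on the number of tiles. Take the highest local minimum `i` of `α`, and the
slopes next to it. If the descent to `i` starts at a peak, the tiles above the minimum fill the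
rectangle between the two slopes (`stack_single`); if it starts at the left boundary, they fill a
trapezoid that is cut off by the boundary (`stack_tri_single`). Removing them leaves a higher path
`γ`. As all the neighbouring valleys are at most as high, the contents in the removed region are
the heights above the minimum, and the contents of all other tiles are the same for `α` and `γ`
(`content_of_lt`, `content_congr`). As contents strictly increase upwards among adjacent tiles, and
operators of tiles that are not adjacent commute, all admissible orders give the same product
(`prod_eq_of_perm`), so that the removed tiles can be taken first.

It remains to evaluate the rectangle or trapezoid `v`, as a function of paths. By the Yang-Baxter
and the reflection equation, `v` inherits from the straight pieces of `γ` that it vanishes on paths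
with a local maximum at any position above it, the lower corner excepted (`kill_tri`,
`kill_stack`); at that corner it does so since the content there is `1` (`kill_tile_one`). Moreover
`v` is supported on paths above `α` that coincide with `α` outside of the region (`Above.stack`,
`AgreeOn.stack`). A path between two given points without local maximum is a descent followed by an
ascent. For the rectangle only `α` is left, with the value `1`. For the trapezoid, the left end is
free, and there are the paths that descend from the boundary to `i + k` and then ascend. Their
values satisfy a recursion, column by column, whose solution is a product of values of `k(u/2, ν)`
(`stack_vee`, `veeCoeff_succ`). For `k ≥ 1` and the lowest content `1`, the choice
`ν = ω + (u mod 2)` makes its first factor vanish (`veeCoeff_one`).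

The hypothesis `η = 0 ∨ exp η - exp (-η) ≠ 0` of many lemmas says that the q-numbers have no
vanishing denominator; it follows from `[ω + 1] ≠ 0`.
-/

namespace QKZ

noncomputable section

open scoped Classical

variable {N : ℕ}

/-! ### Identities for q-numbers -/

/-- For `exp (2 η) = 1`, `η ≠ 0`, all q-numbers have the junk value `x / 0 = 0`. -/
lemma exp_sub_ne_zero_of_qnum_ne {η u : ℂ} (h : qnum η u ≠ 0) :
    η = 0 ∨ Complex.exp η - Complex.exp (-η) ≠ 0 := by
  by_cases h0 : η = 0
  · exact Or.inl h0
  · refine Or.inr fun h1 => h ?_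
    simp [qnum, h0, h1]

lemma qnum_zero (η : ℂ) : qnum η 0 = 0 := by
  by_cases h0 : η = 0 <;> simp [qnum, h0]

lemma qnum_one {η : ℂ} (hη : η = 0 ∨ Complex.exp η - Complex.exp (-η) ≠ 0) : qnum η 1 = 1 := by
  by_cases h0 : η = 0
  · simp [qnum, h0]
  · simp [qnum, h0, div_self (hη.resolve_left h0)]

lemma qnum_neg (η u : ℂ) : qnum η (-u) = -qnum η u := by
  by_cases h0 : η = 0
  · simp [qnum, h0]
  · simp only [qnum, h0, if_false, mul_neg, neg_neg]
    ring

/-- The addition theorem behind the identities between the boundary weights `k(u, ν)`. -/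
lemma qnum_mul_sub_mul (η a b x y : ℂ) :
    qnum η (a + y) * qnum η (b + y) - qnum η (a - x) * qnum η (b - x)
      = qnum η (a + b + y - x) * qnum η (x + y) := by
  by_cases h0 : η = 0
  · simp only [qnum, h0, if_true]; ring
  · simp only [qnum, h0, if_false, div_mul_div_comm, ← sub_div]
    congr 1
    have e : ∀ u v : ℂ, Complex.exp (η * (u + v)) = Complex.exp (η * u) * Complex.exp (η * v) :=
      fun u v => by rw [← Complex.exp_add]; ring_nf
    have e' : ∀ u v : ℂ, Complex.exp (η * (u - v))
        = Complex.exp (η * u) * (Complex.exp (η * v))⁻¹ :=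
      fun u v => by rw [← Complex.exp_neg, ← Complex.exp_add]; ring_nf
    have ha := Complex.exp_ne_zero (η * a)
    have hb := Complex.exp_ne_zero (η * b)
    have hx := Complex.exp_ne_zero (η * x)
    have hy := Complex.exp_ne_zero (η * y)
    simp only [Complex.exp_neg, e, e']
    field_simp
    ring

lemma qnum_add_one_add_sub_one {η : ℂ}
    (hη : η = 0 ∨ Complex.exp η - Complex.exp (-η) ≠ 0) (u : ℂ) :
    qnum η (u + 1) + qnum η (u - 1) = qnum η 2 * qnum η u := by
  by_cases h0 : η = 0
  · simp only [qnum, h0, if_true]; ring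
  · have hd := hη.resolve_left h0
    have e1 : Complex.exp (η * 2) = Complex.exp η * Complex.exp η := by
      rw [← Complex.exp_add]; ring_nf
    have e2 : Complex.exp (η * (u + 1)) = Complex.exp (η * u) * Complex.exp η := by
      rw [← Complex.exp_add]; ring_nf
    have e3 : Complex.exp (η * (u - 1)) = Complex.exp (η * u) * (Complex.exp η)⁻¹ := by
      rw [← Complex.exp_neg, ← Complex.exp_add]; ring_nf
    simp only [qnum, h0, if_false, ← add_div, div_mul_div_comm]
    rw [div_eq_div_iff hd (mul_ne_zero hd hd)]
    have hu := Complex.exp_ne_zero (η * u)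
    have h1 := Complex.exp_ne_zero η
    simp only [Complex.exp_neg, e1, e2, e3]
    field_simp
    ring

/-! ### The generators on Ballot paths -/

lemma BallotPath.ht_last (α : BallotPath N) : α.ht N = 0 := α.tail N le_rfl

lemma BallotPath.ext_ht {α β : BallotPath N} (h : ∀ m, α.ht m = β.ht m) : α = β :=
  BallotPath.ext (funext h)

lemma BallotPath.ht_add_le (α : BallotPath N) {l : ℕ} (hl : l ≤ N) : α.ht l + l ≤ N := by
  induction hl using Nat.decreasingInduction with
  | self => simp [α.ht_last]
  | of_succ k hk ih =>
    have := α.step k hk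
    push_cast at ih
    omega

lemma eq_add_of_ascent {f : ℕ → ℤ} {m x : ℕ}
    (h : ∀ l, m ≤ l → l < x → f (l + 1) = f l + 1) {l : ℕ} (hml : m ≤ l) (hlx : l ≤ x) :
    f l = f m + (l - m : ℕ) := by
  induction l, hml using Nat.le_induction with
  | base => simp
  | succ l hml ih =>
    rw [h l hml (by omega), ih (by omega)]
    omega

lemma eq_sub_of_descent {f : ℕ → ℤ} {m x : ℕ}
    (h : ∀ l, m ≤ l → l < x → f (l + 1) = f l - 1) {l : ℕ} (hml : m ≤ l) (hlx : l ≤ x) :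
    f l = f m - (l - m : ℕ) := by
  induction l, hml using Nat.le_induction with
  | base => simp
  | succ l hml ih =>
    rw [h l hml (by omega), ih (by omega)]
    omega

/-- The path `α` has a local maximum at the interior position `i`. -/
def IsMax (α : BallotPath N) (i : ℕ) : Prop :=
  1 ≤ i ∧ α.ht (i - 1) < α.ht i ∧ α.ht (i + 1) < α.ht i

/-- The height function of the path that the generator `e_i` assigns to `α`. -/
def actHt (i : ℕ) (α : BallotPath N) : ℕ → ℤ :=
  if i = 0 then
    if α.ht 0 < α.ht 1 then fun m => if m = 0 then α.ht m + 2 else α.ht m else α.ht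
  else if α.ht i < α.ht (i - 1) ∧ α.ht i < α.ht (i + 1) then
    fun m => if m = i then α.ht m + 2 else α.ht m
  else if α.ht (i - 1) < α.ht i ∧ α.ht (i + 1) < α.ht i then α.ht
  else if α.ht (i - 1) < α.ht i then
    fun m => if i < m ∧ (∀ l, i < l → l ≤ m → α.ht i < α.ht l) then α.ht m - 2 else α.ht m
  else
    fun m => if m < i ∧ (∀ l, m ≤ l → l < i → α.ht i < α.ht l) then α.ht m - 2 else α.ht m

/-- The path `β` with `e_i |α⟩ = c |β⟩`; every generator maps a state to a multiple of a state. -/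
def act (i : ℕ) (α : BallotPath N) : BallotPath N :=
  if h : ∃ β : BallotPath N, β.ht = actHt i α then h.choose else α

/-- The factor `c` in `e_i |α⟩ = c |act i α⟩`. -/
def wt (η ω : ℂ) (i : ℕ) (α : BallotPath N) : ℂ :=
  if i = 0 then
    if α.ht 0 < α.ht 1 then 1 else -(qnum η ω / qnum η (ω + 1))
  else if α.ht i < α.ht (i - 1) ∧ α.ht i < α.ht (i + 1) then 1
  else if α.ht (i - 1) < α.ht i ∧ α.ht (i + 1) < α.ht i then -(qnum η 2)
  else if α.ht (i - 1) < α.ht i then 1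
  else if (∀ k, k < i → α.ht i < α.ht k) ∧ Even i then -(qnum η ω / qnum η (ω + 1)) else 1

/-- An uphill slope returns to its height on the right. -/
lemma exists_return_right (α : BallotPath N) {i : ℕ} (hi : i < N) (h : α.ht i < α.ht (i + 1)) :
    ∃ r, i + 1 < r ∧ r ≤ N ∧ α.ht r = α.ht i ∧ ∀ l, i < l → l < r → α.ht i < α.ht l := by
  have hex : ∃ r, i < r ∧ α.ht r ≤ α.ht i :=
    ⟨N, hi, by rw [α.ht_last]; exact α.nonneg i⟩
  have h1 := Nat.find_spec hex
  have h2 : ∀ l, i < l → l < Nat.find hex → α.ht i < α.ht l := fun l hl hl' => by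
    have := Nat.find_min hex hl'
    push Not at this
    exact this hl
  have h3 : Nat.find hex ≤ N := Nat.find_min' hex ⟨hi, by rw [α.ht_last]; exact α.nonneg i⟩
  obtain ⟨r, hr⟩ : ∃ r, r = Nat.find hex := ⟨_, rfl⟩
  rw [← hr] at h1 h2 h3
  have hne : r ≠ i + 1 := by rintro rfl; omega
  obtain ⟨r', rfl⟩ : ∃ r', r = r' + 1 := ⟨r - 1, by omega⟩
  have h4 := h2 r' (by omega) (by omega)
  have h5 := α.step r' (by omega)
  exact ⟨r' + 1, by omega, h3, by omega, h2⟩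

/-- A downhill slope either was visited at its height before, or it is lower than all of the path
to its left. -/
lemma exists_return_left (α : BallotPath N) {i : ℕ} (h0 : 1 ≤ i) (hi : i < N)
    (h : α.ht i < α.ht (i - 1)) :
    (∃ k, k + 1 < i ∧ α.ht k = α.ht i ∧ ∀ l, k < l → l < i → α.ht i < α.ht l) ∨
      ∀ l, l < i → α.ht i < α.ht l := by
  by_cases hall : ∀ l, l < i → α.ht i < α.ht l
  · exact Or.inr hall
  · left
    push Not at hall
    obtain ⟨l₀, hl₀, hl₀'⟩ := hall
    have hs := Nat.findGreatest_spec (P := fun k => α.ht k ≤ α.ht i) (n := i - 1)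
      (by omega : l₀ ≤ i - 1) hl₀'
    have hle := Nat.findGreatest_le (P := fun k => α.ht k ≤ α.ht i) (i - 1)
    have hgt : ∀ l, Nat.findGreatest (fun k => α.ht k ≤ α.ht i) (i - 1) < l → l < i →
        α.ht i < α.ht l := fun l hl hl' => by
      have := Nat.findGreatest_is_greatest (P := fun k => α.ht k ≤ α.ht i) hl (by omega)
      omega
    obtain ⟨k, hk⟩ : ∃ k, k = Nat.findGreatest (fun k => α.ht k ≤ α.ht i) (i - 1) := ⟨_, rfl⟩
    rw [← hk] at hs hle hgt
    have hne : k ≠ i - 1 := by rintro rfl; omega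
    have h4 := hgt (k + 1) (by omega) (by omega)
    have h5 := α.step k (by omega)
    exact ⟨k, by omega, by omega, hgt⟩

lemma act_ht_of_exists {i : ℕ} {α : BallotPath N} (h : ∃ β : BallotPath N, β.ht = actHt i α) :
    (act i α).ht = actHt i α := by
  rw [act, dif_pos h]
  exact h.choose_spec

lemma exists_ballotPath {f : ℕ → ℤ} (h0 : ∀ i, 0 ≤ f i)
    (h1 : ∀ i, i < N → f (i + 1) = f i + 1 ∨ f (i + 1) = f i - 1) (h2 : ∀ i, N ≤ i → f i = 0) :
    ∃ β : BallotPath N, β.ht = f :=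
  ⟨⟨f, h0, h1, h2⟩, rfl⟩

lemma exists_ht_raise (α : BallotPath N) {i : ℕ} (hi : i < N)
    (hl : 1 ≤ i → α.ht i < α.ht (i - 1)) (hr : α.ht i < α.ht (i + 1)) :
    ∃ β : BallotPath N, β.ht = fun m => if m = i then α.ht m + 2 else α.ht m := by
  refine exists_ballotPath (fun m => ?_) (fun m hm => ?_) (fun m hm => ?_)
  · have := α.nonneg m
    split_ifs <;> omega
  · have := α.step m hm
    by_cases h1 : m = i
    · subst h1
      simp only [if_true, Nat.succ_ne_self, if_false]
      omega
    · by_cases h2 : m + 1 = i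
      · subst h2
        have := hl (by omega)
        simp only [Nat.add_sub_cancel] at this
        simp only [if_true, h1, if_false]
        omega
      · simp only [h1, h2, if_false]
        exact this
  · have := α.tail m hm
    have h1 : m ≠ i := by omega
    simp [h1, this]

lemma exists_ht_lower (α : BallotPath N) {k r : ℕ} (hkr : k + 1 < r) (hr : r ≤ N)
    (hk : α.ht r = α.ht k) (h1 : 1 ≤ α.ht k) (h : ∀ l, k < l → l < r → α.ht k < α.ht l) :
    ∃ β : BallotPath N, β.ht = fun m => if k < m ∧ m < r then α.ht m - 2 else α.ht m := by
  refine exists_ballotPath (fun m => ?_) (fun m hm => ?_) (fun m hm => ?_)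
  · have := α.nonneg m
    have := h m
    split_ifs <;> omega
  · have := α.step m hm
    have a := h m
    have b := h (m + 1)
    by_cases h2 : m = k
    · subst h2
      rw [if_pos (by omega), if_neg (by omega)]
      omega
    · by_cases h3 : m + 1 = r
      · subst h3
        rw [if_neg (by omega), if_pos (by omega)]
        omega
      · by_cases h4 : k < m ∧ m < r
        · rw [if_pos (by omega), if_pos (by omega)]; omega
        · rw [if_neg (by omega), if_neg (by omega)]; omega
  · have := α.tail m hm
    rw [if_neg (by omega), this]

lemma exists_ht_lower_left (α : BallotPath N) {r : ℕ} (hr : r ≤ N)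
    (h1 : 1 ≤ α.ht r) (h : ∀ l, l < r → α.ht r < α.ht l) :
    ∃ β : BallotPath N, β.ht = fun m => if m < r then α.ht m - 2 else α.ht m := by
  refine exists_ballotPath (fun m => ?_) (fun m hm => ?_) (fun m hm => ?_)
  · have := α.nonneg m
    have := h m
    split_ifs <;> omega
  · have := α.step m hm
    have a := h m
    by_cases h3 : m + 1 = r
    · subst h3
      rw [if_neg (by omega), if_pos (by omega)]
      omega
    · by_cases h4 : m < r
      · rw [if_pos (by omega), if_pos (by omega)]; omega
      · rw [if_neg (by omega), if_neg (by omega)]; omega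
  · have := α.tail m hm
    rw [if_neg (by omega), this]

/-! #### The action in each of the local configurations -/

lemma act_zero_raise {α : BallotPath N} (hN : 0 < N) (h : α.ht 0 < α.ht 1) (m : ℕ) :
    (act 0 α).ht m = if m = 0 then α.ht m + 2 else α.ht m := by
  rw [act_ht_of_exists] <;> simp only [actHt, if_true, h]
  exact exists_ht_raise α hN (by omega) h

lemma act_zero_down {α : BallotPath N} (h : α.ht 1 < α.ht 0) : act 0 α = α := by
  apply BallotPath.ext
  rw [act_ht_of_exists] <;> simp only [actHt, if_true, h.not_gt, if_false]
  exact ⟨α, rfl⟩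

lemma act_max {α : BallotPath N} {i : ℕ} (h : IsMax α i) : act i α = α := by
  obtain ⟨h0, h1, h2⟩ := h
  have : actHt i α = α.ht := by
    rw [actHt, if_neg (by omega), if_neg (by omega), if_pos ⟨h1, h2⟩]
  apply BallotPath.ext
  rw [act_ht_of_exists] <;> rw [this]
  exact ⟨α, rfl⟩

lemma act_min {α : BallotPath N} {i : ℕ} (h0 : 1 ≤ i) (hi : i < N) (h1 : α.ht i < α.ht (i - 1))
    (h2 : α.ht i < α.ht (i + 1)) (m : ℕ) :
    (act i α).ht m = if m = i then α.ht m + 2 else α.ht m := by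
  have : actHt i α = fun m => if m = i then α.ht m + 2 else α.ht m := by
    rw [actHt, if_neg (by omega), if_pos ⟨h1, h2⟩]
  rw [act_ht_of_exists] <;> rw [this]
  exact exists_ht_raise α hi (fun _ => h1) h2

lemma act_up {α : BallotPath N} {i r : ℕ} (h0 : 1 ≤ i) (h1 : α.ht (i - 1) < α.ht i)
    (hir : i + 1 < r) (hr : r ≤ N) (hk : α.ht r = α.ht i)
    (h : ∀ l, i < l → l < r → α.ht i < α.ht l) (m : ℕ) :
    (act i α).ht m = if i < m ∧ m < r then α.ht m - 2 else α.ht m := by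
  have h2 := h (i + 1) (by omega) hir
  have : actHt i α = fun m => if i < m ∧ m < r then α.ht m - 2 else α.ht m := by
    rw [actHt, if_neg (by omega), if_neg (by omega), if_neg (by omega), if_pos h1]
    funext m
    refine if_congr ⟨fun ⟨ha, hb⟩ => ⟨ha, ?_⟩, fun ⟨ha, hb⟩ => ⟨ha, fun l hl hl' =>
      h l hl (by omega)⟩⟩ rfl rfl
    by_contra hc
    have := hb r (by omega) (by omega)
    omega
  rw [act_ht_of_exists] <;> rw [this]
  have := α.nonneg (i - 1)
  exact exists_ht_lower α hir hr hk (by omega) h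

lemma act_down {α : BallotPath N} {i k : ℕ} (hi : i < N) (h1 : α.ht (i + 1) < α.ht i)
    (hki : k + 1 < i) (hk : α.ht k = α.ht i)
    (h : ∀ l, k < l → l < i → α.ht i < α.ht l) (m : ℕ) :
    (act i α).ht m = if k < m ∧ m < i then α.ht m - 2 else α.ht m := by
  have h2 := h (i - 1) (by omega) (by omega)
  have : actHt i α = fun m => if k < m ∧ m < i then α.ht m - 2 else α.ht m := by
    rw [actHt, if_neg (by omega), if_neg (by omega), if_neg (by omega), if_neg (by omega)]
    funext m
    refine if_congr ⟨fun ⟨ha, hb⟩ => ⟨?_, ha⟩, fun ⟨ha, hb⟩ => ⟨hb, fun l hl hl' =>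
      h l (by omega) hl'⟩⟩ rfl rfl
    by_contra hc
    have := hb k (by omega) (by omega)
    omega
  rw [act_ht_of_exists] <;> rw [this]
  have := α.nonneg (i + 1)
  exact exists_ht_lower α hki hi.le hk.symm (by omega) (by rwa [hk])

lemma act_free {α : BallotPath N} {i : ℕ} (h0 : 1 ≤ i) (hi : i < N) (h1 : α.ht (i + 1) < α.ht i)
    (h : ∀ l, l < i → α.ht i < α.ht l) (m : ℕ) :
    (act i α).ht m = if m < i then α.ht m - 2 else α.ht m := by
  have h2 := h (i - 1) (by omega)
  have : actHt i α = fun m => if m < i then α.ht m - 2 else α.ht m := by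
    rw [actHt, if_neg (by omega), if_neg (by omega), if_neg (by omega), if_neg (by omega)]
    funext m
    exact if_congr ⟨fun ⟨ha, hb⟩ => ha, fun ha => ⟨ha, fun l hl hl' => h l hl'⟩⟩ rfl rfl
  rw [act_ht_of_exists] <;> rw [this]
  have := α.nonneg (i + 1)
  exact exists_ht_lower_left α hi.le (by omega) h

lemma wt_zero_raise (η ω : ℂ) {α : BallotPath N} (h : α.ht 0 < α.ht 1) : wt η ω 0 α = 1 := by
  simp [wt, h]

lemma wt_zero_down (η ω : ℂ) {α : BallotPath N} (h : α.ht 1 < α.ht 0) :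
    wt η ω 0 α = -(qnum η ω / qnum η (ω + 1)) := by
  simp [wt, h.not_gt]

lemma wt_max (η ω : ℂ) {α : BallotPath N} {i : ℕ} (h : IsMax α i) : wt η ω i α = -qnum η 2 := by
  obtain ⟨h0, h1, h2⟩ := h
  rw [wt, if_neg (by omega), if_neg (by omega), if_pos ⟨h1, h2⟩]

lemma wt_min (η ω : ℂ) {α : BallotPath N} {i : ℕ} (h0 : 1 ≤ i) (h1 : α.ht i < α.ht (i - 1))
    (h2 : α.ht i < α.ht (i + 1)) : wt η ω i α = 1 := by
  rw [wt, if_neg (by omega), if_pos ⟨h1, h2⟩]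

lemma wt_up (η ω : ℂ) {α : BallotPath N} {i : ℕ} (h0 : 1 ≤ i) (h1 : α.ht (i - 1) < α.ht i)
    (h2 : α.ht i < α.ht (i + 1)) : wt η ω i α = 1 := by
  rw [wt, if_neg (by omega), if_neg (by omega), if_neg (by omega), if_pos h1]

lemma wt_down (η ω : ℂ) {α : BallotPath N} {i k : ℕ} (h1 : α.ht (i + 1) < α.ht i)
    (hki : k + 1 < i) (hk : α.ht k = α.ht i)
    (h : ∀ l, k < l → l < i → α.ht i < α.ht l) : wt η ω i α = 1 := by
  have h2 := h (i - 1) (by omega) (by omega)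
  rw [wt, if_neg (by omega), if_neg (by omega), if_neg (by omega), if_neg (by omega), if_neg]
  rintro ⟨h3, -⟩
  have := h3 k (by omega)
  omega

/-- The weight of a downhill slope that lies lower than all of the path to its left. -/
def freeWt (η ω : ℂ) (i : ℕ) : ℂ := if Even i then -(qnum η ω / qnum η (ω + 1)) else 1

lemma wt_free (η ω : ℂ) {α : BallotPath N} {i : ℕ} (h0 : 1 ≤ i) (h1 : α.ht (i + 1) < α.ht i)
    (h : ∀ l, l < i → α.ht i < α.ht l) : wt η ω i α = freeWt η ω i := by
  have h2 := h (i - 1) (by omega)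
  rw [wt, if_neg (by omega), if_neg (by omega), if_neg (by omega), if_neg (by omega), freeWt]
  exact if_congr ⟨fun h => h.2, fun h' => ⟨h, h'⟩⟩ rfl rfl

/-! ### Local configurations -/

/-- The path `α` has a local minimum at the interior position `i`. -/
def IsMin (α : BallotPath N) (i : ℕ) : Prop :=
  1 ≤ i ∧ α.ht i < α.ht (i - 1) ∧ α.ht i < α.ht (i + 1)

/-- The path `α` has an uphill slope at `i`, and `r > i` is the first return to its height. -/
def IsUp (α : BallotPath N) (i r : ℕ) : Prop :=
  1 ≤ i ∧ α.ht (i - 1) < α.ht i ∧ i + 1 < r ∧ r ≤ N ∧ α.ht r = α.ht i ∧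
    ∀ l, i < l → l < r → α.ht i < α.ht l

/-- The path `α` has a downhill slope at `i`, and `k < i` is the last earlier visit of its
height. -/
def IsDown (α : BallotPath N) (k i : ℕ) : Prop :=
  α.ht (i + 1) < α.ht i ∧ k + 1 < i ∧ α.ht k = α.ht i ∧ ∀ l, k < l → l < i → α.ht i < α.ht l

/-- The path `α` has a downhill slope at `i` that lies lower than all of the path to its left. -/
def IsFree (α : BallotPath N) (i : ℕ) : Prop :=
  1 ≤ i ∧ α.ht (i + 1) < α.ht i ∧ ∀ l, l < i → α.ht i < α.ht l

lemma config_cases (α : BallotPath N) {i : ℕ} (h0 : 1 ≤ i) (hi : i < N) :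
    IsMax α i ∨ IsMin α i ∨ (∃ r, IsUp α i r) ∨ (∃ k, IsDown α k i) ∨ IsFree α i := by
  have h1 := α.step i hi
  have h2 := α.step (i - 1) (by omega)
  rw [Nat.sub_add_cancel h0] at h2
  rcases h1 with h1 | h1 <;> rcases h2 with h2 | h2
  · obtain ⟨r, hr⟩ := exists_return_right α hi (by omega)
    exact Or.inr (Or.inr (Or.inl ⟨r, h0, by omega, hr.1, hr.2⟩))
  · exact Or.inr (Or.inl ⟨h0, by omega, by omega⟩)
  · exact Or.inl ⟨h0, by omega, by omega⟩
  · rcases exists_return_left α h0 hi (by omega) with ⟨k, hk⟩ | h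
    · exact Or.inr (Or.inr (Or.inr (Or.inl ⟨k, by omega, hk⟩)))
    · exact Or.inr (Or.inr (Or.inr (Or.inr ⟨h0, by omega, h⟩)))

lemma IsMin.act {α : BallotPath N} {i : ℕ} (h : IsMin α i) (hi : i < N) (m : ℕ) :
    (act i α).ht m = if m = i then α.ht m + 2 else α.ht m :=
  act_min h.1 hi h.2.1 h.2.2 m

lemma IsUp.act {α : BallotPath N} {i r : ℕ} (h : IsUp α i r) (m : ℕ) :
    (act i α).ht m = if i < m ∧ m < r then α.ht m - 2 else α.ht m :=
  act_up h.1 h.2.1 h.2.2.1 h.2.2.2.1 h.2.2.2.2.1 h.2.2.2.2.2 m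

lemma IsDown.act {α : BallotPath N} {i k : ℕ} (h : IsDown α k i) (hi : i < N) (m : ℕ) :
    (act i α).ht m = if k < m ∧ m < i then α.ht m - 2 else α.ht m :=
  act_down hi h.1 h.2.1 h.2.2.1 h.2.2.2 m

lemma IsFree.act {α : BallotPath N} {i : ℕ} (h : IsFree α i) (hi : i < N) (m : ℕ) :
    (act i α).ht m = if m < i then α.ht m - 2 else α.ht m :=
  act_free h.1 hi h.2.1 h.2.2 m

lemma IsMin.wt (η ω : ℂ) {α : BallotPath N} {i : ℕ} (h : IsMin α i) : wt η ω i α = 1 :=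
  wt_min η ω h.1 h.2.1 h.2.2

lemma IsUp.wt (η ω : ℂ) {α : BallotPath N} {i r : ℕ} (h : IsUp α i r) : wt η ω i α = 1 :=
  wt_up η ω h.1 h.2.1 (h.2.2.2.2.2 _ (by omega) h.2.2.1)

lemma IsDown.wt (η ω : ℂ) {α : BallotPath N} {i k : ℕ} (h : IsDown α k i) : wt η ω i α = 1 :=
  wt_down η ω h.1 h.2.1 h.2.2.1 h.2.2.2

lemma IsFree.wt (η ω : ℂ) {α : BallotPath N} {i : ℕ} (h : IsFree α i) :
    wt η ω i α = freeWt η ω i :=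
  wt_free η ω h.1 h.2.1 h.2.2

/-- A generator creates a local maximum. -/
lemma act_isMax (α : BallotPath N) {i : ℕ} (h0 : 1 ≤ i) (hi : i < N) : IsMax (act i α) i := by
  rcases config_cases α h0 hi with h | h | ⟨r, h⟩ | ⟨k, h⟩ | h
  · rwa [act_max h]
  · have := α.step i hi
    have := α.step (i - 1) (by omega)
    have H := h.act hi
    obtain ⟨h1, h2, h3⟩ := h
    rw [Nat.sub_add_cancel h0] at this
    refine ⟨h0, ?_, ?_⟩ <;> rw [H, H] <;> split_ifs <;> omega
  · have := α.step i hi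
    have H := h.act
    obtain ⟨h1, h2, h3, h4, h5, h6⟩ := h
    refine ⟨h0, ?_, ?_⟩ <;> rw [H, H] <;> split_ifs <;> omega
  · have := α.step (i - 1) (by omega)
    rw [Nat.sub_add_cancel h0] at this
    have H := h.act hi
    obtain ⟨h1, h2, h3, h4⟩ := h
    refine ⟨h0, ?_, ?_⟩ <;> rw [H, H] <;> split_ifs <;> omega
  · have := α.step (i - 1) (by omega)
    rw [Nat.sub_add_cancel h0] at this
    have H := h.act hi
    obtain ⟨h1, h2, h3⟩ := h
    refine ⟨h0, ?_, ?_⟩ <;> rw [H, H] <;> split_ifs <;> omega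

lemma act_ht_le (α : BallotPath N) {i : ℕ} (hi : i < N) (l : ℕ) :
    (act i α).ht l ≤ if l = i then α.ht l + 2 else α.ht l := by
  rcases Nat.eq_zero_or_pos i with rfl | h0
  · have := α.step 0 hi
    rw [zero_add] at this
    rcases this with h | h
    · rw [act_zero_raise hi (by omega)]
    · rw [act_zero_down (by omega)]; split_ifs <;> omega
  · rcases config_cases α h0 hi with h | h | ⟨r, h⟩ | ⟨k, h⟩ | h
    · rw [act_max h]; split_ifs <;> omega
    · rw [h.act hi]
    · rw [h.act]; split_ifs <;> omega
    · rw [h.act hi]; split_ifs <;> omega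
    · rw [h.act hi]; split_ifs <;> omega

/-- A generator does not destroy a local maximum at a position that is not adjacent. -/
lemma IsMax.act_of_far {α : BallotPath N} {i j : ℕ} (hi : i < N) (hj : j < N)
    (hij : i + 2 ≤ j ∨ j + 2 ≤ i) (h : IsMax α j) : IsMax (act i α) j := by
  have s1 := α.step j hj
  have s2 := α.step (j - 1) (by omega)
  obtain ⟨j0, j1, j2⟩ := h
  rw [Nat.sub_add_cancel j0] at s2
  rcases Nat.eq_zero_or_pos i with rfl | h0
  · have := α.step 0 hi
    rw [zero_add] at this
    rcases this with h | h
    · have H := act_zero_raise hi (by omega : α.ht 0 < α.ht 1)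
      refine ⟨j0, ?_, ?_⟩ <;> rw [H, H] <;> split_ifs <;> grind
    · rw [act_zero_down (by omega)]; exact ⟨j0, j1, j2⟩
  · rcases config_cases α h0 hi with h | h | ⟨r, h⟩ | ⟨k, h⟩ | h
    · rw [act_max h]; exact ⟨j0, j1, j2⟩
    · have H := h.act hi
      refine ⟨j0, ?_, ?_⟩ <;> rw [H, H] <;> split_ifs <;> omega
    · have H := h.act
      obtain ⟨h1, h2, h3, h4, h5, h6⟩ := h
      have a := h6 j
      have b := h6 (j - 1)
      have c := h6 (j + 1)
      have e : r ≠ j := by grind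
      refine ⟨j0, ?_, ?_⟩ <;> rw [H, H] <;> split_ifs <;> grind
    · have H := h.act hi
      obtain ⟨h1, h2, h3, h4⟩ := h
      refine ⟨j0, ?_, ?_⟩ <;> rw [H, H] <;> split_ifs <;> grind
    · have H := h.act hi
      obtain ⟨h1, h2, h3⟩ := h
      refine ⟨j0, ?_, ?_⟩ <;> rw [H, H] <;> split_ifs <;> grind

lemma act_ht_eq (α : BallotPath N) {i : ℕ} (h0 : 1 ≤ i) (hi : i < N) :
    (act i α).ht = actHt i α := by
  by_cases hex : ∃ β : BallotPath N, β.ht = actHt i α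
  · exact act_ht_of_exists hex
  -- `act` falls back to `α` only if there is no path with the required heights; but only a local
  -- maximum is left unchanged.
  have hact : act i α = α := by rw [act, dif_neg hex]
  exfalso
  rcases config_cases α h0 hi with h | h | ⟨r, h⟩ | ⟨k, h⟩ | h
  · refine hex ⟨α, ?_⟩
    rw [actHt, if_neg (by omega), if_neg (by obtain ⟨_, _, _⟩ := h; omega), if_pos h.2]
  · have := h.act hi i
    rw [hact, if_pos rfl] at this
    omega
  · have := h.act (i + 1)
    rw [hact, if_pos ⟨by omega, h.2.2.1⟩] at this
    omega
  · have := h.act hi (i - 1)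
    have h' := h.2.1
    rw [hact, if_pos (by omega)] at this
    omega
  · have := h.act hi (i - 1)
    rw [hact, if_pos (by omega)] at this
    omega

lemma BallotPath.ht_parity (α : BallotPath N) {i : ℕ} (hi : i ≤ N) :
    (α.ht i + i - N) % 2 = 0 := by
  induction hi using Nat.decreasingInduction with
  | self => simp [α.ht_last]
  | of_succ k hk ih =>
    have := α.step k hk
    push_cast at ih
    omega

lemma ket_ht (α : BallotPath N) : ket N α.ht = Finsupp.single α 1 := by
  have h : ∃ β : BallotPath N, β.ht = α.ht := ⟨α, rfl⟩
  rw [ket, dif_pos h, BallotPath.ext h.choose_spec]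

/-- Every generator maps a state to a multiple of a state. -/
lemma genKet_eq (η ω : ℂ) (α : BallotPath N) {i : ℕ} (hi : i < N) :
    genKet η ω i α = wt η ω i α • Finsupp.single (act i α) 1 := by
  rcases Nat.eq_zero_or_pos i with rfl | h0
  · have := α.step 0 hi
    rw [zero_add] at this
    rcases this with h | h
    · have h' : α.ht 0 < α.ht 1 := by omega
      rw [← ket_ht, funext (act_zero_raise hi h')]
      simp [genKet, wt, h']
    · have h' : α.ht 1 < α.ht 0 := by omega
      simp [genKet, act_zero_down h', wt, h'.not_gt]
  · rw [← ket_ht, act_ht_eq α h0 hi]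
    have hi0 : i ≠ 0 := by omega
    unfold genKet actHt wt
    simp only [hi0, if_false]
    by_cases h1 : α.ht i < α.ht (i - 1) ∧ α.ht i < α.ht (i + 1)
    · simp only [if_pos h1, one_smul]
    · by_cases h2 : α.ht (i - 1) < α.ht i ∧ α.ht (i + 1) < α.ht i
      · simp only [if_neg h1, if_pos h2, ket_ht]
      · by_cases h3 : α.ht (i - 1) < α.ht i
        · simp only [if_neg h1, if_neg h2, if_pos h3, one_smul]
        · simp only [if_neg h1, if_neg h2, if_neg h3]

/-! ### Commutation of distant generators -/

/-- The relation `e_i e_j = e_j e_i`, on the state of `α`. -/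
def ActCommute (η ω : ℂ) (i j : ℕ) (α : BallotPath N) : Prop :=
  act j (act i α) = act i (act j α) ∧
    wt η ω i α * wt η ω j (act i α) = wt η ω j α * wt η ω i (act j α)

lemma comm_min_min (η ω : ℂ) {α : BallotPath N} {i j : ℕ} (hij : i + 2 ≤ j) (hi : i < N)
    (hj : j < N) (h : IsMin α i) (h' : IsMin α j) :
    ActCommute η ω i j α := by
  have H := h.act hi
  have H' := h'.act hj
  have g : IsMin (act i α) j := by clear H'; unfold IsMin at *; grind
  have g' : IsMin (act j α) i := by clear g H; unfold IsMin at *; grind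
  refine ⟨BallotPath.ext_ht fun m => ?_, by rw [g.wt, g'.wt, h.wt, h'.wt]⟩
  rw [g.act hj, g'.act hi]
  simp only [H, H']
  clear g g'; unfold IsMin at *; grind

lemma comm_min_up (η ω : ℂ) {α : BallotPath N} {i j r' : ℕ} (hij : i + 2 ≤ j) (hi : i < N)
    (h : IsMin α i) (h' : IsUp α j r') :
    ActCommute η ω i j α := by
  have H := h.act hi
  have H' := h'.act
  have g : IsUp (act i α) j r' := by clear H'; unfold IsMin IsUp at *; grind
  have g' : IsMin (act j α) i := by clear g H; unfold IsMin IsUp at *; grind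
  refine ⟨BallotPath.ext_ht fun m => ?_, by rw [g.wt, g'.wt, h.wt, h'.wt]⟩
  rw [g.act, g'.act hi]
  simp only [H, H']
  clear g g'; unfold IsMin IsUp at *; grind

lemma comm_min_down (η ω : ℂ) {α : BallotPath N} {i j k' : ℕ} (hij : i + 2 ≤ j) (hi : i < N)
    (hj : j < N) (h : IsMin α i) (h' : IsDown α k' j) :
    ActCommute η ω i j α := by
  by_cases hk : k' = i
  · subst hk
    -- After either of the generators, the other one sees a downhill slope.
    have hp := α.ht_parity hi.le
    have hp' := α.ht_parity hj.le
    have s1 := α.step k' hi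
    rcases exists_return_left α h.1 hi h.2.1 with ⟨k, hk⟩ | hk
    · have H := h.act hi
      have H' := h'.act hj
      have g : IsDown (act k' α) k j := by clear H'; unfold IsDown IsMin at *; grind
      have g' : IsDown (act j α) k k' := by clear g H; unfold IsDown IsMin at *; grind
      refine ⟨BallotPath.ext_ht fun m => ?_, by rw [g.wt, g'.wt, h.wt, h'.wt]⟩
      rw [g.act hj, g'.act hi]
      simp only [H, H']
      clear g g'; unfold IsDown IsMin at *; grind
    · have H := h.act hi
      have H' := h'.act hj
      have e : freeWt η ω j = freeWt η ω k' := by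
        have h1 := h'.2.2.1
        unfold freeWt
        exact if_congr (by rw [Nat.even_iff, Nat.even_iff]; omega) rfl rfl
      have g : IsFree (act k' α) j := by clear H'; unfold IsDown IsFree IsMin at *; grind
      have g' : IsFree (act j α) k' := by clear g H; unfold IsDown IsFree IsMin at *; grind
      refine ⟨BallotPath.ext_ht fun m => ?_, by rw [g.wt, g'.wt, h.wt, h'.wt, e]⟩
      rw [g.act hj, g'.act hi]
      simp only [H, H']
      clear g g'; unfold IsDown IsMin at *; grind
  · have H := h.act hi
    have H' := h'.act hj
    have g : IsDown (act i α) k' j := by clear H'; unfold IsDown IsMin at *; grind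
    have g' : IsMin (act j α) i := by clear g H; unfold IsDown IsMin at *; grind
    refine ⟨BallotPath.ext_ht fun m => ?_, by rw [g.wt, g'.wt, h.wt, h'.wt]⟩
    rw [g.act hj, g'.act hi]
    simp only [H, H']
    clear g g'; unfold IsDown IsMin at *; grind

lemma comm_min_free (η ω : ℂ) {α : BallotPath N} {i j : ℕ} (hij : i + 2 ≤ j) (hi : i < N)
    (hj : j < N) (h : IsMin α i) (h' : IsFree α j) :
    ActCommute η ω i j α := by
  have H := h.act hi
  have H' := h'.act hj
  have g : IsFree (act i α) j := by clear H'; unfold IsFree IsMin at *; grind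
  have g' : IsMin (act j α) i := by clear g H; unfold IsFree IsMin at *; grind
  refine ⟨BallotPath.ext_ht fun m => ?_, by rw [g.wt, g'.wt, h.wt, h'.wt]; ring⟩
  rw [g.act hj, g'.act hi]
  simp only [H, H']
  clear g g'; unfold IsFree IsMin at *; grind

lemma comm_up_min (η ω : ℂ) {α : BallotPath N} {i j r : ℕ} (hij : i + 2 ≤ j) (hi : i < N)
    (hj : j < N) (h : IsUp α i r) (h' : IsMin α j) :
    ActCommute η ω i j α := by
  by_cases hk : r = j
  · -- The arc of `i` ends at the minimum `j`; raising `j` joins it with the next arc.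
    subst hk
    obtain ⟨r', hr'⟩ := exists_return_right α hj h'.2.2
    have s2 := α.step (r - 1) (by omega)
    have s1 := α.step i hi
    have H := h.act
    have H' := h'.act hj
    have g : IsUp (act i α) r r' := by clear H'; unfold IsMin IsUp at *; grind
    have g' : IsUp (act r α) i r' := by
      clear g H
      obtain ⟨a1, a2, a3, a4, a5, a6⟩ := h
      obtain ⟨b1, b2, b3, b4⟩ := hr'
      refine ⟨a1, ?_, by omega, b2, ?_, fun l hl hl' => ?_⟩
      · rw [H', H']; split_ifs <;> omega
      · rw [H', H']; split_ifs <;> omega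
      · have := a6 l hl
        have := b4 l
        rw [H', H', if_neg (by omega)]
        rcases lt_trichotomy l r with h1 | h1 | h1 <;> split_ifs <;> grind
    refine ⟨BallotPath.ext_ht fun m => ?_, by rw [g.wt, g'.wt, h.wt, h'.wt]⟩
    rw [g.act, g'.act]
    simp only [H, H']
    have := h.2.2.1
    have := hr'.1
    split_ifs <;> omega
  · have H := h.act
    have H' := h'.act hj
    have g : IsMin (act i α) j := by clear H'; unfold IsMin IsUp at *; grind
    have g' : IsUp (act j α) i r := by clear g H; unfold IsMin IsUp at *; grind
    refine ⟨BallotPath.ext_ht fun m => ?_, by rw [g.wt, g'.wt, h.wt, h'.wt]⟩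
    rw [g.act hj, g'.act]
    simp only [H, H']
    clear g g'; unfold IsMin IsUp at *; grind

lemma comm_up_up (η ω : ℂ) {α : BallotPath N} {i j r r' : ℕ} (hij : i + 2 ≤ j)
    (h : IsUp α i r) (h' : IsUp α j r') :
    ActCommute η ω i j α := by
  have H := h.act
  have H' := h'.act
  have g : IsUp (act i α) j r' := by clear H'; unfold IsUp at *; grind
  have g' : IsUp (act j α) i r := by clear g H; unfold IsUp at *; grind
  refine ⟨BallotPath.ext_ht fun m => ?_, by rw [g.wt, g'.wt, h.wt, h'.wt]⟩
  rw [g.act, g'.act]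
  simp only [H, H']
  clear g g'; unfold IsUp at *; grind

lemma comm_up_down (η ω : ℂ) {α : BallotPath N} {i j r k' : ℕ} (hij : i + 2 ≤ j) (hi : i < N)
    (hj : j < N) (h : IsUp α i r) (h' : IsDown α k' j) :
    ActCommute η ω i j α := by
  by_cases hk : r = j
  · -- The slopes at `i` and `j` belong to the same arc, which either generator lowers.
    subst hk
    have s1 := α.step i hi
    have s2 := α.step (r - 1) (by omega)
    have H := h.act
    have H' := h'.act hj
    have g : IsMax (act i α) r := by clear H'; unfold IsDown IsMax IsUp at *; grind
    have g' : IsMax (act r α) i := by clear g H; unfold IsDown IsMax IsUp at *; grind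
    refine ⟨BallotPath.ext_ht fun m => ?_, by
      rw [wt_max η ω g, wt_max η ω g', h.wt, h'.wt, mul_comm]⟩
    rw [act_max g, act_max g', H, H']
    clear g g'; unfold IsDown IsUp at *; grind
  · by_cases hk' : r = j + 1
    · -- The arc of `j` lies inside of that of `i` and ends next to its end.
      subst hk'
      have s1 := α.step i hi
      have s2 := α.step j hj
      have s3 := α.step k' (by have := h'.2.1; omega)
      have e1 : i < k' := by
        by_contra hc
        obtain ⟨-, -, h1, h2⟩ := h'
        obtain ⟨-, -, -, -, h3, h4⟩ := h
        have := h2 (i + 1) (by omega) (by omega)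
        have := h4 j (by omega) (by omega)
        have := h4 (i + 1) (by omega) (by omega)
        omega
      have H := h.act
      have H' := h'.act hj
      have g : IsMin (act i α) j := by clear H'; unfold IsDown IsMin IsUp at *; grind
      have g' : IsUp (act j α) i (k' + 1) := by clear g H; unfold IsDown IsUp at *; grind
      refine ⟨BallotPath.ext_ht fun m => ?_, by rw [g.wt, g'.wt, h.wt, h'.wt]⟩
      rw [g.act hj, g'.act]
      simp only [H, H']
      clear g g'; unfold IsDown IsUp at *; grind
    · have s1 := α.step i hi
      have s2 := α.step (r - 1) (by obtain ⟨_, _, _, h', _⟩ := h; omega)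
      have s3 := α.step (i - 1) (by omega)
      by_cases hk'' : k' + 1 = i
      · -- The arc of `i` lies inside of that of `j` and begins next to its beginning.
        subst hk''
        have H := h.act
        have H' := h'.act hj
        have hrj : r < j := by unfold IsDown IsUp at *; grind
        have g : IsDown (act (k' + 1) α) (r - 1) j := by clear H'; unfold IsDown IsUp at *; grind
        have g' : IsMin (act j α) (k' + 1) := by clear g H; unfold IsDown IsUp IsMin at *; grind
        refine ⟨BallotPath.ext_ht fun m => ?_, by rw [g.wt, g'.wt, h.wt, h'.wt]⟩
        rw [g.act hj, g'.act hi]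
        simp only [H, H']
        clear g g'; unfold IsDown IsUp at *; grind
      · clear s1 s2 s3
        have t := h.2.2.2.2.2 (j + 1)
        have t' := h'.2.2.2 (i - 1)
        have H := h.act
        have H' := h'.act hj
        have g : IsDown (act i α) k' j := by clear H'; unfold IsDown IsUp at *; grind
        have g' : IsUp (act j α) i r := by clear g H; unfold IsDown IsUp at *; grind
        refine ⟨BallotPath.ext_ht fun m => ?_, by rw [g.wt, g'.wt, h.wt, h'.wt]⟩
        rw [g.act hj, g'.act]
        simp only [H, H']
        clear g g'; unfold IsDown IsUp at *; grind

lemma comm_up_free (η ω : ℂ) {α : BallotPath N} {i j r : ℕ} (hij : i + 2 ≤ j)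
    (hj : j < N) (h : IsUp α i r) (h' : IsFree α j) :
    ActCommute η ω i j α := by
  have H := h.act
  have H' := h'.act hj
  have g : IsFree (act i α) j := by clear H'; unfold IsFree IsUp at *; grind
  have g' : IsUp (act j α) i r := by clear g H; unfold IsFree IsUp at *; grind
  refine ⟨BallotPath.ext_ht fun m => ?_, by rw [g.wt, g'.wt, h.wt, h'.wt]; ring⟩
  rw [g.act hj, g'.act]
  simp only [H, H']
  clear g g'; unfold IsFree IsUp at *; grind

lemma comm_down_min (η ω : ℂ) {α : BallotPath N} {i j k : ℕ} (hij : i + 2 ≤ j) (hi : i < N)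
    (hj : j < N) (h : IsDown α k i) (h' : IsMin α j) :
    ActCommute η ω i j α := by
  have H := h.act hi
  have H' := h'.act hj
  have g : IsMin (act i α) j := by clear H'; unfold IsDown IsMin at *; grind
  have g' : IsDown (act j α) k i := by clear g H; unfold IsDown IsMin at *; grind
  refine ⟨BallotPath.ext_ht fun m => ?_, by rw [g.wt, g'.wt, h.wt, h'.wt]⟩
  rw [g.act hj, g'.act hi]
  simp only [H, H']
  clear g g'; unfold IsDown IsMin at *; grind

lemma comm_down_up (η ω : ℂ) {α : BallotPath N} {i j k r' : ℕ} (hij : i + 2 ≤ j) (hi : i < N)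
    (h : IsDown α k i) (h' : IsUp α j r') :
    ActCommute η ω i j α := by
  have H := h.act hi
  have H' := h'.act
  have g : IsUp (act i α) j r' := by clear H'; unfold IsDown IsUp at *; grind
  have g' : IsDown (act j α) k i := by clear g H; unfold IsDown IsUp at *; grind
  refine ⟨BallotPath.ext_ht fun m => ?_, by rw [g.wt, g'.wt, h.wt, h'.wt]⟩
  rw [g.act, g'.act hi]
  simp only [H, H']
  clear g g'; unfold IsDown IsUp at *; grind

lemma comm_down_down (η ω : ℂ) {α : BallotPath N} {i j k k' : ℕ} (hij : i + 2 ≤ j) (hi : i < N)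
    (hj : j < N) (h : IsDown α k i) (h' : IsDown α k' j) :
    ActCommute η ω i j α := by
  have H := h.act hi
  have H' := h'.act hj
  have g : IsDown (act i α) k' j := by clear H'; unfold IsDown at *; grind
  have g' : IsDown (act j α) k i := by clear g H; unfold IsDown at *; grind
  refine ⟨BallotPath.ext_ht fun m => ?_, by rw [g.wt, g'.wt, h.wt, h'.wt]⟩
  rw [g.act hj, g'.act hi]
  simp only [H, H']
  clear g g'; unfold IsDown at *; grind

lemma comm_down_free (η ω : ℂ) {α : BallotPath N} {i j k : ℕ} (hij : i + 2 ≤ j) (hi : i < N)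
    (hj : j < N) (h : IsDown α k i) (h' : IsFree α j) :
    ActCommute η ω i j α := by
  have H := h.act hi
  have H' := h'.act hj
  have g : IsFree (act i α) j := by clear H'; unfold IsDown IsFree at *; grind
  have g' : IsDown (act j α) k i := by clear g H; unfold IsDown IsFree at *; grind
  refine ⟨BallotPath.ext_ht fun m => ?_, by rw [g.wt, g'.wt, h.wt, h'.wt]; ring⟩
  rw [g.act hj, g'.act hi]
  simp only [H, H']
  clear g g'; unfold IsDown IsFree at *; grind

lemma comm_free_min (η ω : ℂ) {α : BallotPath N} {i j : ℕ} (hij : i + 2 ≤ j) (hi : i < N)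
    (hj : j < N) (h : IsFree α i) (h' : IsMin α j) :
    ActCommute η ω i j α := by
  have H := h.act hi
  have H' := h'.act hj
  have g : IsMin (act i α) j := by clear H'; unfold IsFree IsMin at *; grind
  have g' : IsFree (act j α) i := by clear g H; unfold IsFree IsMin at *; grind
  refine ⟨BallotPath.ext_ht fun m => ?_, by rw [g.wt, g'.wt, h.wt, h'.wt]; ring⟩
  rw [g.act hj, g'.act hi]
  simp only [H, H']
  clear g g'; unfold IsFree IsMin at *; grind

lemma comm_free_up (η ω : ℂ) {α : BallotPath N} {i j r' : ℕ} (hij : i + 2 ≤ j) (hi : i < N)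
    (h : IsFree α i) (h' : IsUp α j r') :
    ActCommute η ω i j α := by
  have H := h.act hi
  have H' := h'.act
  have g : IsUp (act i α) j r' := by clear H'; unfold IsFree IsUp at *; grind
  have g' : IsFree (act j α) i := by clear g H; unfold IsFree IsUp at *; grind
  refine ⟨BallotPath.ext_ht fun m => ?_, by rw [g.wt, g'.wt, h.wt, h'.wt]; ring⟩
  rw [g.act, g'.act hi]
  simp only [H, H']
  clear g g'; unfold IsFree IsUp at *; grind

lemma comm_free_down (η ω : ℂ) {α : BallotPath N} {i j k' : ℕ} (hij : i + 2 ≤ j) (hi : i < N)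
    (hj : j < N) (h : IsFree α i) (h' : IsDown α k' j) :
    ActCommute η ω i j α := by
  have H := h.act hi
  have H' := h'.act hj
  have g : IsDown (act i α) k' j := by clear H'; unfold IsDown IsFree at *; grind
  have g' : IsFree (act j α) i := by clear g H; unfold IsDown IsFree at *; grind
  refine ⟨BallotPath.ext_ht fun m => ?_, by rw [g.wt, g'.wt, h.wt, h'.wt]; ring⟩
  rw [g.act hj, g'.act hi]
  simp only [H, H']
  clear g g'; unfold IsDown IsFree at *; grind

lemma comm_free_free (η ω : ℂ) {α : BallotPath N} {i j : ℕ} (hij : i + 2 ≤ j) (hi : i < N)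
    (hj : j < N) (h : IsFree α i) (h' : IsFree α j) :
    ActCommute η ω i j α := by
  have H := h.act hi
  have H' := h'.act hj
  have g : IsFree (act i α) j := by clear H'; unfold IsFree at *; grind
  have g' : IsFree (act j α) i := by clear g H; unfold IsFree at *; grind
  refine ⟨BallotPath.ext_ht fun m => ?_, by rw [g.wt, g'.wt, h.wt, h'.wt]; ring⟩
  rw [g.act hj, g'.act hi]
  simp only [H, H']
  clear g g'; unfold IsFree at *; grind

lemma comm_zero (η ω : ℂ) (α : BallotPath N) {j : ℕ} (hij : 2 ≤ j) (hj : j < N) :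
    ActCommute η ω 0 j α := by
  have s0 := α.step 0 (by omega)
  rw [zero_add] at s0
  by_cases h0 : α.ht 1 < α.ht 0
  · have h1 : (act j α).ht 1 < (act j α).ht 0 := by
      rcases config_cases α (by omega) hj with h | h | ⟨r, h⟩ | ⟨k, h⟩ | h
      · rwa [act_max h]
      · have H := h.act hj
        grind
      · have H := h.act
        grind
      · have H := h.act hj
        unfold IsDown at h
        grind
      · have H := h.act hj
        grind
    rw [ActCommute, act_zero_down h0, act_zero_down h1, wt_zero_down η ω h0, wt_zero_down η ω h1]
    exact ⟨rfl, mul_comm _ _⟩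
  · have h0' : α.ht 0 < α.ht 1 := by omega
    have H0 := act_zero_raise (by omega) h0'
    rcases config_cases α (by omega) hj with h | h | ⟨r, h⟩ | ⟨k, h⟩ | h
    · have g := h.act_of_far (i := 0) (by omega) hj (by omega)
      rw [ActCommute, act_max h, act_max g, wt_max η ω h, wt_max η ω g]
      exact ⟨rfl, mul_comm _ _⟩
    · have H := h.act hj
      have g : IsMin (act 0 α) j := by unfold IsMin at *; grind
      have g' : (act j α).ht 0 < (act j α).ht 1 := by grind
      refine ⟨BallotPath.ext_ht fun m => ?_, by
        rw [g.wt, h.wt, wt_zero_raise η ω h0', wt_zero_raise η ω g']⟩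
      rw [g.act hj, act_zero_raise (by omega) g']
      grind
    · have H := h.act
      have g : IsUp (act 0 α) j r := by unfold IsUp at *; grind
      have g' : (act j α).ht 0 < (act j α).ht 1 := by grind
      refine ⟨BallotPath.ext_ht fun m => ?_, by
        rw [g.wt, h.wt, wt_zero_raise η ω h0', wt_zero_raise η ω g']⟩
      rw [g.act, act_zero_raise (by omega) g']
      grind
    · have H := h.act hj
      have hp := α.ht_parity hj.le
      have hp' := α.ht_parity (Nat.zero_le N)
      by_cases hk : k = 0
      · -- The arc from `0` to `j` is cut open by `e_0`; the height of its ends is that of the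
        -- starting point, so that `j` is even, and the weights of both orders agree.
        subst hk
        have g : IsFree (act 0 α) j := by unfold IsFree IsDown at *; grind
        have g' : (act j α).ht 1 < (act j α).ht 0 := by unfold IsDown at *; grind
        have e : Even j := by
          have := h.2.2.1
          rw [Nat.even_iff]
          omega
        refine ⟨BallotPath.ext_ht fun m => ?_, by
          rw [g.wt, h.wt, wt_zero_raise η ω h0', wt_zero_down η ω g', freeWt, if_pos e]⟩
        rw [g.act hj, act_zero_down g']
        grind
      · have g : IsDown (act 0 α) k j := by unfold IsDown at *; grind
        have g' : (act j α).ht 0 < (act j α).ht 1 := by unfold IsDown at *; grind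
        refine ⟨BallotPath.ext_ht fun m => ?_, by
          rw [g.wt, h.wt, wt_zero_raise η ω h0', wt_zero_raise η ω g']⟩
        rw [g.act hj, act_zero_raise (by omega) g']
        grind
    · have H := h.act hj
      have g : IsFree (act 0 α) j := by unfold IsFree at *; grind
      have g' : (act j α).ht 0 < (act j α).ht 1 := by grind
      refine ⟨BallotPath.ext_ht fun m => ?_, by
        rw [g.wt, h.wt, wt_zero_raise η ω h0', wt_zero_raise η ω g', mul_comm]⟩
      rw [g.act hj, act_zero_raise (by omega) g']
      grind

lemma act_comm (η ω : ℂ) (α : BallotPath N) {i j : ℕ} (hij : i + 2 ≤ j) (hj : j < N) :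
    ActCommute η ω i j α := by
  rcases Nat.eq_zero_or_pos i with rfl | hi0
  · exact comm_zero η ω α (by omega) hj
  have hi : i < N := by omega
  rcases config_cases α hi0 hi with h | h | ⟨r, h⟩ | ⟨k, h⟩ | h
  · have g := h.act_of_far (i := j) hj hi (by omega)
    rw [ActCommute, act_max h, act_max g, wt_max η ω h, wt_max η ω g]
    exact ⟨rfl, mul_comm _ _⟩
  all_goals
    rcases config_cases α (by omega) hj with h' | h' | ⟨r', h'⟩ | ⟨k', h'⟩ | h'
    · have g := h'.act_of_far (i := i) hi hj (by omega)
      rw [ActCommute, act_max h', act_max g, wt_max η ω h', wt_max η ω g]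
      exact ⟨rfl, mul_comm _ _⟩
  · exact comm_min_min η ω hij hi hj h h'
  · exact comm_min_up η ω hij hi h h'
  · exact comm_min_down η ω hij hi hj h h'
  · exact comm_min_free η ω hij hi hj h h'
  · exact comm_up_min η ω hij hi hj h h'
  · exact comm_up_up η ω hij h h'
  · exact comm_up_down η ω hij hi hj h h'
  · exact comm_up_free η ω hij hj h h'
  · exact comm_down_min η ω hij hi hj h h'
  · exact comm_down_up η ω hij hi h h'
  · exact comm_down_down η ω hij hi hj h h'
  · exact comm_down_free η ω hij hi hj h h'
  · exact comm_free_min η ω hij hi hj h h'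
  · exact comm_free_up η ω hij hi h h'
  · exact comm_free_down η ω hij hi hj h h'
  · exact comm_free_free η ω hij hi hj h h'

/-! ### Relations of neighbouring generators -/

/-- The relation `e_j e_{j+1} e_j = e_j`, on a state `μ = e_j |β⟩`. -/
lemma IsMax.act_succ (η ω : ℂ) {μ : BallotPath N} {j : ℕ} (hj : j + 1 < N) (h : IsMax μ j) :
    act j (act (j + 1) μ) = μ ∧ wt η ω (j + 1) μ = 1 ∧ wt η ω j (act (j + 1) μ) = 1 := by
  have s1 := μ.step (j + 1) hj
  have s2 := μ.step j (by omega)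
  have s3 := μ.step (j - 1) (by omega)
  rw [Nat.sub_add_cancel h.1] at s3
  rcases s1 with s1 | s1
  · have h' : IsMin μ (j + 1) := ⟨by omega, by simpa using h.2.2, by omega⟩
    have H := h'.act hj
    have g : IsUp (act (j + 1) μ) j (j + 2) := by unfold IsMax IsMin IsUp at *; grind
    refine ⟨BallotPath.ext_ht fun m => ?_, h'.wt .., g.wt ..⟩
    rw [g.act]
    grind
  · have h' : IsDown μ (j - 1) (j + 1) := by unfold IsMax IsDown at *; grind
    have H := h'.act hj
    have g : IsMin (act (j + 1) μ) j := by unfold IsMax IsMin IsDown at *; grind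
    refine ⟨BallotPath.ext_ht fun m => ?_, h'.wt .., g.wt ..⟩
    rw [g.act (by omega)]
    unfold IsMax at h
    grind

/-- The relation `e_{j+1} e_j e_{j+1} = e_{j+1}`, on a state `μ = e_{j+1} |β⟩`; for `j = 0` it is
the boundary relation `e_1 e_0 e_1 = e_1`. -/
lemma IsMax.act_pred (η ω : ℂ) {μ : BallotPath N} {j : ℕ} (hj : j + 1 < N)
    (h : IsMax μ (j + 1)) :
    act (j + 1) (act j μ) = μ ∧ wt η ω j μ = 1 ∧ wt η ω (j + 1) (act j μ) = 1 := by
  have s1 := μ.step (j + 1) hj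
  have s2 := μ.step j (by omega)
  rcases Nat.eq_zero_or_pos j with rfl | h0
  · have h' : μ.ht 0 < μ.ht 1 := h.2.1
    have H := act_zero_raise (by omega) h'
    have g : IsFree (act 0 μ) 1 := by unfold IsMax IsFree at *; grind
    refine ⟨BallotPath.ext_ht fun m => ?_, wt_zero_raise η ω h', ?_⟩
    · rw [zero_add, g.act hj]
      grind
    · rw [zero_add, g.wt, freeWt, if_neg (by decide)]
  · have s3 := μ.step (j - 1) (by omega)
    rw [Nat.sub_add_cancel h0] at s3
    rcases s3 with s3 | s3
    · have h' : IsUp μ j (j + 2) := by unfold IsMax IsUp at *; grind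
      have H := h'.act
      have g : IsMin (act j μ) (j + 1) := by unfold IsMax IsMin IsUp at *; grind
      refine ⟨BallotPath.ext_ht fun m => ?_, h'.wt .., g.wt ..⟩
      rw [g.act (by omega)]
      grind
    · have h' : IsMin μ j := by unfold IsMax IsMin at *; grind
      have H := h'.act (by omega)
      have g : IsDown (act j μ) (j - 1) (j + 1) := by unfold IsMax IsMin IsDown at *; grind
      refine ⟨BallotPath.ext_ht fun m => ?_, h'.wt .., g.wt ..⟩
      rw [g.act (by omega)]
      grind

/-! ### The tiles on the dual path space -/

/-- The function `k(u/2, ν) / [ω + 1]` of the boundary half-tile `h₀(u)`. -/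
def kap (η ω ν u : ℂ) : ℂ := kfun η ω (u / 2) ν / qnum η (ω + 1)

lemma kap_sub_kap_neg (η ω ν u : ℂ) :
    kap η ω ν u - kap η ω ν (-u) = qnum η ω / qnum η (ω + 1) * qnum η u := by
  have h := qnum_mul_sub_mul η ((ω + ν) / 2) ((ω - ν) / 2) (u / 2) (u / 2)
  have e1 : (ω + ν) / 2 + (ω - ν) / 2 + u / 2 - u / 2 = ω := by ring
  rw [e1, add_halves] at h
  rw [kap, kap, ← sub_div, kfun, kfun, neg_div, ← sub_eq_add_neg, ← sub_eq_add_neg, h]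
  ring

lemma kap_add_two {η ω : ℂ} (hω : qnum η (ω + 1) ≠ 0) (ν u : ℂ) :
    kap η ω ν (u + 2) - qnum η (u + 1) = kap η ω ν (-u) := by
  have h := qnum_mul_sub_mul η ((ω + ν) / 2) ((ω - ν) / 2) (u / 2) ((u + 2) / 2)
  have e1 : (ω + ν) / 2 + (ω - ν) / 2 + (u + 2) / 2 - u / 2 = ω + 1 := by ring
  have e2 : u / 2 + (u + 2) / 2 = u + 1 := by ring
  rw [e1, e2] at h
  rw [kap, kap, kfun, kfun, neg_div, ← sub_eq_add_neg, ← sub_eq_add_neg, sub_eq_iff_eq_add,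
    div_add' _ _ _ hω]
  congr 1
  linear_combination h

/-- Functions on the set of Ballot paths; `w` stands for the linear form on the path space with
the values `w α` on the states `|α⟩`. -/
abbrev DualSpace (N : ℕ) := BallotPath N → ℂ

/-- The constant term of a tile of content `u` when it is written as `e_i + const`. -/
def tileConst (η ω : ℂ) (i u : ℕ) : ℂ :=
  if i = 0 then
    qnum η ω / qnum η (ω + 1) - kap η ω (ω + ((u % 2 : ℕ) : ℂ)) u / qnum η u
  else qnum η (u + 1) / qnum η u

/-- The tile of content `u` at the position `i`, acting on linear forms on the path space: the
transpose of `e_i` plus a constant. -/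
def tile (η ω : ℂ) (N i u : ℕ) : Module.End ℂ (DualSpace N) where
  toFun w β := wt η ω i β * w (act i β) + tileConst η ω i u * w β
  map_add' w w' := by funext β; simp only [Pi.add_apply]; ring
  map_smul' c w := by funext β; simp only [Pi.smul_apply, smul_eq_mul, RingHom.id_apply]; ring

lemma tile_apply (η ω : ℂ) (i u : ℕ) (w : DualSpace N) (β : BallotPath N) :
    tile η ω N i u w β = wt η ω i β * w (act i β) + tileConst η ω i u * w β := rfl

lemma tile_commute (η ω : ℂ) {i j : ℕ} (u v : ℕ) (hi : i < N) (hj : j < N)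
    (hij : i + 2 ≤ j ∨ j + 2 ≤ i) : Commute (tile η ω N i u) (tile η ω N j v) := by
  wlog h : i + 2 ≤ j generalizing i j u v
  · exact (this v u hj hi hij.symm (by omega)).symm
  refine LinearMap.ext fun w => funext fun β => ?_
  obtain ⟨h1, h2⟩ := act_comm η ω β h hj
  simp only [Module.End.mul_apply, tile_apply]
  rw [h1]
  linear_combination w (act i (act j β)) * h2

/-- The linear form `w` vanishes on the image of `e_j`. -/
def Kill (j : ℕ) (w : DualSpace N) : Prop := ∀ μ, IsMax μ j → w μ = 0

lemma Kill.tile_far {η ω : ℂ} {i j u : ℕ} {w : DualSpace N} (hi : i < N) (hj : j < N)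
    (hij : i + 2 ≤ j ∨ j + 2 ≤ i) (h : Kill j w) : Kill j (tile η ω N i u w) := fun μ hμ => by
  rw [tile_apply, h μ hμ, h _ (hμ.act_of_far hi hj hij), mul_zero, mul_zero, add_zero]

lemma tileConst_pos (η ω : ℂ) {i : ℕ} (hi : 1 ≤ i) (u : ℕ) :
    tileConst η ω i u = qnum η (u + 1) / qnum η u := if_neg (by omega)

/-- A tile of content `1` is a multiple of a projection. -/
lemma kill_tile_one {η ω : ℂ} (hη : η = 0 ∨ Complex.exp η - Complex.exp (-η) ≠ 0) {i : ℕ}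
    (hi : 1 ≤ i) (w : DualSpace N) : Kill i (tile η ω N i 1 w) := fun μ hμ => by
  rw [tile_apply, act_max hμ, wt_max η ω hμ, tileConst_pos η ω hi, Nat.cast_one, qnum_one hη,
    one_add_one_eq_two, div_one]
  ring

lemma tileConst_yang_baxter {η ω : ℂ} (hη : η = 0 ∨ Complex.exp η - Complex.exp (-η) ≠ 0)
    {i j : ℕ} (hi : 1 ≤ i) (hj : 1 ≤ j) {u : ℕ} (hu : qnum η u ≠ 0)
    (hu1 : qnum η ((u + 1 : ℕ) : ℂ) ≠ 0) :
    1 + tileConst η ω i u * (tileConst η ω j (u + 1) - qnum η 2) = 0 := by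
  have h := qnum_add_one_add_sub_one hη ((u : ℂ) + 1)
  rw [add_sub_cancel_right] at h
  rw [tileConst_pos η ω hi, tileConst_pos η ω hj]
  push_cast at hu1 ⊢
  field_simp
  linear_combination h

/-- The Yang-Baxter equation moves the projector that annihilates `w` through two tiles. -/
lemma Kill.yang_baxter_succ {η ω : ℂ} (hη : η = 0 ∨ Complex.exp η - Complex.exp (-η) ≠ 0)
    {j u : ℕ} (hj0 : 1 ≤ j) (hj : j + 1 < N) (hu : qnum η u ≠ 0)
    (hu1 : qnum η ((u + 1 : ℕ) : ℂ) ≠ 0) {w : DualSpace N} (h : Kill j w) :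
    Kill (j + 1) (tile η ω N j u (tile η ω N (j + 1) (u + 1) w)) := fun μ hμ => by
  obtain ⟨h1, h2, h3⟩ := hμ.act_pred η ω hj
  rw [tile_apply, tile_apply, tile_apply, h1, h2, h3, act_max hμ, wt_max η ω hμ,
    h _ (act_isMax μ hj0 (by omega))]
  linear_combination w μ * tileConst_yang_baxter (ω := ω) hη hj0 (by omega : 1 ≤ j + 1) hu hu1

lemma Kill.yang_baxter_pred {η ω : ℂ} (hη : η = 0 ∨ Complex.exp η - Complex.exp (-η) ≠ 0)
    {j u : ℕ} (hj0 : 1 ≤ j) (hj : j + 1 < N) (hu : qnum η u ≠ 0)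
    (hu1 : qnum η ((u + 1 : ℕ) : ℂ) ≠ 0) {w : DualSpace N} (h : Kill (j + 1) w) :
    Kill j (tile η ω N (j + 1) u (tile η ω N j (u + 1) w)) := fun μ hμ => by
  obtain ⟨h1, h2, h3⟩ := hμ.act_succ η ω hj
  rw [tile_apply, tile_apply, tile_apply, h1, h2, h3, act_max hμ, wt_max η ω hμ,
    h _ (act_isMax μ (by omega) (by omega))]
  linear_combination w μ * tileConst_yang_baxter (ω := ω) hη (by omega : 1 ≤ j + 1) hj0 hu hu1

lemma tileConst_reflection {η ω : ℂ} (hη : η = 0 ∨ Complex.exp η - Complex.exp (-η) ≠ 0)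
    (hω : qnum η (ω + 1) ≠ 0) {u : ℕ} (hu : qnum η u ≠ 0)
    (hu1 : qnum η ((u + 1 : ℕ) : ℂ) ≠ 0) (hu2 : qnum η ((u + 2 : ℕ) : ℂ) ≠ 0) :
    1 + tileConst η ω 1 (u + 1) * (tileConst η ω 0 (u + 2) - qnum η ω / qnum η (ω + 1)) +
      tileConst η ω 0 u * (tileConst η ω 1 (u + 1) - qnum η 2) = 0 := by
  have h := qnum_add_one_add_sub_one hη ((u : ℂ) + 1)
  rw [add_sub_cancel_right] at h
  have k1 := kap_sub_kap_neg η ω (ω + ((u % 2 : ℕ) : ℂ)) u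
  have k2 := kap_add_two hω (ω + ((u % 2 : ℕ) : ℂ)) u
  rw [tileConst_pos η ω le_rfl, tileConst, tileConst, if_pos rfl, if_pos rfl, Nat.add_mod_right]
  push_cast at hu1 hu2 ⊢
  have e2 : (u : ℂ) + 1 + 1 = u + 2 := by ring
  rw [e2] at h ⊢
  set c := qnum η ω / qnum η (ω + 1)
  set A := kap η ω (ω + ((u % 2 : ℕ) : ℂ)) u
  set B := kap η ω (ω + ((u % 2 : ℕ) : ℂ)) (u + 2)
  field_simp
  linear_combination qnum η u * (k1 - k2) + (c * qnum η u - A) * h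

/-- The reflection equation moves the projector that annihilates `w` through the tiles next to
the boundary. -/
lemma Kill.reflection {η ω : ℂ} (hη : η = 0 ∨ Complex.exp η - Complex.exp (-η) ≠ 0)
    (hω : qnum η (ω + 1) ≠ 0) (hN : 1 < N) {u : ℕ} (hu : qnum η u ≠ 0)
    (hu1 : qnum η ((u + 1 : ℕ) : ℂ) ≠ 0) (hu2 : qnum η ((u + 2 : ℕ) : ℂ) ≠ 0)
    {w : DualSpace N} (h : Kill 1 w) :
    Kill 1 (tile η ω N 0 u (tile η ω N 1 (u + 1) (tile η ω N 0 (u + 2) w))) := fun μ hμ => by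
  obtain ⟨h1, h2, h3⟩ := hμ.act_pred (j := 0) η ω hN
  rw [zero_add] at h1 h3
  have hd : (act 0 μ).ht 1 < (act 0 μ).ht 0 := by
    have h4 := μ.step 0 (by omega)
    have H := act_zero_raise (by omega) hμ.2.1
    have h5 := hμ.2.1
    rw [H, H, if_pos rfl, if_neg (by omega)]
    simp only [zero_add] at h4 ⊢
    omega
  simp only [tile_apply, h1, h2, h3, act_max hμ, wt_max η ω hμ, act_zero_down hd,
    wt_zero_down η ω hd, h μ hμ]
  linear_combination w (act 0 μ) * tileConst_reflection (ω := ω) hη hω hu hu1 hu2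

/-! ### Columns and stacks of tiles -/

/-- The product of the tiles at the positions `i, i + 1, …, i + a - 1` with the contents
`u, u + 1, …, u + a - 1`. -/
def col (η ω : ℂ) (N : ℕ) : (i u a : ℕ) → Module.End ℂ (DualSpace N)
  | _, _, 0 => 1
  | i, u, a + 1 => tile η ω N i u * col η ω N (i + 1) (u + 1) a

/-- The triangle of tiles at the boundary: columns of the lengths `a, a - 1, …, 1`, all of them
starting at the position `0`, with the contents `u, u + 2, …` of the half-tiles. -/
def tri (η ω : ℂ) (N : ℕ) : (u a : ℕ) → Module.End ℂ (DualSpace N)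
  | _, 0 => 1
  | u, a + 1 => col η ω N 0 u (a + 1) * tri η ω N (u + 2) a

/-- The product of `b` columns of length `a`, starting at the positions `p + b, …, p + 1` and with
the initial contents `u, …, u + b - 1`, applied to the vector `base (u + b)`. -/
def stack (η ω : ℂ) (base : ℕ → DualSpace N) (p : ℕ) : (b u a : ℕ) → DualSpace N
  | 0, u, _ => base u
  | b + 1, u, a => col η ω N (p + b + 1) u a (stack η ω base p b (u + 1) a)

lemma col_succ_apply (η ω : ℂ) (i u a : ℕ) (w : DualSpace N) :
    col η ω N i u (a + 1) w = tile η ω N i u (col η ω N (i + 1) (u + 1) a w) := rfl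

lemma Kill.col_far {η ω : ℂ} {i l u a : ℕ} {w : DualSpace N} (hi : i + a ≤ N) (hl : l < N)
    (hil : l + 2 ≤ i ∨ i + a + 1 ≤ l) (h : Kill l w) : Kill l (col η ω N i u a w) := by
  induction a generalizing i u with
  | zero => exact h
  | succ a ih => exact (ih (by omega) (by omega)).tile_far (by omega) hl (by omega)

/-- A projector enters a column at one position and leaves it at the preceding one. -/
lemma Kill.col_pass {η ω : ℂ} (hη : η = 0 ∨ Complex.exp η - Complex.exp (-η) ≠ 0)
    (hq : ∀ k : ℕ, 1 ≤ k → k ≤ N → qnum η k ≠ 0) {i m u a : ℕ} (hi0 : 1 ≤ i) (hi : i + a ≤ N)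
    (hu : 1 ≤ u) (hua : u + a ≤ N + 1) (him : i ≤ m) (hma : m + 1 < i + a) {w : DualSpace N}
    (h : Kill m w) : Kill (m + 1) (col η ω N i u a w) := by
  induction a generalizing i u with
  | zero => omega
  | succ a ih =>
    rcases him.eq_or_lt with rfl | him
    · obtain ⟨a, rfl⟩ : ∃ a', a = a' + 1 := ⟨a - 1, by omega⟩
      exact (h.col_far (by omega) (by omega) (by omega)).yang_baxter_succ hη hi0 (by omega)
        (hq u hu (by omega)) (hq (u + 1) (by omega) (by omega))
    · exact (ih (by omega) (by omega) (by omega) (by omega) him (by omega)).tile_far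
        (by omega) (by omega) (by omega)

lemma tile_commute_col (η ω : ℂ) {l i a : ℕ} (u v : ℕ) (hl : l + 2 ≤ i) (hi : i + a ≤ N)
    (h : l < N) : Commute (tile η ω N l u) (col η ω N i v a) := by
  induction a generalizing i v with
  | zero => exact Commute.one_right _
  | succ a ih =>
    exact (tile_commute η ω u v h (by omega) (by omega)).mul_right
      (ih (v + 1) (by omega) (by omega))

/-- A projector passes through two consecutive columns along their end. -/
lemma Kill.col_col {η ω : ℂ} (hη : η = 0 ∨ Complex.exp η - Complex.exp (-η) ≠ 0)
    (hq : ∀ k : ℕ, 1 ≤ k → k ≤ N → qnum η k ≠ 0) {j u a : ℕ} (hj0 : 1 ≤ j)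
    (hj : j + 1 + a ≤ N) (hu : 1 ≤ u) (hua : u + a ≤ N) {w : DualSpace N}
    (h : Kill (j + a) w) :
    Kill j (col η ω N (j + 1) u a (col η ω N j (u + 1) a w)) := by
  induction a generalizing j u with
  | zero => exact h
  | succ a ih =>
    rw [col_succ_apply, col_succ_apply]
    have hc := tile_commute_col η ω (u + 1) (u + 1) (by omega : j + 2 ≤ j + 1 + 1)
      (by omega : j + 1 + 1 + a ≤ N) (by omega)
    have hc' := LinearMap.congr_fun hc.eq (col η ω N (j + 1) (u + 1 + 1) a w)
    rw [Module.End.mul_apply, Module.End.mul_apply] at hc'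
    rw [← hc']
    refine Kill.yang_baxter_pred hη hj0 (by omega) (hq u hu (by omega))
      (hq (u + 1) (by omega) (by omega)) ?_
    exact ih (by omega) (by omega) (by omega) (by omega) (by rwa [add_right_comm, add_assoc])

/-- The triangle at the boundary inherits all the annihilation properties of a straight path
except for that at its upper right corner. -/
lemma kill_tri {η ω : ℂ} (hη : η = 0 ∨ Complex.exp η - Complex.exp (-η) ≠ 0)
    (hω : qnum η (ω + 1) ≠ 0)
    (hq : ∀ k : ℕ, 1 ≤ k → k ≤ N → qnum η k ≠ 0) {Q : ℕ} (hQ : Q ≤ N) {w : DualSpace N}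
    (hw : ∀ l, 1 ≤ l → l < Q → Kill l w) {u a : ℕ} (hu : 1 ≤ u) (hua : u + 2 * a ≤ N + 2)
    (ha : a ≤ Q) {l : ℕ} (hl : 1 ≤ l) (hlQ : l < Q) (hla : l ≠ a) :
    Kill l (tri η ω N u a w) := by
  induction a using Nat.strong_induction_on generalizing u l with
  | _ a ih =>
    rcases a with _ | a
    · exact hw l hl hlQ
    change Kill l (tile η ω N 0 u (col η ω N 1 (u + 1) a (tri η ω N (u + 2) a w)))
    rcases Nat.lt_or_ge (a + 1) l with h1 | h1
    · exact ((ih a (by omega) (by omega) (by omega) (by omega) hl hlQ (by omega)).col_far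
        (by omega) (by omega) (by omega)).tile_far (by omega) (by omega) (by omega)
    rcases hl.eq_or_lt with rfl | hl1
    · obtain ⟨a, rfl⟩ : ∃ a', a = a' + 1 := ⟨a - 1, by omega⟩
      rw [col_succ_apply]
      change Kill 1 (tile η ω N 0 u (tile η ω N 1 (u + 1) (col η ω N 2 (u + 1 + 1) a
        (tile η ω N 0 (u + 2) (col η ω N 1 (u + 2 + 1) a (tri η ω N (u + 2 + 2) a w))))))
      have hc := LinearMap.congr_fun (tile_commute_col η ω (u + 2) (u + 1 + 1)
        (by omega : 0 + 2 ≤ 2) (by omega : 2 + a ≤ N) (by omega)).eq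
        (col η ω N 1 (u + 2 + 1) a (tri η ω N (u + 2 + 2) a w))
      rw [Module.End.mul_apply, Module.End.mul_apply] at hc
      rw [← hc]
      refine Kill.reflection hη hω (by omega) (hq u hu (by omega))
        (hq (u + 1) (by omega) (by omega)) (hq (u + 2) (by omega) (by omega)) ?_
      refine Kill.col_col hη hq le_rfl (by omega) (by omega) (by omega) ?_
      exact ih a (by omega) (by omega) (by omega) (by omega) (by omega) (by omega) (by omega)
    · obtain ⟨m, rfl⟩ : ∃ m, l = m + 1 := ⟨l - 1, by omega⟩
      refine (Kill.col_pass hη hq le_rfl (by omega) (by omega) (by omega) (by omega) (by omega)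
        ?_).tile_far (by omega) (by omega) (by omega)
      exact ih a (by omega) (by omega) (by omega) (by omega) (by omega) (by omega) (by omega)

/-- A stack of columns inherits the annihilation properties of its base; the exceptional
positions are those of its lower and of its upper right corner. -/
lemma kill_stack {η ω : ℂ} (hη : η = 0 ∨ Complex.exp η - Complex.exp (-η) ≠ 0)
    (hq : ∀ k : ℕ, 1 ≤ k → k ≤ N → qnum η k ≠ 0) {Q : ℕ} (hQ : Q ≤ N)
    {base : ℕ → DualSpace N} {p b u a : ℕ}
    (hbase : ∀ l, p < l → l < Q → l ≠ p + a → Kill l (base (u + b)))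
    (hu : 1 ≤ u) (hua : u + b + a ≤ N + 2) (hab : p + b + a ≤ Q) {l : ℕ} (hl : p < l)
    (hlQ : l < Q) (hlb : l ≠ p + b) (hla : l ≠ p + b + a) :
    Kill l (stack η ω base p b u a) := by
  induction b using Nat.strong_induction_on generalizing u l with
  | _ b ih =>
    rcases b with _ | b
    · exact hbase l hl hlQ hla
    have ih1 : ∀ {l}, p < l → l < Q → l ≠ p + b → l ≠ p + b + a →
        Kill l (stack η ω base p b (u + 1) a) := fun h1 h2 h3 h4 =>
      ih b (by omega) (by rwa [add_right_comm]) (by omega) (by omega) (by omega) h1 h2 h3 h4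
    change Kill l (col η ω N (p + b + 1) u a (stack η ω base p b (u + 1) a))
    rcases lt_trichotomy l (p + b) with h1 | rfl | h1
    · exact (ih1 hl hlQ (by omega) (by omega)).col_far (by omega) (by omega) (by omega)
    · obtain ⟨b, rfl⟩ : ∃ b', b = b' + 1 := ⟨b - 1, by omega⟩
      refine Kill.col_col (j := p + (b + 1)) hη hq (by omega) (by omega) hu (by omega) ?_
      refine ih b (by omega) (u := u + 1 + 1) ?_ (by omega) (by omega) (by omega) (by omega)
        (by omega) (by omega) (by omega)
      rwa [show u + 1 + 1 + b = u + (b + 1 + 1) by ring]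
    · rcases Nat.lt_or_ge (p + b + 1 + a) l with h2 | h2
      · exact (ih1 hl hlQ (by omega) (by omega)).col_far (by omega) (by omega) (by omega)
      · obtain ⟨m, rfl⟩ : ∃ m, l = m + 1 := ⟨l - 1, by omega⟩
        exact (ih1 (by omega) (by omega) (by omega) (by omega)).col_pass hη hq (by omega)
          (by omega) hu (by omega) (by omega) (by omega)

/-! ### Supports -/

/-- The function `w` is supported on paths that lie weakly above the height function `B`. -/
def Above (B : ℕ → ℤ) (w : DualSpace N) : Prop := ∀ μ, w μ ≠ 0 → ∀ l, B l ≤ μ.ht l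

lemma Above.mono {B B' : ℕ → ℤ} {w : DualSpace N} (h : Above B w) (hB : ∀ l, B' l ≤ B l) :
    Above B' w := fun μ hμ l => (hB l).trans (h μ hμ l)

lemma Above.eq_zero {B : ℕ → ℤ} {w : DualSpace N} (h : Above B w) {μ : BallotPath N} (l : ℕ)
    (hl : μ.ht l < B l) : w μ = 0 := by
  by_contra hc
  exact absurd (h μ hc l) (by omega)

lemma ne_zero_of_tile {η ω : ℂ} {i u : ℕ} {w : DualSpace N} {μ : BallotPath N}
    (h : tile η ω N i u w μ ≠ 0) : w μ ≠ 0 ∨ w (act i μ) ≠ 0 := by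
  by_contra! hc
  exact h (by rw [tile_apply, hc.1, hc.2, mul_zero, mul_zero, add_zero])

lemma Above.tile {η ω : ℂ} {B : ℕ → ℤ} {i u : ℕ} {w : DualSpace N} (hi : i < N)
    (h : Above B w) : Above (fun l => if l = i then B l - 2 else B l) (tile η ω N i u w) :=
  fun μ hμ l => by
    rcases ne_zero_of_tile hμ with h1 | h1
    · have := h μ h1 l
      dsimp only; split_ifs <;> omega
    · have := h _ h1 l
      have := act_ht_le μ hi l
      dsimp only; split_ifs at * <;> omega

lemma Above.col {η ω : ℂ} {B : ℕ → ℤ} {i u a : ℕ} {w : DualSpace N} (hi : i + a ≤ N)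
    (h : Above B w) :
    Above (fun l => if i ≤ l ∧ l < i + a then B l - 2 else B l) (col η ω N i u a w) := by
  induction a generalizing i u with
  | zero => exact h.mono fun l => by split_ifs <;> omega
  | succ a ih =>
    refine ((ih (i := i + 1) (u := u + 1) (by omega)).tile (by omega)).mono fun l => ?_
    split_ifs <;> omega

lemma Above.tri {η ω : ℂ} {B : ℕ → ℤ} {u a : ℕ} {w : DualSpace N} (ha : a ≤ N)
    (h : Above B w) : Above (fun l => B l - 2 * ((a - l : ℕ) : ℤ)) (tri η ω N u a w) := by
  induction a generalizing u with
  | zero => exact h.mono fun l => by omega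
  | succ a ih =>
    change Above _ (QKZ.col η ω N 0 u (a + 1) (QKZ.tri η ω N (u + 2) a w))
    refine ((ih (u := u + 2) (by omega)).col (by omega)).mono fun l => ?_
    split_ifs <;> omega

lemma Above.stack {η ω : ℂ} {B : ℕ → ℤ} {base : ℕ → DualSpace N} {p b u a : ℕ}
    (hb : p + b + a ≤ N) (h : Above B (base (u + b))) :
    Above (fun l => B l - 2 * ((min b (l - p) - (l - p - a) : ℕ) : ℤ))
      (stack η ω base p b u a) := by
  induction b generalizing u with
  | zero => exact h.mono fun l => by omega
  | succ b ih =>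
    refine ((ih (u := u + 1) (by omega) (by rwa [add_right_comm])).col (by omega)).mono
      fun l => ?_
    split_ifs <;> omega

/-- The function `w` is supported on paths that coincide with `α` on `S`. -/
def AgreeOn (α : BallotPath N) (S : Set ℕ) (w : DualSpace N) : Prop :=
  ∀ μ, w μ ≠ 0 → ∀ l ∈ S, μ.ht l = α.ht l

/-- The generator `e_j` produces a path above `α` that coincides with `α` on `S` only from a path
with the latter property. -/
def Rigid (α : BallotPath N) (S : Set ℕ) (j : ℕ) : Prop :=
  ∀ μ : BallotPath N, (∀ l, α.ht l ≤ (act j μ).ht l) → (∀ l ∈ S, (act j μ).ht l = α.ht l) →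
    ∀ l ∈ S, μ.ht l = α.ht l

lemma AgreeOn.tile {η ω : ℂ} {α : BallotPath N} {S : Set ℕ} {i u : ℕ} {w : DualSpace N}
    (hr : Rigid α S i) (ha : Above α.ht w) (h : AgreeOn α S w) :
    AgreeOn α S (tile η ω N i u w) := fun μ hμ => by
  rcases ne_zero_of_tile hμ with h1 | h1
  · exact h μ h1
  · exact hr μ (ha _ h1) (h _ h1)

lemma AgreeOn.col {η ω : ℂ} {α : BallotPath N} {S : Set ℕ} {B : ℕ → ℤ} {i u a : ℕ}
    {w : DualSpace N} (hi : i + a ≤ N) (hr : ∀ j, i ≤ j → j < i + a → Rigid α S j)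
    (hB : Above B w) (hα : ∀ l, α.ht l ≤ B l)
    (hα' : ∀ l, i ≤ l → l < i + a → α.ht l ≤ B l - 2) (h : AgreeOn α S w) :
    AgreeOn α S (col η ω N i u a w) := by
  induction a generalizing i u with
  | zero => exact h
  | succ a ih =>
    refine AgreeOn.tile (hr i le_rfl (by omega)) ?_ (ih (i := i + 1) (u := u + 1) (by omega)
      (fun j h1 h2 => hr j (by omega) (by omega)) fun l h1 h2 => hα' l (by omega) (by omega))
    refine (hB.col (by omega)).mono fun l => ?_
    have h1 := hα l
    have h2 := hα' l
    split_ifs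
    · exact h2 (by omega) (by omega)
    · exact h1

lemma AgreeOn.tri {η ω : ℂ} {α : BallotPath N} {S : Set ℕ} {B : ℕ → ℤ} {u a : ℕ}
    {w : DualSpace N} (ha : a ≤ N) (hr : ∀ j, j < a → Rigid α S j) (hB : Above B w)
    (hα : ∀ l, α.ht l ≤ B l - 2 * ((a - l : ℕ) : ℤ)) (h : AgreeOn α S w) :
    AgreeOn α S (tri η ω N u a w) := by
  induction a generalizing u with
  | zero => exact h
  | succ a ih =>
    change AgreeOn α S (QKZ.col η ω N 0 u (a + 1) (QKZ.tri η ω N (u + 2) a w))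
    refine AgreeOn.col (by omega) (fun j _ h2 => hr j (by omega))
      (hB.tri (u := u + 2) (by omega)) (fun l => ?_) (fun l h1 h2 => ?_)
      (ih (by omega) (fun j h2 => hr j (by omega)) fun l => ?_) <;>
    · have := hα l
      omega

lemma AgreeOn.stack {η ω : ℂ} {α : BallotPath N} {S : Set ℕ} {B : ℕ → ℤ}
    {base : ℕ → DualSpace N} {p b u a : ℕ} (hb : p + b + a ≤ N)
    (hr : ∀ j, p < j → j < p + b + a → Rigid α S j) (hB : Above B (base (u + b)))
    (hα : ∀ l, α.ht l ≤ B l - 2 * ((min b (l - p) - (l - p - a) : ℕ) : ℤ))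
    (h : AgreeOn α S (base (u + b))) :
    AgreeOn α S (stack η ω base p b u a) := by
  induction b generalizing u with
  | zero => exact h
  | succ b ih =>
    rw [show u + (b + 1) = u + 1 + b by ring] at hB h
    refine AgreeOn.col (by omega) (fun j h1 h2 => hr j (by omega) (by omega))
      (Above.stack (η := η) (ω := ω) (by omega) hB) (fun l => ?_) (fun l h1 h2 => ?_)
      (ih (by omega) (fun j h1 h2 => hr j (by omega) (by omega)) hB (fun l => ?_) h) <;>
    · have := hα l
      omega

/-- Nothing changes to the right of a point from which the path descends to a low level: an arc
that `e_j` lowers would have to end on this descent or to cross its lowest point. -/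
lemma act_ht_eq_right {μ : BallotPath N} {j q m : ℕ} (hj : 1 ≤ j) (hjq : j < q) (hqm : q ≤ m)
    (hm : m ≤ N) (hlow : (act j μ).ht m + 2 ≤ (act j μ).ht j)
    (hdesc : ∀ l, q ≤ l → l < m → (act j μ).ht (l + 1) < (act j μ).ht l) {l : ℕ} (hl : q ≤ l) :
    (act j μ).ht l = μ.ht l := by
  rcases config_cases μ hj (by omega : j < N) with h | h | ⟨r, h⟩ | ⟨k, h⟩ | h
  · rw [act_max h]
  · rw [h.act (by omega), if_neg (by omega)]
  · have H := h.act
    obtain ⟨-, h2, h3, h4, h5, h6⟩ := h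
    rw [H, if_neg]
    rintro ⟨-, h7⟩
    rcases Nat.lt_or_ge m r with h8 | h8
    · have := h6 m (by omega) h8
      rw [H, H, if_pos (by omega), if_neg (by omega)] at hlow
      omega
    · have h9 := hdesc (r - 1) (by omega) (by omega)
      have := h6 (r - 1) (by omega) (by omega)
      have h10 := μ.step (r - 1) (by omega)
      rw [Nat.sub_add_cancel (by omega)] at h9 h10
      rw [H, H, if_neg (by omega), if_pos (by omega)] at h9
      omega
  · rw [h.act (by omega), if_neg (by omega)]
  · rw [h.act (by omega), if_neg (by omega)]

/-- Nothing changes to the left of a point up to which the path ascends from a low level. -/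
lemma act_ht_eq_left {μ : BallotPath N} {j p m : ℕ} (hj : j < N) (hjq : p < j) (hqm : m ≤ p)
    (hlow : (act j μ).ht m + 2 ≤ (act j μ).ht j)
    (hdesc : ∀ l, m ≤ l → l < p → (act j μ).ht l < (act j μ).ht (l + 1)) {l : ℕ} (hl : l ≤ p) :
    (act j μ).ht l = μ.ht l := by
  rcases config_cases μ (by omega : 1 ≤ j) hj with h | h | ⟨r, h⟩ | ⟨k, h⟩ | h
  · rw [act_max h]
  · rw [h.act (by omega), if_neg (by omega)]
  · rw [h.act, if_neg (by omega)]
  · have H := h.act hj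
    obtain ⟨h2, h3, h5, h6⟩ := h
    rw [H, if_neg]
    rintro ⟨h7, -⟩
    rcases Nat.lt_or_ge k m with h8 | h8
    · have := h6 m h8 (by omega)
      rw [H, H, if_pos (by omega), if_neg (by omega)] at hlow
      omega
    · have h9 := hdesc k (by omega) (by omega)
      have := h6 (k + 1) (by omega) (by omega)
      have h10 := μ.step k (by omega)
      rw [H, H, if_neg (by omega), if_pos (by omega)] at h9
      omega
  · have H := h.act hj
    have := h.2.2 m (by omega)
    rw [H, H, if_pos (by omega), if_neg (by omega)] at hlow
    omega

/-- A column of tiles acts on a path below the support of `w` by raising an ascending segment: the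
constant term of each of the tiles contributes nothing, as that position then is not raised. -/
lemma col_raise {η ω : ℂ} {B : ℕ → ℤ} {i u a : ℕ} {w : DualSpace N} (hi : i + a ≤ N)
    (hB : Above B w) {μ : BallotPath N} (hleft : 1 ≤ i → μ.ht i < μ.ht (i - 1))
    (hup : ∀ l, i ≤ l → l < i + a → μ.ht (l + 1) = μ.ht l + 1)
    (hlow : ∀ l, i ≤ l → l < i + a → μ.ht l < B l) :
    ∃ μ' : BallotPath N, (∀ l, μ'.ht l = if i ≤ l ∧ l < i + a then μ.ht l + 2 else μ.ht l) ∧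
      col η ω N i u a w μ = w μ' := by
  induction a generalizing i u μ with
  | zero => exact ⟨μ, fun l => (if_neg (by omega)).symm, rfl⟩
  | succ a ih =>
    have h1 := hup i le_rfl (by omega)
    have H : (∀ m, (act i μ).ht m = if m = i then μ.ht m + 2 else μ.ht m) ∧ wt η ω i μ = 1 := by
      rcases Nat.eq_zero_or_pos i with rfl | h0
      · rw [zero_add] at h1
        exact ⟨act_zero_raise (by omega) (by omega), wt_zero_raise η ω (by omega)⟩
      · exact ⟨act_min h0 (by omega) (hleft h0) (by omega),
          wt_min η ω h0 (hleft h0) (by omega)⟩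
    obtain ⟨H, hw⟩ := H
    obtain ⟨μ', h2, h3⟩ := ih (i := i + 1) (u := u + 1) (μ := act i μ) (by omega)
      (fun _ => by rw [H, H, if_neg (by omega), if_pos (by omega), Nat.add_sub_cancel]; omega)
      (fun l h4 h5 => by
        rw [H, H, if_neg (by omega), if_neg (by omega)]; exact hup l (by omega) (by omega))
      (fun l h4 h5 => by rw [H, if_neg (by omega)]; exact hlow l (by omega) (by omega))
    refine ⟨μ', fun l => ?_, ?_⟩
    · rw [h2, H]; split_ifs <;> omega
    · rw [col_succ_apply, tile_apply, h3, hw, (hB.col (by omega)).eq_zero i, mul_zero, one_mul,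
        add_zero]
      rw [if_neg (by omega)]
      exact hlow i le_rfl (by omega)

/-! ### Columns along a descent to the left boundary -/

lemma col_add (η ω : ℂ) (i u k m : ℕ) :
    col η ω N i u (k + m) = col η ω N i u k * col η ω N (i + k) (u + k) m := by
  induction k generalizing i u with
  | zero => rw [zero_add]; exact (one_mul _).symm
  | succ k ih =>
    rw [add_right_comm, col, col, ih, mul_assoc, add_right_comm, add_assoc i, add_right_comm u,
      add_assoc u]

/-- Next to a local maximum, a column of tiles on a descent moves the maximum to the end of the
column. -/
lemma col_apply_of_isMax {η ω : ℂ} {i u k : ℕ} {x : DualSpace N} {ν : BallotPath N} (hi : 1 ≤ i)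
    (hk : i + k < N) (hx : ∀ l, i ≤ l → l < i + k → Kill l x) (hν : ν.ht (i - 1) < ν.ht i)
    (hdesc : ∀ l, i ≤ l → l ≤ i + k → ν.ht (l + 1) = ν.ht l - 1) :
    ∃ ν' : BallotPath N, (∀ m, ν'.ht m = if i ≤ m ∧ m < i + k then ν.ht m - 2 else ν.ht m) ∧
      col η ω N (i + 1) u k x ν = x ν' := by
  induction k generalizing i u ν with
  | zero => exact ⟨ν, fun m => (if_neg (by omega)).symm, rfl⟩
  | succ k ih =>
    have d1 := hdesc i le_rfl (by omega)
    have d2 := hdesc (i + 1) (by omega) (by omega)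
    have s := ν.step (i - 1) (by omega)
    rw [Nat.sub_add_cancel hi] at s
    have hd : IsDown ν (i - 1) (i + 1) :=
      ⟨by omega, by omega, by omega, fun l h1 h2 => by rw [show l = i by omega]; omega⟩
    have H := hd.act (by omega)
    obtain ⟨ν', h1, h2⟩ := ih (i := i + 1) (u := u + 1) (ν := act (i + 1) ν) (by omega)
      (by omega) (fun l h3 h4 => hx l (by omega) (by omega))
      (by rw [H, H, if_pos (by omega), if_neg (by omega), Nat.add_sub_cancel]; omega)
      (fun l h3 h4 => by
        rw [H, H, if_neg (by omega), if_neg (by omega)]; exact hdesc l (by omega) (by omega))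
    refine ⟨ν', fun m => ?_, ?_⟩
    · rw [h1, H]; split_ifs <;> omega
    · have hz : col η ω N (i + 1 + 1) (u + 1) k x ν = 0 :=
        (hx i le_rfl (by omega)).col_far (by omega) (by omega) (by omega) ν
          ⟨hi, hν, by omega⟩
      rw [col_succ_apply, tile_apply, h2, hd.wt, hz, mul_zero, one_mul, add_zero]

/-- The coefficient of the lowered path in the action of a column on a descent that starts at the
left boundary. -/
def freeSum (η ω : ℂ) : (i : ℕ) → (u : ℂ) → (k : ℕ) → ℂ
  | _, _, 0 => 0
  | i, u, k + 1 => freeWt η ω i * qnum η u + freeSum η ω (i + 1) (u + 1) k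

/-- A column of tiles on a descent that starts at the left boundary: either no generator acts, or
one of them acts freely, and the following ones move the local maximum that arises to the end of
the column. -/
lemma col_apply_of_free {η ω : ℂ} {i u k : ℕ} {x : DualSpace N} {μ : BallotPath N} (hi : 1 ≤ i)
    (hk : i + k < N) (hx : ∀ l, i ≤ l → l < i + k → Kill l x)
    (hμ : ∀ l, l ≤ i + k + 1 → μ.ht l = μ.ht 0 - l)
    (hq : ∀ n : ℕ, n ≤ k → qnum η ((u + n : ℕ) : ℂ) ≠ 0) :
    ∃ μ' : BallotPath N, (∀ m, μ'.ht m = if m < i + k then μ.ht m - 2 else μ.ht m) ∧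
      col η ω N i u (k + 1) x μ * qnum η u =
        qnum η ((u + (k + 1) : ℕ) : ℂ) * x μ + freeSum η ω i u (k + 1) * x μ' := by
  induction k generalizing i u with
  | zero =>
    have hf : IsFree μ i :=
      ⟨hi, by rw [hμ _ (by omega), hμ i (by omega)]; omega,
        fun l hl => by rw [hμ i (by omega), hμ l (by omega)]; omega⟩
    refine ⟨act i μ, hf.act (by omega), ?_⟩
    have h0 := hq 0 le_rfl
    rw [add_zero] at h0
    change (wt η ω i μ * x (act i μ) + tileConst η ω i u * x μ) * _ = _
    rw [hf.wt, tileConst_pos η ω hi]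
    simp only [freeSum]
    push_cast
    field_simp
    ring
  | succ k ih =>
    have hf : IsFree μ i :=
      ⟨hi, by rw [hμ _ (by omega), hμ i (by omega)]; omega,
        fun l hl => by rw [hμ i (by omega), hμ l (by omega)]; omega⟩
    have H := hf.act (by omega)
    obtain ⟨μ', h1, h2⟩ := ih (i := i + 1) (u := u + 1) (by omega) (by omega)
      (fun l h3 h4 => hx l (by omega) (by omega)) (fun l h3 => hμ l (by omega))
      (fun n hn => by rw [add_right_comm, add_assoc]; exact hq (n + 1) (by omega))
    obtain ⟨ν', h3, h4⟩ := col_apply_of_isMax (η := η) (ω := ω) (u := u + 1) (k := k + 1) (x := x)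
      (ν := act i μ) hi (by omega) hx
      (by rw [H, H, if_pos (by omega), if_neg (by omega), hμ _ (by omega), hμ i (by omega)]
          omega)
      (fun l h5 h6 => by
        rw [H, H, if_neg (by omega), if_neg (by omega), hμ _ (by omega), hμ l (by omega)]
        push_cast; ring)
    have he : ν' = μ' := BallotPath.ext_ht fun m => by
      rw [h1, h3, H]; split_ifs <;> omega
    subst he
    refine ⟨ν', fun m => ?_, ?_⟩
    · rw [h1]; exact if_congr (by omega) rfl rfl
    · have h0 := hq 0 (by omega)
      have h00 := hq 1 (by omega)
      rw [add_zero] at h0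
      rw [col_succ_apply, tile_apply, hf.wt, h4, tileConst_pos η ω hi]
      rw [freeSum, show u + (k + 1 + 1) = u + 1 + (k + 1) by ring]
      push_cast at h2 h00 ⊢
      have e : qnum η (u + 1) / qnum η u * col η ω N (i + 1) (u + 1) (k + 1) x μ * qnum η u =
        col η ω N (i + 1) (u + 1) (k + 1) x μ * qnum η (u + 1) := by field_simp
      rw [add_mul, e, h2]
      ring

/-! ### Paths that descend from the boundary and ascend to a straight path -/

/-- The path `μ` descends on `[0, c]`, ascends on `[c, t]`, and coincides with `γ` to the right of
`t`, for a path `γ` that descends on `[0, t]`. -/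
def IsVee (γ : BallotPath N) (c t : ℕ) (μ : BallotPath N) : Prop :=
  ∀ l, μ.ht l = γ.ht l - 2 * ((t - max l c : ℕ) : ℤ)

/-- The numerator of the coefficients of the trapezoid of tiles. The auxiliary parameter `ν` is
the same for all the half-tiles of the trapezoid, since their contents have the same parity. -/
def veeCoeff (η ω ν : ℂ) : (i k : ℕ) → (u : ℂ) → ℂ
  | _, 0, _ => 1
  | i, k + 1, u => -kap η ω ν (if Even i then u else 1 - u) * veeCoeff η ω ν (i + 1) k (u + 1)

lemma veeCoeff_add_two (η ω ν : ℂ) (i k : ℕ) (u : ℂ) :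
    veeCoeff η ω ν (i + 2) k u = veeCoeff η ω ν i k u := by
  induction k generalizing i u with
  | zero => rfl
  | succ k ih =>
    have h : Even (i + 2) ↔ Even i := by simp [Nat.even_add]
    rw [veeCoeff, veeCoeff, add_right_comm, ih]
    simp only [h]

/-- The recursion of the coefficients of the trapezoid, which is a consequence of the relations
`kap_sub_kap_neg` and `kap_add_two` of the boundary weights. -/
lemma veeCoeff_succ {η ω : ℂ} (hω : qnum η (ω + 1) ≠ 0) (ν : ℂ) (j k : ℕ) (u : ℂ) :
    veeCoeff η ω ν (j + 1) (k + 1) u = veeCoeff η ω ν j (k + 1) (u + 1) +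
      freeSum η ω (j + 1) u (k + 1) * veeCoeff η ω ν j k (u + 1) := by
  have key : ∀ (j : ℕ) (u : ℂ), -kap η ω ν (if Even (j + 1) then u else 1 - u) =
      -kap η ω ν (if Even j then u + 1 else 1 - (u + 1)) + freeWt η ω (j + 1) * qnum η u := by
    intro j u
    have h1 := kap_sub_kap_neg η ω ν u
    have h2 := kap_add_two hω ν (u - 1)
    rw [sub_add_cancel, neg_sub, show u - 1 + 2 = u + 1 by ring] at h2
    by_cases hj : Even j
    · have hj' : ¬ Even (j + 1) := by simpa [Nat.even_add_one] using hj
      rw [freeWt, if_neg hj', if_pos hj, if_neg hj', ← h2]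
      ring
    · have hj' : Even (j + 1) := by simpa [Nat.even_add_one] using hj
      rw [freeWt, if_pos hj', if_neg hj, if_pos hj', show 1 - (u + 1) = -u by ring]
      linear_combination -h1
  induction k generalizing j u with
  | zero =>
    simp only [veeCoeff, freeSum, mul_one, add_zero]
    exact key j u
  | succ k ih =>
    have h1 := ih (j + 1) (u + 1)
    have h2 : veeCoeff η ω ν (j + 1 + 1) (k + 1) (u + 1) =
      -kap η ω ν (if Even j then u + 1 else 1 - (u + 1)) *
        veeCoeff η ω ν (j + 1) k (u + 1 + 1) := by
      rw [veeCoeff_add_two]; rfl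
    have h3 := key j u
    rw [veeCoeff, freeSum]
    conv_rhs => rw [veeCoeff, show veeCoeff η ω ν j (k + 1) (u + 1) =
      -kap η ω ν (if Even j then u + 1 else 1 - (u + 1)) *
        veeCoeff η ω ν (j + 1) k (u + 1 + 1) from rfl]
    rw [h3]
    linear_combination (-kap η ω ν (if Even j then u + 1 else 1 - (u + 1))) * h1 +
      freeWt η ω (j + 1) * qnum η u * h2

lemma prod_qnum_succ (η : ℂ) (u k : ℕ) :
    ∏ n ∈ Finset.range (k + 1), qnum η ((u + n : ℕ) : ℂ) =
      qnum η u * ∏ n ∈ Finset.range k, qnum η ((u + 1 + n : ℕ) : ℂ) := by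
  rw [Finset.prod_range_succ', mul_comm, add_zero]
  congr 1
  exact Finset.prod_congr rfl fun n _ => by rw [add_right_comm, add_assoc]

/-- A column of tiles in the trapezoid: the coefficients of its paths `IsVee γ (j + k) (j + a)`
determine those after the column. -/
lemma col_vee {η ω : ℂ} (hω : qnum η (ω + 1) ≠ 0) (ν : ℂ) {γ : BallotPath N} {j u a k : ℕ}
    {w : DualSpace N} (hj : j + a + 1 < N) (hγ : ∀ l, l ≤ j + a + 1 → γ.ht l = γ.ht 0 - l)
    (hq : ∀ n : ℕ, n < a → qnum η ((u + n : ℕ) : ℂ) ≠ 0)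
    (hB : Above (fun l => γ.ht l - 2 * ((j + a - max l j : ℕ) : ℤ)) w)
    (hkill : ∀ l, j < l → l < j + a → Kill l w)
    (hw : ∀ k μ, k ≤ a → IsVee γ (j + k) (j + a) μ →
      w μ * ∏ n ∈ Finset.range k, qnum η ((u + 1 + n : ℕ) : ℂ) =
        veeCoeff η ω ν j k ((u + 1 : ℕ) : ℂ)) (hk : k ≤ a) {μ : BallotPath N}
    (hμ : IsVee γ (j + 1 + k) (j + 1 + a) μ) :
    col η ω N (j + 1) u a w μ * ∏ n ∈ Finset.range k, qnum η ((u + n : ℕ) : ℂ) =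
      veeCoeff η ω ν (j + 1) k u := by
  obtain ⟨m, rfl⟩ : ∃ m, a = k + m := ⟨a - k, by omega⟩
  rw [col_add, Module.End.mul_apply]
  set x := col η ω N (j + 1 + k) (u + k) m w with hx
  -- The part of the column on the ascent raises `μ`, and the lowered version of `μ` as well.
  have raise : ∀ (c : ℕ) (μ' : BallotPath N), c + 1 = j + 1 + k ∨ c + 2 = j + 1 + k →
      (∀ l, μ'.ht l = if l < j + k ∧ c < j + k then μ.ht l - 2 else μ.ht l) →
      ∃ μ₁, IsVee γ c (j + (k + m)) μ₁ ∧ x μ' = w μ₁ := by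
    intro c μ' hc hμ'
    obtain ⟨μ₁, h1, h2⟩ := col_raise (η := η) (ω := ω) (i := j + 1 + k) (u := u + k) (a := m)
      (by omega) hB (μ := μ')
      (fun _ => by
        rw [hμ', hμ', hμ, hμ, hγ (j + 1 + k) (by omega), hγ (j + 1 + k - 1) (by omega)]
        split_ifs <;> omega)
      (fun l h3 h4 => by
        rw [hμ', hμ', hμ, hμ, hγ _ (by omega), hγ l (by omega)]; split_ifs <;> omega)
      (fun l h3 h4 => by
        rw [hμ', hμ]; split_ifs <;> omega)
    refine ⟨μ₁, fun l => ?_, h2⟩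
    rw [h1, hμ', hμ]
    split_ifs <;> omega
  rcases k with _ | k
  · obtain ⟨μ₁, h1, h2⟩ := raise j μ (by omega) fun l => (if_neg (by omega)).symm
    have h3 := hw 0 μ₁ (by omega) h1
    rw [Finset.prod_range_zero] at h3 ⊢
    change x μ * 1 = 1
    rw [h2, h3]
    rfl
  · have hxk : ∀ l, j + 1 ≤ l → l < j + 1 + k → Kill l x := fun l h1 h2 =>
      (hkill l (by omega) (by omega)).col_far (by omega) (by omega) (by omega)
    obtain ⟨μ', h1, h2⟩ := col_apply_of_free (η := η) (ω := ω) (i := j + 1) (u := u) (k := k)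
      (μ := μ) (by omega) (by omega) hxk
      (fun l h3 => by
        rw [hμ l, hμ 0, hγ l (by omega)]; omega)
      (fun n hn => hq n (by omega))
    obtain ⟨μ₁, h3, h4⟩ := raise (j + (k + 1)) μ (by omega) fun l => (if_neg (by omega)).symm
    obtain ⟨μ₂, h5, h6⟩ := raise (j + k) μ' (by omega) fun l => by
      rw [h1]; exact if_congr (by omega) rfl rfl
    have h7 := hw _ μ₁ (by omega) h3
    have h8 := hw _ μ₂ (by omega) h5
    rw [h4, h6] at h2
    rw [prod_qnum_succ, ← mul_assoc, h2, veeCoeff_succ hω]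
    rw [Nat.cast_add_one u] at h7 h8
    rw [← h7, ← h8, Finset.prod_range_succ, show u + 1 + k = u + (k + 1) by ring]
    ring

lemma kill_single {γ : BallotPath N} {l : ℕ} (h : ¬ IsMax γ l) :
    Kill l (Pi.single γ 1 : DualSpace N) := fun μ hμ =>
  Pi.single_eq_of_ne (by rintro rfl; exact h hμ) 1

lemma above_single (γ : BallotPath N) : Above γ.ht (Pi.single γ 1 : DualSpace N) := fun μ hμ l => by
  by_cases h : μ = γ
  · rw [h]
  · exact absurd (Pi.single_eq_of_ne h 1) hμ

lemma agreeOn_single {α γ : BallotPath N} {S : Set ℕ} (h : ∀ l ∈ S, γ.ht l = α.ht l) :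
    AgreeOn α S (Pi.single γ 1 : DualSpace N) := fun μ hμ l hl => by
  by_cases h' : μ = γ
  · rw [h', h l hl]
  · exact absurd (Pi.single_eq_of_ne h' 1) hμ

lemma single_vee {γ μ : BallotPath N} (h : IsVee γ 0 0 μ) :
    (Pi.single γ 1 : DualSpace N) μ = 1 := by
  obtain rfl : μ = γ := BallotPath.ext_ht fun l => by rw [h l]; omega
  exact Pi.single_eq_same _ _

/-- The coefficients of the triangle of tiles at the boundary. -/
lemma tri_vee {η ω : ℂ} (hη : η = 0 ∨ Complex.exp η - Complex.exp (-η) ≠ 0)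
    (hω : qnum η (ω + 1) ≠ 0)
    (hq : ∀ k : ℕ, 1 ≤ k → k ≤ N → qnum η k ≠ 0) {γ : BallotPath N} {Q : ℕ} (hQ : Q < N)
    (hγ : ∀ l, l ≤ Q → γ.ht l = γ.ht 0 - l) {a u k : ℕ} (hu : 1 ≤ u) (hua : u + 2 * a ≤ N + 2)
    (ha : a ≤ Q) (hk : k ≤ a) {μ : BallotPath N} (hμ : IsVee γ k a μ) :
    tri η ω N u a (Pi.single γ 1) μ * ∏ n ∈ Finset.range k, qnum η ((u + n : ℕ) : ℂ) =
      veeCoeff η ω (ω + ((u % 2 : ℕ) : ℂ)) 0 k u := by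
  induction a generalizing u k μ with
  | zero =>
    obtain rfl : k = 0 := by omega
    rw [Finset.prod_range_zero, mul_one]
    exact single_vee hμ
  | succ a ih =>
    set w := tri η ω N (u + 2) a (Pi.single γ 1) with hw
    have hB : Above (fun l => γ.ht l - 2 * ((a - l : ℕ) : ℤ)) w :=
      (above_single γ).tri (by omega)
    have hprod : ∀ k, k < a → qnum η ((u + 1 + k : ℕ) : ℂ) ≠ 0 := fun k hk =>
      hq _ (by omega) (by omega)
    rcases k with _ | k
    · obtain ⟨μ', h1, h2⟩ := col_raise (η := η) (ω := ω) (i := 0) (u := u) (a := a + 1)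
        (by omega) hB (μ := μ) (by omega)
        (fun l h3 h4 => by rw [hμ, hμ, hγ _ (by omega), hγ l (by omega)]; omega)
        (fun l h3 h4 => by rw [hμ]; omega)
      have h3 := ih (u := u + 2) (k := 0) (μ := μ') (by omega) (by omega) (by omega) (by omega)
        (fun l => by rw [h1, hμ]; split_ifs <;> omega)
      rw [Finset.prod_range_zero, mul_one] at h3 ⊢
      change col η ω N 0 u (a + 1) w μ = 1
      exact h2.trans h3
    · -- The half-tile acts on a descent by its scalar part.
      have h1 := col_vee hω (ω + ((u % 2 : ℕ) : ℂ)) (γ := γ) (j := 0) (u := u + 1) (a := a)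
        (k := k) (w := w) (μ := μ) (by omega) (fun l hl => hγ l (by omega)) hprod
        (hB.mono fun l => by omega)
        (fun l h1 h2 => kill_tri hη hω hq (Q := Q) (by omega)
          (fun l h3 h4 => kill_single fun h5 => by
            have := h5.2.1
            rw [hγ _ (by omega), hγ l (by omega)] at this
            omega) (by omega) (by omega) (by omega) (by omega) (by omega) (by omega))
        (fun k μ h3 h4 => by
          have h5 := ih (u := u + 2) (k := k) (μ := μ) (by omega) (by omega) (by omega) h3
            (by simpa only [zero_add] using h4)
          rwa [Nat.add_mod_right] at h5) (by omega)
        (by rwa [zero_add, add_comm 1 k, add_comm 1 a])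
      have hd : μ.ht 1 < μ.ht 0 := by
        rw [hμ, hμ, hγ 1 (by omega)]; omega
      have h0 := hq u hu (by omega)
      change tile η ω N 0 u (col η ω N 1 (u + 1) a w) μ * _ = _
      rw [tile_apply, act_zero_down hd, wt_zero_down η ω hd, prod_qnum_succ, veeCoeff,
        if_pos Even.zero, ← Nat.cast_add_one, ← h1, tileConst, if_pos rfl]
      field_simp
      ring

/-- The coefficients of the trapezoid of tiles. -/
lemma stack_vee {η ω : ℂ} (hη : η = 0 ∨ Complex.exp η - Complex.exp (-η) ≠ 0)
    (hω : qnum η (ω + 1) ≠ 0)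
    (hq : ∀ k : ℕ, 1 ≤ k → k ≤ N → qnum η k ≠ 0) {γ : BallotPath N} {Q : ℕ} (hQ : Q < N)
    (hγ : ∀ l, l ≤ Q → γ.ht l = γ.ht 0 - l) {a b u k : ℕ} (hu : 1 ≤ u)
    (hua : u + b + 2 * a ≤ N + 2) (ha : b + a ≤ Q) (hk : k ≤ a) {μ : BallotPath N}
    (hμ : IsVee γ (b + k) (b + a) μ) :
    stack η ω (fun v => tri η ω N v a (Pi.single γ 1)) 0 b u a μ *
      ∏ n ∈ Finset.range k, qnum η ((u + n : ℕ) : ℂ) =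
        veeCoeff η ω (ω + (((b + u) % 2 : ℕ) : ℂ)) b k u := by
  have hγk : ∀ l, 1 ≤ l → l < Q → Kill l (Pi.single γ 1 : DualSpace N) :=
    fun l h3 h4 => kill_single fun h5 => by
      have := h5.2.1
      rw [hγ _ (by omega), hγ l (by omega)] at this
      omega
  induction b generalizing u k μ with
  | zero =>
    simp only [zero_add] at hμ ⊢
    exact tri_vee hη hω hq hQ hγ hu (by omega) (by omega) hk hμ
  | succ b ih =>
    have h1 := col_vee hω (ω + (((b + 1 + u) % 2 : ℕ) : ℂ)) (γ := γ) (j := b) (u := u) (a := a)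
      (k := k) (w := stack η ω (fun v => tri η ω N v a (Pi.single γ 1)) 0 b (u + 1) a) (μ := μ)
    rw [← h1]
    · change col η ω N (0 + b + 1) u a _ μ * _ = _
      rw [zero_add]
    · omega
    · exact fun l hl => hγ l (by omega)
    · exact fun n hn => hq _ (by omega) (by omega)
    · refine (Above.stack (by omega) ((above_single γ).tri (by omega))).mono fun l => ?_
      omega
    · intro l h2 h3
      exact kill_stack hη hq (Q := Q) (by omega)
        (fun l h4 h5 h6 => kill_tri hη hω hq (by omega) hγk (by omega) (by omega) (by omega)
          (by omega) h5 (by omega)) (by omega) (by omega) (by omega) (by omega) (by omega)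
          (by omega) (by omega)
    · intro k μ h2 h3
      have h4 := ih (u := u + 1) (by omega) (by omega) (by omega) h2 h3
      rwa [show b + (u + 1) = b + 1 + u by ring] at h4
    · exact hk
    · exact hμ

/-- For the content `1` at the lower corner, the choice of the auxiliary parameter leaves only the
coefficient of the path `IsVee γ i (i + a)`. -/
lemma veeCoeff_one {η : ℂ} (ω : ℂ) (i k : ℕ) :
    veeCoeff η ω (ω + (((i + 1) % 2 : ℕ) : ℂ)) i (k + 1) 1 = 0 := by
  have h : kap η ω (ω + (((i + 1) % 2 : ℕ) : ℂ)) (if Even i then 1 else 1 - 1) = 0 := by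
    rw [kap, kfun]
    rcases Nat.even_or_odd i with hi | hi
    · have : (i + 1) % 2 = 1 := by obtain ⟨r, rfl⟩ := hi; omega
      rw [if_pos hi, this, Nat.cast_one,
        show (ω - (ω + 1)) / 2 + 1 / 2 = 0 by ring, qnum_zero, mul_zero, zero_div]
    · have : (i + 1) % 2 = 0 := by obtain ⟨r, rfl⟩ := hi; omega
      rw [if_neg (Nat.not_even_iff_odd.mpr hi), this, Nat.cast_zero,
        show (ω - (ω + 0)) / 2 + (1 - 1) / 2 = 0 by ring, qnum_zero, mul_zero, zero_div]
  rw [veeCoeff, h, neg_zero, zero_mul]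

/-! ### Rectangles and trapezoids of tiles -/

lemma rigid_right {α : BallotPath N} {q j : ℕ} {h : ℤ} (hjN : j < N) (hjq : j < q)
    (hright : ∃ m, q ≤ m ∧ m ≤ N ∧ α.ht m ≤ h ∧ ∀ l, q ≤ l → l < m → α.ht (l + 1) < α.ht l)
    (hj : 1 ≤ j → h < α.ht (j - 1) ∨ h < α.ht (j + 1)) : Rigid α {l | q ≤ l} j := by
  obtain ⟨m, h1, h2, h3, h4⟩ := hright
  intro μ h5 h6 l hl
  rw [← h6 l hl]
  rcases Nat.eq_zero_or_pos j with rfl | hj0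
  · have := μ.step 0 hjN
    rw [zero_add] at this
    rcases this with h7 | h7
    · rw [act_zero_raise hjN (by omega), if_neg (by have : q ≤ l := hl; omega)]
    · rw [act_zero_down (by omega)]
  · refine (act_ht_eq_right hj0 hjq h1 h2 ?_ (fun l' h7 h8 => ?_) hl).symm
    · obtain ⟨-, h8, h9⟩ := act_isMax μ hj0 hjN
      have := h5 (j - 1)
      have := h5 (j + 1)
      rw [h6 m h1]
      have := hj hj0
      omega
    · rw [h6 l' h7, h6 (l' + 1) (by have : q ≤ l' := h7; exact this.trans (by omega))]
      exact h4 l' h7 h8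

lemma rigid_left {α : BallotPath N} {p j : ℕ} {h : ℤ} (hjN : j < N) (hjp : p < j)
    (hleft : ∃ m, m ≤ p ∧ α.ht m ≤ h ∧ ∀ l, m ≤ l → l < p → α.ht l < α.ht (l + 1))
    (hj : h < α.ht (j - 1) ∨ h < α.ht (j + 1)) : Rigid α {l | l ≤ p} j := by
  obtain ⟨m, h1, h3, h4⟩ := hleft
  intro μ h5 h6 l hl
  rw [← h6 l hl]
  refine (act_ht_eq_left hjN hjp h1 ?_ (fun l' h7 h8 => ?_) hl).symm
  · obtain ⟨-, h8, h9⟩ := act_isMax μ (by omega) hjN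
    have := h5 (j - 1)
    have := h5 (j + 1)
    rw [h6 m h1]
    omega
  · rw [h6 l' (by have : l' < p := h8; exact this.le), h6 (l' + 1) h8]
    exact h4 l' h7 h8

lemma Rigid.union {α : BallotPath N} {S T : Set ℕ} {j : ℕ} (hS : Rigid α S j)
    (hT : Rigid α T j) : Rigid α (S ∪ T) j := fun μ h1 h2 l hl =>
  hl.elim (hS μ h1 (fun l hl => h2 l (Or.inl hl)) l) (hT μ h1 (fun l hl => h2 l (Or.inr hl)) l)

/-- Without a local maximum, the path continues to ascend. -/
lemma ascend_of_not_isMax {μ : BallotPath N} {l q : ℕ} (hq : q ≤ N) (hl : 1 ≤ l)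
    (hup : μ.ht (l - 1) < μ.ht l) (hmax : ∀ m, l ≤ m → m < q → ¬ IsMax μ m) {m : ℕ}
    (hlm : l ≤ m) (hm : m ≤ q) : μ.ht m = μ.ht l + (m - l : ℕ) ∧ μ.ht (m - 1) < μ.ht m := by
  induction m, hlm using Nat.le_induction with
  | base => simpa using hup
  | succ m hlm ih =>
    obtain ⟨h1, h2⟩ := ih (by omega)
    have h3 := μ.step m (by omega)
    have h4 : ¬ μ.ht (m + 1) < μ.ht m := fun h => hmax m hlm (by omega) ⟨by omega, h2, h⟩
    rw [Nat.add_sub_cancel]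
    omega

/-- The value of a rectangle of tiles at its lowest path. -/
lemma stack_raise {η ω : ℂ} {γ : BallotPath N} {p a b u : ℕ} (hN : p + b + a ≤ N)
    (hup : ∀ l, p ≤ l → l < p + a → γ.ht (l + 1) = γ.ht l + 1)
    (hdown : ∀ l, p + a ≤ l → l < p + b + a → γ.ht (l + 1) = γ.ht l - 1) {μ : BallotPath N}
    (hμ : ∀ l, μ.ht l = γ.ht l - 2 * ((min b (l - p) - (l - p - a) : ℕ) : ℤ)) :
    stack η ω (fun _ => Pi.single γ 1) p b u a μ = 1 := by
  induction b generalizing u μ with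
  | zero =>
    obtain rfl : μ = γ := BallotPath.ext_ht fun l => by rw [hμ l]; omega
    exact Pi.single_eq_same _ _
  | succ b ih =>
    have hB := Above.stack (η := η) (ω := ω) (base := fun _ => Pi.single γ 1) (p := p) (b := b)
      (u := u + 1) (a := a) (by omega) (above_single γ)
    have hl : ∀ l, p + b + 1 ≤ l → l < p + b + 1 + a →
        μ.ht (l + 1) = μ.ht l + 1 := fun l h1 h2 => by
      have h3 := hup l
      have h4 := hdown l
      rw [hμ, hμ]
      rcases Nat.lt_or_ge l (p + a) with h5 | h5
      · rw [h3 (by omega) h5]; omega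
      · rw [h4 h5 (by omega)]; omega
    obtain ⟨μ', h1, h2⟩ := col_raise (η := η) (ω := ω) (i := p + b + 1) (u := u) (a := a)
      (by omega) hB (μ := μ)
      (fun _ => by
        have h3 := hup (p + b)
        have h4 := hdown (p + b)
        rw [hμ, hμ, Nat.add_sub_cancel]
        rcases Nat.lt_or_ge (p + b) (p + a) with h5 | h5
        · rw [h3 (by omega) h5]; omega
        · rw [h4 h5 (by omega)]; omega) hl
      (fun l h3 h4 => by rw [hμ]; omega)
    change col η ω N (p + b + 1) u a _ μ = 1
    rw [h2]
    refine ih (by omega) (fun l h3 h4 => hdown l (by omega) (by omega)) fun l => ?_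
    rw [h1, hμ]
    split_ifs <;> omega

/-- A rectangle of tiles next to two slopes that are at least as long as its sides. -/
lemma stack_single {η ω : ℂ} (hη : η = 0 ∨ Complex.exp η - Complex.exp (-η) ≠ 0)
    (hq : ∀ k : ℕ, 1 ≤ k → k ≤ N → qnum η k ≠ 0) {α γ : BallotPath N} {p a b : ℕ}
    (hb : 1 ≤ b) (ha : 1 ≤ a) (hN : p + b + a < N)
    (hup : ∀ l, p ≤ l → l < p + a → γ.ht (l + 1) = γ.ht l + 1)
    (hdown : ∀ l, p + a ≤ l → l < p + b + a → γ.ht (l + 1) = γ.ht l - 1)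
    (hα : ∀ l, α.ht l = γ.ht l - 2 * ((min b (l - p) - (l - p - a) : ℕ) : ℤ))
    (hleft : ∃ m, m ≤ p ∧ α.ht m ≤ α.ht (p + b) ∧
      ∀ l, m ≤ l → l < p → α.ht l < α.ht (l + 1))
    (hright : ∃ m, p + b + a ≤ m ∧ m ≤ N ∧ α.ht m ≤ α.ht (p + b) ∧
      ∀ l, p + b + a ≤ l → l < m → α.ht (l + 1) < α.ht l) :
    stack η ω (fun _ => Pi.single γ 1) p b 1 a = Pi.single α 1 := by
  have hdα : ∀ l, p ≤ l → l < p + b → α.ht (l + 1) = α.ht l - 1 := fun l h1 h2 => by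
    have h3 := hup l
    have h4 := hdown l
    rw [hα, hα]
    rcases Nat.lt_or_ge l (p + a) with h5 | h5
    · rw [h3 (by omega) h5]; omega
    · rw [h4 h5 (by omega)]; omega
  have huα : ∀ l, p + b ≤ l → l < p + b + a → α.ht (l + 1) = α.ht l + 1 := fun l h1 h2 => by
    have h3 := hup l
    have h4 := hdown l
    rw [hα, hα]
    rcases Nat.lt_or_ge l (p + a) with h5 | h5
    · rw [h3 (by omega) h5]; omega
    · rw [h4 h5 (by omega)]; omega
  have hdα' : ∀ n, n ≤ b → α.ht (p + b - n) = α.ht (p + b) + n := fun n hn => by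
    have h1 := eq_sub_of_descent hdα (l := p + b - n) (by omega) (by omega)
    have h2 := eq_sub_of_descent hdα (l := p + b) (by omega) le_rfl
    omega
  have huα' : ∀ n, n ≤ a → α.ht (p + b + n) = α.ht (p + b) + n := fun n hn => by
    have h1 := eq_add_of_ascent huα (l := p + b + n) (by omega) (by omega)
    omega
  have hhigh : ∀ j, p < j → j < p + b + a → α.ht (p + b) < α.ht (j - 1) ∨
      α.ht (p + b) < α.ht (j + 1) := fun j h1 h2 => by
    rcases Nat.lt_or_ge j (p + b) with h3 | h3
    · left
      have := hdα' (p + b - (j - 1)) (by omega)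
      rw [show p + b - (p + b - (j - 1)) = j - 1 by omega] at this
      omega
    · right
      have := huα' (j + 1 - (p + b)) (by omega)
      rw [show p + b + (j + 1 - (p + b)) = j + 1 by omega] at this
      omega
  have hab : Above α.ht (stack η ω (fun _ => Pi.single γ 1) p b 1 a) :=
    (Above.stack (by omega) (above_single γ)).mono fun l => (hα l).le
  have hag : AgreeOn α ({l | l ≤ p} ∪ {l | p + b + a ≤ l})
      (stack η ω (fun _ => Pi.single γ 1) p b 1 a) := by
    refine AgreeOn.stack (by omega) (fun j h1 h2 => ?_) (above_single γ)
      (fun l => (hα l).le) (agreeOn_single fun l hl => ?_)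
    · exact (rigid_left (by omega) h1 hleft (hhigh j h1 h2)).union
        (rigid_right (by omega) h2 hright fun _ => hhigh j h1 h2)
    · rw [hα l]
      rcases hl with hl | hl <;> (simp only [Set.mem_ofPred_eq] at hl; omega)
  have hkill : ∀ l, p < l → l < p + b + a →
      Kill l (stack η ω (fun _ => Pi.single γ 1) p b 1 a) := fun l h1 h2 => by
    rcases eq_or_ne l (p + b) with rfl | h3
    · obtain ⟨b, rfl⟩ : ∃ b', b = b' + 1 := ⟨b - 1, by omega⟩
      obtain ⟨a, rfl⟩ : ∃ a', a = a' + 1 := ⟨a - 1, by omega⟩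
      exact kill_tile_one hη (by omega) _
    · refine kill_stack hη hq (Q := p + b + a) (by omega) (fun l h4 h5 h6 => kill_single ?_)
        le_rfl (by omega) le_rfl h1 h2 h3 (by omega)
      rintro ⟨h7, h8, h9⟩
      rcases Nat.lt_or_ge l (p + a) with h10 | h10
      · have := hup l (by omega) h10
        omega
      · have := hdown (l - 1) (by omega) (by omega)
        rw [Nat.sub_add_cancel h7] at this
        omega
  have huniq : ∀ μ, stack η ω (fun _ => Pi.single γ 1) p b 1 a μ ≠ 0 → μ = α := by
    intro μ hμ
    have hout := hag μ hμ
    have hab' := hab μ hμ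
    have hmax : ∀ l, p < l → l < p + b + a → ¬ IsMax μ l := fun l h1 h2 h3 =>
      hμ (hkill l h1 h2 μ h3)
    have hin : ∀ n, n ≤ b + a → μ.ht (p + n) = α.ht (p + n) := fun n hn => by
      induction n with
      | zero => exact hout p (Or.inl (le_refl p))
      | succ n ih =>
        have h1 := ih (by omega)
        have h2 := hab' (p + (n + 1))
        have h3 := μ.step (p + n) (by omega)
        rw [add_assoc] at h3
        by_contra hne
        rcases Nat.lt_or_ge n b with h4 | h4
        · -- Leaving the descent of `α`, the path `μ` ascends up to the end, which is too low.
          have h5 := hdα (p + n) (by omega) (by omega)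
          have h6 := (ascend_of_not_isMax (μ := μ) (l := p + (n + 1)) (q := p + b + a) (by omega)
            (by omega) (by rw [show p + (n + 1) - 1 = p + n by omega]; rw [add_assoc] at h5; omega)
            (fun m h7 h8 => hmax m (by omega) h8) (m := p + b + a) (by omega) le_rfl).1
          rw [hout (p + b + a) (Or.inr (le_refl (p + b + a))), huα' a le_rfl] at h6
          have h7 := hdα' (b - n) (by omega)
          rw [show p + b - (b - n) = p + n by omega] at h7
          rw [add_assoc] at h5
          omega
        · have h5 := huα (p + n) (by omega) (by omega)
          rw [add_assoc] at h5
          omega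
    refine BallotPath.ext_ht fun l => ?_
    rcases Nat.lt_or_ge l p with h1 | h1
    · exact hout l (Or.inl h1.le)
    rcases Nat.lt_or_ge (p + b + a) l with h2 | h2
    · exact hout l (Or.inr h2.le)
    · have := hin (l - p) (by omega)
      rwa [Nat.add_sub_cancel' h1] at this
  funext μ
  by_cases h : μ = α
  · rw [h, Pi.single_eq_same]
    exact stack_raise (by omega) hup hdown hα
  · rw [Pi.single_eq_of_ne h]
    by_contra hc
    exact h (huniq μ hc)

/-- A trapezoid of tiles between a descent from the left boundary, followed by an ascent, and a
straight path. -/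
lemma stack_tri_single {η ω : ℂ} (hη : η = 0 ∨ Complex.exp η - Complex.exp (-η) ≠ 0)
    (hω : qnum η (ω + 1) ≠ 0)
    (hq : ∀ k : ℕ, 1 ≤ k → k ≤ N → qnum η k ≠ 0) {α γ : BallotPath N} {i a : ℕ}
    (ha : 1 ≤ a) (hN : i + a < N) (hγ : ∀ l, l ≤ i + a → γ.ht l = γ.ht 0 - l)
    (hα : IsVee γ i (i + a) α)
    (hright : ∃ m, i + a ≤ m ∧ m ≤ N ∧ α.ht m ≤ α.ht i ∧
      ∀ l, i + a ≤ l → l < m → α.ht (l + 1) < α.ht l) :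
    stack η ω (fun v => tri η ω N v a (Pi.single γ 1)) 0 i 1 a = Pi.single α 1 := by
  set v := stack η ω (fun v => tri η ω N v a (Pi.single γ 1)) 0 i 1 a with hv
  have hsize : i + 2 * a ≤ N := by
    have h2 := γ.ht_add_le (Nat.zero_le N)
    have h3 := hα i
    have h4 := α.nonneg i
    rw [hγ i (by omega)] at h3
    omega
  have hB : ∀ u, Above (fun l => γ.ht l - 2 * ((a - l : ℕ) : ℤ))
      (tri η ω N u a (Pi.single γ 1)) := fun u => (above_single γ).tri (by omega)
  have hvee : ∀ l, α.ht l = γ.ht l - 2 * ((a - l : ℕ) : ℤ) -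
      2 * ((min i (l - 0) - (l - 0 - a) : ℕ) : ℤ) := fun l => by
    rw [hα l]; omega
  have hab : Above α.ht v := (Above.stack (by omega) (hB _)).mono fun l => (hvee l).le
  have hrigid : ∀ j, j < i + a → Rigid α {l | i + a ≤ l} j := fun j hj =>
    rigid_right (by omega) hj hright fun hj0 => by
      rw [hα i, hα (j - 1), hα (j + 1), hγ i (by omega), hγ (j - 1) (by omega),
        hγ (j + 1) (by omega)]
      omega
  have hag : AgreeOn α {l | i + a ≤ l} v := by
    refine AgreeOn.stack (by omega) (fun j _ h2 => hrigid j (by omega)) (hB _)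
      (fun l => (hvee l).le) ?_
    refine AgreeOn.tri (by omega) (fun j h2 => hrigid j (by omega)) (above_single γ)
      (fun l => ?_) (agreeOn_single fun l hl => ?_)
    · have := hvee l
      omega
    · rw [hα l]
      simp only [Set.mem_ofPred_eq] at hl
      omega
  have hkill : ∀ l, 1 ≤ l → l < i + a → Kill l v := fun l h1 h2 => by
    rcases eq_or_ne l i with rfl | h3
    · obtain ⟨i, rfl⟩ : ∃ b', l = b' + 1 := ⟨l - 1, by omega⟩
      obtain ⟨a, rfl⟩ : ∃ a', a = a' + 1 := ⟨a - 1, by omega⟩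
      have : Kill (0 + i + 1) v := kill_tile_one hη (by omega) _
      rwa [zero_add] at this
    · refine kill_stack hη hq (Q := i + a) (by omega) (fun l h4 h5 h6 => ?_)
        le_rfl (by omega) (by omega) (by omega) h2 (by omega) (by omega)
      refine kill_tri hη hω hq (Q := i + a) (by omega) (fun l h7 h8 => kill_single ?_) (by omega)
        (by omega) (by omega) (by omega) h5 (by omega)
      rintro ⟨-, h9, -⟩
      rw [hγ _ (by omega), hγ l (by omega)] at h9
      omega
  have hval : ∀ k μ, k ≤ a → IsVee γ (i + k) (i + a) μ →
      v μ * ∏ n ∈ Finset.range k, qnum η ((1 + n : ℕ) : ℂ) =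
        veeCoeff η ω (ω + (((i + 1) % 2 : ℕ) : ℂ)) i k 1 := fun k μ h1 h2 => by
    have := stack_vee hη hω hq (Q := i + a) hN hγ (u := 1) le_rfl (by omega) le_rfl h1 h2
    rwa [Nat.cast_one] at this
  have huniq : ∀ μ, v μ ≠ 0 → μ = α := by
    intro μ hμ
    have hout := hag μ hμ
    have hab' := hab μ hμ
    -- Let `c` be the start of the final ascent of `μ`; then `μ` descends on `[0, c]`.
    have hex : ∃ c, c ≤ i + a ∧ ∀ l, c ≤ l → l < i + a → μ.ht (l + 1) = μ.ht l + 1 :=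
      ⟨i + a, le_rfl, fun l h1 h2 => by omega⟩
    obtain ⟨c, ⟨hc, hup⟩, hmin⟩ : ∃ c, (c ≤ i + a ∧ ∀ l, c ≤ l → l < i + a →
        μ.ht (l + 1) = μ.ht l + 1) ∧ ∀ c' < c, ¬ (c' ≤ i + a ∧ ∀ l, c' ≤ l → l < i + a →
        μ.ht (l + 1) = μ.ht l + 1) :=
      ⟨Nat.find hex, Nat.find_spec hex, fun c' => Nat.find_min hex⟩
    have hdown : ∀ l, l < c → μ.ht (l + 1) = μ.ht l - 1 := fun l hl => by
      rcases μ.step l (by omega) with h1 | h1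
      · refine absurd ⟨by omega, fun m h2 h3 => ?_⟩ (hmin l hl)
        have h4 := ascend_of_not_isMax (μ := μ) (l := l + 1) (q := i + a) (by omega) (by omega)
          (by rw [Nat.add_sub_cancel]; omega)
          (fun m h2 h3 h4 => hμ (hkill m (by omega) h3 μ h4)) (m := m + 1) (by omega) (by omega)
        have h5 := μ.step m (by omega)
        rw [Nat.add_sub_cancel] at h4
        omega
      · exact h1
    have hq' : μ.ht (i + a) = γ.ht (i + a) := by
      rw [hout (i + a) (le_refl (i + a)), hα]
      omega
    have h1 : ∀ n, n ≤ i + a - c → μ.ht (i + a - n) = γ.ht (i + a) - n := fun n hn => by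
      have h2 := eq_add_of_ascent hup (l := i + a - n) (by omega) (by omega)
      have h3 := eq_add_of_ascent hup hc le_rfl
      omega
    have h2 : ∀ n, n ≤ c → μ.ht (c - n) = μ.ht c + n := fun n hn => by
      have hd : ∀ l, 0 ≤ l → l < c → μ.ht (l + 1) = μ.ht l - 1 := fun l _ => hdown l
      have h3 := eq_sub_of_descent hd (Nat.zero_le (c - n)) (by omega)
      have h4 := eq_sub_of_descent hd (Nat.zero_le c) le_rfl
      omega
    have hμv : IsVee γ c (i + a) μ := fun l => by
      rcases Nat.lt_or_ge (i + a) l with h3 | h3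
      · rw [hout l h3.le, hα l]; omega
      have h4 := h1 (i + a - max l c) (by omega)
      rw [show i + a - (i + a - max l c) = max l c by omega, hγ _ le_rfl] at h4
      rw [hγ l h3]
      rcases le_total l c with h5 | h5
      · have h6 := h2 (c - l) (by omega)
        rw [show c - (c - l) = l by omega] at h6
        rw [max_eq_right h5] at h4 ⊢
        omega
      · rw [max_eq_left h5] at h4 ⊢
        omega
    have hci : i ≤ c := by
      by_contra hlt
      have h3 := hab' c
      rw [hμv, hα] at h3
      omega
    obtain ⟨k, rfl⟩ := Nat.exists_eq_add_of_le hci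
    rcases k with _ | k
    · exact BallotPath.ext_ht fun l => by rw [hμv l, hα l, add_zero]
    · have h3 := hval (k + 1) μ (by omega) hμv
      rw [veeCoeff_one] at h3
      refine absurd ((mul_eq_zero.mp h3).resolve_right ?_) hμ
      exact Finset.prod_ne_zero_iff.mpr fun n hn => hq _ (by omega) (by
        have := Finset.mem_range.mp hn
        omega)
  funext μ
  by_cases h : μ = α
  · have h1 := hval 0 α (by omega) hα
    rw [Finset.prod_range_zero, mul_one] at h1
    rw [h, Pi.single_eq_same, h1]
    rfl
  · rw [Pi.single_eq_of_ne h]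
    by_contra hc
    exact h (huniq μ hc)

/-! ### Contents of tiles -/

lemma content_of_not_isTile {α : BallotPath N} {i j : ℕ} (h : ¬ IsTile α i j) :
    content α i j = 0 := by
  rcases j with _ | j
  · rfl
  · rcases i with _ | i <;> exact if_neg h

lemma content_of_isTile {α : BallotPath N} {i j : ℕ} (h : IsTile α i (j + 1)) :
    content α i (j + 1) =
      max (content α (i + 1) j) (if i = 0 then 0 else content α (i - 1) j) + 1 := by
  rcases i with _ | i
  · rw [if_pos rfl, Nat.max_zero]
    exact if_pos h
  · rw [if_neg (Nat.succ_ne_zero i)]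
    exact if_pos h

lemma IsTile.pos {α : BallotPath N} {i j : ℕ} (h : IsTile α i j) : 1 ≤ j := by
  have := α.nonneg i
  have := h.1
  omega

lemma content_pos {α : BallotPath N} {i j : ℕ} (h : IsTile α i j) : 1 ≤ content α i j := by
  obtain ⟨j, rfl⟩ : ∃ j', j = j' + 1 := ⟨j - 1, by have := h.pos; omega⟩
  rw [content_of_isTile h]
  omega

lemma content_le {α : BallotPath N} (i j : ℕ) : content α i j ≤ j := by
  induction j generalizing i with
  | zero => exact le_of_eq rfl
  | succ j ih =>
    by_cases h : IsTile α i (j + 1)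
    · rw [content_of_isTile h]
      have := ih (i + 1)
      have := ih (i - 1)
      split_ifs <;> omega
    · rw [content_of_not_isTile h]; omega

lemma content_lt_of_left {α : BallotPath N} {i j : ℕ} (h : IsTile α (i + 1) (j + 1)) :
    content α i j < content α (i + 1) (j + 1) := by
  rw [content_of_isTile h, if_neg (by omega), Nat.add_sub_cancel]
  omega

lemma content_lt_of_right {α : BallotPath N} {i j : ℕ} (h : IsTile α i (j + 1)) :
    content α (i + 1) j < content α i (j + 1) := by
  rw [content_of_isTile h]
  omega

/-- Two tiles at the same position or at adjacent positions: these are the pairs of tiles whose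
operators need not commute. -/
def Near (s t : ℕ × ℕ) : Prop := s.1 ≤ t.1 + 1 ∧ t.1 ≤ s.1 + 1

lemma content_lt_of_near {α : BallotPath N} {s t : ℕ × ℕ} (hs : IsTile α s.1 s.2)
    (ht : IsTile α t.1 t.2) (h : Near t s) (hlt : t.2 < s.2) :
    content α t.1 t.2 < content α s.1 s.2 := by
  obtain ⟨x, y⟩ := s
  obtain ⟨x', y'⟩ := t
  dsimp only at *
  induction y generalizing x with
  | zero => omega
  | succ y ih =>
    obtain ⟨h1, h2⟩ := h
    dsimp only at h1 h2
    have hs' := hs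
    have ht' := ht
    obtain ⟨s1, s2, s3⟩ := hs'
    obtain ⟨t1, t2, t3⟩ := ht'
    have s4 := Nat.odd_iff.mp s3
    have t4 := Nat.odd_iff.mp t3
    have step := α.step
    rcases (Nat.lt_succ_iff.mp hlt).eq_or_lt with rfl | hlt'
    · rcases Nat.lt_or_ge x' x with h3 | h3
      · obtain rfl : x = x' + 1 := by omega
        exact content_lt_of_left hs
      · obtain rfl : x' = x + 1 := by omega
        exact content_lt_of_right hs
    · rcases lt_trichotomy x' x with h3 | h3 | h3
      · obtain rfl : x = x' + 1 := by omega
        refine (ih x' ⟨by omega, by omega, Nat.odd_iff.mpr (by omega)⟩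
          ⟨by simp, by simp⟩ hlt').trans (content_lt_of_left hs)
      · subst h3
        have := step x' (by omega)
        refine (ih (x' + 1) ⟨by push_cast at *; omega, by omega, Nat.odd_iff.mpr (by omega)⟩
          ⟨by simp; omega, by simp⟩ hlt').trans (content_lt_of_right hs)
      · obtain rfl : x' = x + 1 := by omega
        refine (ih (x + 1) ⟨by omega, by omega, Nat.odd_iff.mpr (by omega)⟩
          ⟨by simp, by simp⟩ hlt').trans (content_lt_of_right hs)

/-- The tiles along an ascent of `γ` form a chain of increasing contents. -/
lemma content_ge_of_ascent {γ : BallotPath N} {m x j : ℕ} (hmx : m ≤ x)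
    (hup : ∀ l, m ≤ l → l < x → γ.ht (l + 1) = γ.ht l + 1) (hj : γ.ht x + 1 = j)
    (ht : IsTile γ x j) : x - m + 1 ≤ content γ x j := by
  induction x, hmx using Nat.le_induction generalizing j with
  | base => rw [Nat.sub_self]; exact content_pos ht
  | succ x hmx ih =>
    obtain ⟨j, rfl⟩ : ∃ j', j = j' + 1 := ⟨j - 1, by have := ht.pos; omega⟩
    have h1 := hup x hmx (by omega)
    obtain ⟨t1, t2, t3⟩ := ht
    have t4 := Nat.odd_iff.mp t3
    have h2 := ih (j := j) (fun l h3 h4 => hup l h3 (by omega)) (by push_cast at hj; omega)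
      ⟨by push_cast at hj; omega, by omega, Nat.odd_iff.mpr (by omega)⟩
    have := content_lt_of_left (α := γ) ⟨t1, t2, t3⟩
    omega

lemma content_ge_of_descent {γ : BallotPath N} {m x j : ℕ} (hmx : x ≤ m)
    (hdown : ∀ l, x ≤ l → l < m → γ.ht (l + 1) = γ.ht l - 1) (hj : γ.ht x + 1 = j)
    (ht : IsTile γ x j) : m - x + 1 ≤ content γ x j := by
  induction hmx using Nat.decreasingInduction generalizing j with
  | self => rw [Nat.sub_self]; exact content_pos ht
  | of_succ x hmx ih =>
    obtain ⟨j, rfl⟩ : ∃ j', j = j' + 1 := ⟨j - 1, by have := ht.pos; omega⟩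
    have h1 := hdown x le_rfl (by omega)
    obtain ⟨t1, t2, t3⟩ := ht
    have t4 := Nat.odd_iff.mp t3
    have h2 := ih (j := j) (fun l h3 h4 => hdown l (by omega) h4) (by push_cast at hj; omega)
      ⟨by push_cast at hj; omega, by omega, Nat.odd_iff.mpr (by omega)⟩
    have := content_lt_of_right (α := γ) ⟨t1, t2, t3⟩
    omega

/-- The contents of the tiles between `α` and `γ` measure the height above the lowest point `h`
of this region, if from every point one can descend along `α` to that level. -/
lemma content_of_lt {α γ : BallotPath N} {h : ℕ}
    (hV : ∀ x, x < N → α.ht x < γ.ht x →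
      (α.ht x = h ∧ α.ht (x + 1) = h + 1 ∧ (1 ≤ x → α.ht (x - 1) = h + 1)) ∨
      ((h : ℤ) < α.ht x ∧
        (α.ht (x + 1) = α.ht x - 1 ∨ (1 ≤ x ∧ α.ht (x - 1) = α.ht x - 1))))
    {x y : ℕ} (ht : IsTile α x y) (hy : (y : ℤ) < γ.ht x) : content α x y + h = y := by
  induction y generalizing x with
  | zero => have := ht.pos; omega
  | succ y ih =>
    obtain ⟨t1, t2, t3⟩ := ht
    have t4 := Nat.odd_iff.mp t3
    have hr : ∀ x', (x' = x + 1 ∨ (1 ≤ x ∧ x' = x - 1)) →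
        (α.ht x' < y ∧ content α x' y + h = y) ∨
          (¬ α.ht x' < y ∧ content α x' y = 0) := fun x' hx' => by
      by_cases h1 : α.ht x' < y
      · refine Or.inl ⟨h1, ih ⟨h1, ?_, Nat.odd_iff.mpr (by omega)⟩ ?_⟩
        · rcases hx' with rfl | ⟨h2, rfl⟩
          · by_contra hc
            have h3 := γ.ht_add_le (l := x) (by omega)
            push_cast at hy
            omega
          · omega
        · push_cast at hy
          rcases hx' with rfl | ⟨h2, rfl⟩
          · have := γ.step x (by omega)
            omega
          · have := γ.step (x - 1) (by omega)
            rw [Nat.sub_add_cancel h2] at this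
            omega
      · exact Or.inr ⟨h1, content_of_not_isTile fun h2 => h1 h2.1⟩
    have hr1 := hr (x + 1) (Or.inl rfl)
    have hv := hV x (by omega) (by omega)
    rw [content_of_isTile ⟨t1, t2, t3⟩]
    have hp := α.ht_parity (i := x) (by omega)
    push_cast at t1 hy ⊢
    rcases Nat.eq_zero_or_pos x with h0 | h0
    · rw [if_pos h0]
      omega
    · have hr2 := hr (x - 1) (Or.inr ⟨h0, rfl⟩)
      rw [if_neg (by omega)]
      omega

/-- The contents of the other tiles are determined by the slopes of `γ` outside of the region. -/
lemma content_congr {α γ : BallotPath N} {h : ℕ} (hle : ∀ l, α.ht l ≤ γ.ht l)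
    (hc : ∀ x y, IsTile α x y → (y : ℤ) < γ.ht x → content α x y + h = y)
    (hL : ∀ x, γ.ht (x + 1) = γ.ht x + 1 → α.ht (x + 1) < γ.ht (x + 1) →
      ∃ m, m < x ∧ γ.ht m ≤ h ∧ ∀ l, m ≤ l → l < x → γ.ht (l + 1) = γ.ht l + 1)
    (hR : ∀ x, γ.ht (x + 1) = γ.ht x - 1 → α.ht x < γ.ht x →
      ∃ m, x + 1 < m ∧ γ.ht m ≤ h ∧ ∀ l, x + 1 ≤ l → l < m → γ.ht (l + 1) = γ.ht l - 1)
    {x y : ℕ} (ht : IsTile γ x y) : content α x y = content γ x y := by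
  induction y generalizing x with
  | zero => rfl
  | succ y ih =>
    have htα : IsTile α x (y + 1) := ⟨(hle x).trans_lt ht.1, ht.2⟩
    have hnbr : ∀ x', (IsTile γ x' y ∧ content α x' y = content γ x' y) ∨
        (¬ IsTile γ x' y ∧ content γ x' y = 0) := fun x' => by
      by_cases h1 : IsTile γ x' y
      · exact Or.inl ⟨h1, ih h1⟩
      · exact Or.inr ⟨h1, content_of_not_isTile h1⟩
    rw [content_of_isTile ht, content_of_isTile htα]
    obtain ⟨t1, t2, t3⟩ := ht
    have t4 := Nat.odd_iff.mp t3
    push_cast at t1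
    congr 1
    -- A neighbour below that is a tile for `α` only does not increase the content.
    -- Its content is `y - h`, and the other neighbour lies on a slope from a point of height at
    -- most `h`, hence has at least that content.
    by_cases hA : IsTile α (x + 1) y ∧ ¬ IsTile γ (x + 1) y
    · obtain ⟨hA1, hA2⟩ := hA
      have h0 : ¬ γ.ht (x + 1) < y := fun h1 => hA2 ⟨h1, hA1.2⟩
      have h1 := γ.step x (by omega)
      have h2 := hA1.1
      obtain ⟨m, m1, m2, m3⟩ := hL x (by omega) (by omega)
      have hp := γ.ht_parity (i := x + 1) (by have := hA1.2.1; omega)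
      have h3 := hc _ _ hA1 (by push_cast at hp; omega)
      have h4 := m3 (x - 1) (by omega) (by omega)
      rw [Nat.sub_add_cancel (by omega)] at h4
      have h5 : IsTile γ (x - 1) y := ⟨by omega, by omega, Nat.odd_iff.mpr (by omega)⟩
      have h6 := content_ge_of_ascent (m := m) (x := x - 1) (j := y) (by omega)
        (fun l h7 h8 => m3 l h7 (by omega)) (by omega) h5
      have h8 := eq_add_of_ascent m3 m1.le le_rfl
      rw [if_neg (by omega), if_neg (by omega), ih h5, content_of_not_isTile hA2]
      omega
    by_cases hB : 1 ≤ x ∧ IsTile α (x - 1) y ∧ ¬ IsTile γ (x - 1) y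
    · obtain ⟨hx, hB1, hB2⟩ := hB
      obtain ⟨x, rfl⟩ : ∃ x', x = x' + 1 := ⟨x - 1, by omega⟩
      rw [Nat.add_sub_cancel] at *
      have h0 : ¬ γ.ht x < y := fun h1 => hB2 ⟨h1, hB1.2⟩
      have h1 := γ.step x (by omega)
      have h2 := hB1.1
      obtain ⟨m, m1, m2, m3⟩ := hR x (by omega) (by omega)
      have hp := γ.ht_parity (i := x) (by omega)
      have h3 := hc _ _ hB1 (by omega)
      have h4 := m3 (x + 1) (by omega) (by omega)
      have h5 : IsTile γ (x + 1 + 1) y := by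
        refine ⟨by omega, ?_, Nat.odd_iff.mpr (by omega)⟩
        omega
      have h6 := content_ge_of_descent (m := m) (x := x + 1 + 1) (j := y) (by omega)
        (fun l h7 h8 => m3 l (by omega) h8) (by omega) h5
      have h8 := eq_sub_of_descent m3 m1.le le_rfl
      rw [if_neg (by omega), if_neg (by omega), ih h5, content_of_not_isTile hB2]
      omega
    have key : ∀ x', ¬ (IsTile α x' y ∧ ¬ IsTile γ x' y) → content α x' y = content γ x' y :=
      fun x' hx' => by
        by_cases h1 : IsTile γ x' y
        · exact ih h1
        · rw [content_of_not_isTile h1, content_of_not_isTile fun h2 => hx' ⟨h2, h1⟩]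
    rw [key _ hA]
    split_ifs with h0
    · rfl
    · rw [key (x - 1) fun h1 => hB ⟨by omega, h1⟩]

/-! ### Orders of the tiles -/

/-- The list `L` is ordered in such a way that, of two tiles whose operators need not commute, the
lower one comes first. -/
def Ascending (L : List (ℕ × ℕ)) : Prop := L.Pairwise fun s t => Near s t → s.2 < t.2

lemma Ascending.nodup {L : List (ℕ × ℕ)} (h : Ascending L) : L.Nodup :=
  h.imp fun {s t} hst he => by
    subst he
    exact lt_irrefl _ (hst ⟨by omega, by omega⟩)

/-- All the ascending orders of the same tiles lead to the same product. -/
lemma prod_eq_of_perm {M : Type*} [Monoid M] {f : ℕ × ℕ → M} {L L' : List (ℕ × ℕ)}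
    (hf : ∀ s ∈ L, ∀ t ∈ L, ¬ Near s t → Commute (f s) (f t)) (hp : L.Perm L')
    (h : Ascending L) (h' : Ascending L') : (L.map f).prod = (L'.map f).prod := by
  induction L generalizing L' with
  | nil => rw [hp.nil_eq]
  | cons s L ih =>
    obtain ⟨A, B, rfl⟩ := List.append_of_mem (hp.subset List.mem_cons_self)
    have hp' : L.Perm (A ++ B) := (List.perm_cons s).mp (hp.trans List.perm_middle)
    have hs := List.pairwise_cons.mp h
    have hA := List.pairwise_append.mp h'
    -- The factors in front of `s` commute with `s`.
    have hfar : ∀ t ∈ A, Commute (f s) (f t) := fun t ht => by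
      have htL : t ∈ L := hp'.symm.subset (List.mem_append_left B ht)
      refine hf s List.mem_cons_self t (List.mem_cons_of_mem s htL) fun hn => ?_
      have h1 := hs.1 t htL hn
      have h2 := hA.2.2 t ht s List.mem_cons_self ⟨hn.2, hn.1⟩
      omega
    have hcomm : Commute (f s) (A.map f).prod :=
      Commute.list_prod_right _ _ fun y hy => by
        obtain ⟨t, ht, rfl⟩ := List.mem_map.mp hy
        exact hfar t ht
    rw [List.map_cons, List.prod_cons, ih
      (fun s hs t ht => hf s (List.mem_cons_of_mem _ hs) t (List.mem_cons_of_mem _ ht)) hp' hs.2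
      (h'.sublist ((List.sublist_cons_self s B).append_left A)), List.map_append, List.map_append,
      List.map_cons, List.prod_append, List.prod_append, List.prod_cons, ← mul_assoc, ← mul_assoc,
      hcomm.eq]

/-- The tiles of a column of length `a` that starts at `(i, y)`. -/
def colTiles : (i y a : ℕ) → List (ℕ × ℕ)
  | _, _, 0 => []
  | i, y, a + 1 => (i, y) :: colTiles (i + 1) (y + 1) a

/-- The tiles of the triangle at the boundary that starts at `(0, y)`. -/
def triTiles : (y a : ℕ) → List (ℕ × ℕ)
  | _, 0 => []
  | y, a + 1 => colTiles 0 y (a + 1) ++ triTiles (y + 2) a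

/-- The tiles of a stack of columns, the first of which starts at `(p + b, y)`. -/
def stackTiles (p : ℕ) : (b y a : ℕ) → List (ℕ × ℕ)
  | 0, _, _ => []
  | b + 1, y, a => colTiles (p + b + 1) y a ++ stackTiles p b (y + 1) a

lemma mem_colTiles {i y a : ℕ} {t : ℕ × ℕ} :
    t ∈ colTiles i y a ↔ i ≤ t.1 ∧ t.1 < i + a ∧ t.2 + i = y + t.1 := by
  induction a generalizing i y with
  | zero => simp only [colTiles, List.not_mem_nil, false_iff]; omega
  | succ a ih =>
    rw [colTiles, List.mem_cons, ih, Prod.ext_iff]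
    dsimp only
    omega

lemma mem_triTiles {y a : ℕ} {t : ℕ × ℕ} :
    t ∈ triTiles y a ↔ ∃ c, t.1 + c < a ∧ t.2 = y + 2 * c + t.1 := by
  induction a generalizing y with
  | zero => simp [triTiles]
  | succ a ih =>
    rw [triTiles, List.mem_append, mem_colTiles, ih]
    constructor
    · rintro (h | ⟨c, h1, h2⟩)
      · exact ⟨0, by omega, by omega⟩
      · exact ⟨c + 1, by omega, by omega⟩
    · rintro ⟨_ | c, h1, h2⟩
      · exact Or.inl (by omega)
      · exact Or.inr ⟨c, by omega, by omega⟩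

lemma mem_stackTiles {p b y a : ℕ} {t : ℕ × ℕ} :
    t ∈ stackTiles p b y a ↔ ∃ c, p < c ∧ c ≤ p + b ∧ c ≤ t.1 ∧ t.1 < c + a ∧
      t.2 + 2 * c = y + p + b + t.1 := by
  induction b generalizing y with
  | zero =>
    simp only [stackTiles, List.not_mem_nil, false_iff]
    rintro ⟨c, h1, h2, -⟩
    omega
  | succ b ih =>
    rw [stackTiles, List.mem_append, mem_colTiles, ih]
    constructor
    · rintro (h | ⟨c, h1, h2, h3, h4, h5⟩)
      · exact ⟨p + b + 1, by omega, by omega, by omega, by omega, by omega⟩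
      · exact ⟨c, h1, by omega, h3, h4, by omega⟩
    · rintro ⟨c, h1, h2, h3, h4, h5⟩
      by_cases hc : c = p + b + 1
      · exact Or.inl (by omega)
      · exact Or.inr ⟨c, h1, by omega, h3, h4, by omega⟩

lemma ascending_colTiles (i y a : ℕ) : Ascending (colTiles i y a) := by
  induction a generalizing i y with
  | zero => exact List.Pairwise.nil
  | succ a ih =>
    refine List.pairwise_cons.mpr ⟨fun t ht _ => ?_, ih _ _⟩
    have := mem_colTiles.mp ht
    dsimp only
    omega

lemma ascending_triTiles (y a : ℕ) : Ascending (triTiles y a) := by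
  induction a generalizing y with
  | zero => exact List.Pairwise.nil
  | succ a ih =>
    refine List.pairwise_append.mpr ⟨ascending_colTiles _ _ _, ih _, fun s hs t ht hn => ?_⟩
    have h1 := mem_colTiles.mp hs
    obtain ⟨c, h2, h3⟩ := mem_triTiles.mp ht
    have := hn.1
    omega

lemma ascending_stackTiles (p b y a : ℕ) : Ascending (stackTiles p b y a) := by
  induction b generalizing y with
  | zero => exact List.Pairwise.nil
  | succ b ih =>
    refine List.pairwise_append.mpr ⟨ascending_colTiles _ _ _, ih _, fun s hs t ht hn => ?_⟩
    have h1 := mem_colTiles.mp hs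
    obtain ⟨c, h2, h3, h4, h5, h6⟩ := mem_stackTiles.mp ht
    have := hn.1
    omega

/-- The product of the operators of the tiles in the list `L`, with the contents `c`. -/
def tileProd (η ω : ℂ) (N : ℕ) (c : ℕ → ℕ → ℕ) (L : List (ℕ × ℕ)) :
    Module.End ℂ (DualSpace N) :=
  (L.map fun t => tile η ω N t.1 (c t.1 t.2)).prod

lemma tileProd_append (η ω : ℂ) (c : ℕ → ℕ → ℕ) (L L' : List (ℕ × ℕ)) :
    tileProd η ω N c (L ++ L') = tileProd η ω N c L * tileProd η ω N c L' := by
  rw [tileProd, List.map_append, List.prod_append]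
  rfl

lemma tileProd_congr (η ω : ℂ) {c c' : ℕ → ℕ → ℕ} {L : List (ℕ × ℕ)}
    (h : ∀ t ∈ L, c t.1 t.2 = c' t.1 t.2) : tileProd η ω N c L = tileProd η ω N c' L := by
  rw [tileProd, tileProd, List.map_congr_left fun t ht => by rw [h t ht]]

lemma tileProd_colTiles (η ω : ℂ) {c : ℕ → ℕ → ℕ} {h i y u a : ℕ} (hy : u + h = y)
    (hc : ∀ t ∈ colTiles i y a, c t.1 t.2 + h = t.2) :
    tileProd η ω N c (colTiles i y a) = col η ω N i u a := by
  induction a generalizing i y u with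
  | zero => rfl
  | succ a ih =>
    have h1 : c i y = u := by
      have := hc (i, y) List.mem_cons_self
      dsimp only at this
      omega
    rw [col, ← ih (by omega : u + 1 + h = y + 1)
      fun t ht => hc t (List.mem_cons_of_mem _ ht), ← h1]
    exact List.prod_cons

lemma tileProd_triTiles (η ω : ℂ) {c : ℕ → ℕ → ℕ} {h y u a : ℕ} (hy : u + h = y)
    (hc : ∀ t ∈ triTiles y a, c t.1 t.2 + h = t.2) :
    tileProd η ω N c (triTiles y a) = tri η ω N u a := by
  induction a generalizing y u with
  | zero => rfl
  | succ a ih =>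
    rw [triTiles, tileProd_append, tri,
      tileProd_colTiles η ω hy fun t ht => hc t (List.mem_append_left _ ht),
      ih (by omega : u + 2 + h = y + 2) fun t ht => hc t (List.mem_append_right _ ht)]

lemma tileProd_stackTiles (η ω : ℂ) {c : ℕ → ℕ → ℕ} {base : ℕ → DualSpace N} {p h b y u a : ℕ}
    (hy : u + h = y) (hc : ∀ t ∈ stackTiles p b y a, c t.1 t.2 + h = t.2) :
    tileProd η ω N c (stackTiles p b y a) (base (u + b)) = stack η ω base p b u a := by
  induction b generalizing y u with
  | zero => rfl
  | succ b ih =>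
    rw [stackTiles, tileProd_append, stack, Module.End.mul_apply,
      tileProd_colTiles η ω hy fun t ht => hc t (List.mem_append_left _ ht),
      show u + (b + 1) = u + 1 + b by ring,
      ih (by omega : u + 1 + h = y + 1) fun t ht => hc t (List.mem_append_right _ ht)]

/-- The list `L` is an ascending order of the tiles of `α`. -/
def IsTileList (α : BallotPath N) (L : List (ℕ × ℕ)) : Prop :=
  Ascending L ∧ ∀ t, t ∈ L ↔ IsTile α t.1 t.2

lemma IsTileList.tileProd_eq (η ω : ℂ) {α : BallotPath N} {L L' : List (ℕ × ℕ)}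
    (h : IsTileList α L) (h' : IsTileList α L') (c : ℕ → ℕ → ℕ) :
    tileProd η ω N c L = tileProd η ω N c L' := by
  refine prod_eq_of_perm (fun s hs t ht hn => ?_) ?_ h.1 h'.1
  · have h1 := ((h.2 s).mp hs).2.1
    have h2 := ((h.2 t).mp ht).2.1
    refine tile_commute η ω _ _ (by omega) (by omega) ?_
    unfold Near at hn
    omega
  · exact (List.perm_ext_iff_of_nodup h.1.nodup h'.1.nodup).mpr fun t => by rw [h.2, h'.2]

/-- Tiles between `α` and a higher path `γ` precede the tiles of `γ`. -/
lemma IsTileList.append {α γ : BallotPath N} {R L : List (ℕ × ℕ)} (hle : ∀ l, α.ht l ≤ γ.ht l)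
    (hR : Ascending R) (hRmem : ∀ t, t ∈ R ↔ IsTile α t.1 t.2 ∧ (t.2 : ℤ) < γ.ht t.1)
    (hL : IsTileList γ L) : IsTileList α (R ++ L) := by
  refine ⟨List.pairwise_append.mpr ⟨hR, hL.1, fun s hs t ht hn => ?_⟩, fun t => ?_⟩
  · obtain ⟨h1, h2⟩ := (hRmem s).mp hs
    have h3 := (hL.2 t).mp ht
    have h4 := h3.1
    have h5 := h3.2.1
    have h6 := h1.2.1
    obtain ⟨n1, n2⟩ := hn
    rcases lt_trichotomy s.1 t.1 with h | h | h
    · have := γ.step s.1 (by omega)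
      rw [show s.1 + 1 = t.1 by omega] at this
      omega
    · rw [h] at h2
      omega
    · have := γ.step t.1 (by omega)
      rw [show t.1 + 1 = s.1 by omega] at this
      omega
  · rw [List.mem_append, hRmem, hL.2]
    constructor
    · rintro (h | h)
      · exact h.1
      · exact ⟨(hle _).trans_lt h.1, h.2⟩
    · intro h
      by_cases h1 : (t.2 : ℤ) < γ.ht t.1
      · exact Or.inl ⟨h, h1⟩
      · refine Or.inr ⟨lt_of_le_of_ne (by omega) fun h2 => ?_, h.2⟩
        have h3 := h.2.1
        have hp := γ.ht_parity (i := t.1) (by omega)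
        have := Nat.odd_iff.mp h.2.2
        omega

/-! ### Removing a rectangle or a trapezoid of tiles -/

/-- The tiles of `α` arise from those of a higher path `γ` by adding tiles that turn the state of
`γ` into that of `α` and that do not alter the contents of the tiles of `γ`. -/
def Peels (η ω : ℂ) (α γ : BallotPath N) : Prop :=
  (∀ l, α.ht l ≤ γ.ht l) ∧ (∃ l < N, α.ht l < γ.ht l) ∧
    (∀ x y, IsTile γ x y → content α x y = content γ x y) ∧
    ∃ R, Ascending R ∧ (∀ t, t ∈ R ↔ IsTile α t.1 t.2 ∧ (t.2 : ℤ) < γ.ht t.1) ∧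
      tileProd η ω N (content α) R (Pi.single γ 1) = Pi.single α 1

/-- The rectangle of tiles above a local minimum `p + b` between a descent of length `b` and an
ascent of length `a`, next to valleys that are not higher. -/
lemma exists_peels_rectangle {η ω : ℂ} (hη : η = 0 ∨ Complex.exp η - Complex.exp (-η) ≠ 0)
    (hq : ∀ k : ℕ, 1 ≤ k → k ≤ N → qnum η k ≠ 0) {α : BallotPath N} {p a b : ℕ}
    (hb : 1 ≤ b) (ha : 1 ≤ a) (hN : p + b + a < N)
    (hd : ∀ l, p ≤ l → l < p + b → α.ht (l + 1) = α.ht l - 1)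
    (hu : ∀ l, p + b ≤ l → l < p + b + a → α.ht (l + 1) = α.ht l + 1)
    (hleft : ∃ m, m ≤ p ∧ α.ht m ≤ α.ht (p + b) ∧
      ∀ l, m ≤ l → l < p → α.ht (l + 1) = α.ht l + 1)
    (hright : ∃ m, p + b + a ≤ m ∧ m ≤ N ∧ α.ht m ≤ α.ht (p + b) ∧
      ∀ l, p + b + a ≤ l → l < m → α.ht (l + 1) = α.ht l - 1) :
    ∃ γ, Peels η ω α γ := by
  have hdv : ∀ l, p ≤ l → l ≤ p + b → α.ht l = α.ht p - (l - p : ℕ) := fun l =>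
    eq_sub_of_descent hd
  have huv : ∀ l, p + b ≤ l → l ≤ p + b + a → α.ht l = α.ht (p + b) + (l - (p + b) : ℕ) :=
    fun l => eq_add_of_ascent hu
  have hpb := hdv (p + b) (by omega) le_rfl
  obtain ⟨h, hh⟩ : ∃ h : ℕ, α.ht (p + b) = h := ⟨_, (Int.toNat_of_nonneg (α.nonneg _)).symm⟩
  obtain ⟨γ, hγ⟩ := exists_ballotPath (N := N)
    (f := fun l => α.ht l + 2 * ((min b (l - p) - (l - p - a) : ℕ) : ℤ))
    (fun l => by have := α.nonneg l; omega)
    (fun l hl => by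
      have h1 := α.step l hl
      have h2 := hd l
      have h3 := hu l
      rcases Nat.lt_or_ge l p with h4 | h4
      · omega
      rcases Nat.lt_or_ge l (p + b) with h5 | h5
      · have := h2 h4 h5; omega
      rcases Nat.lt_or_ge l (p + b + a) with h6 | h6
      · have := h3 h5 h6; omega
      · omega)
    (fun l hl => by have := α.tail l hl; omega)
  have hγ : ∀ l, γ.ht l = α.ht l + 2 * ((min b (l - p) - (l - p - a) : ℕ) : ℤ) :=
    fun l => congrFun hγ l
  have hup : ∀ l, p ≤ l → l < p + a → γ.ht (l + 1) = γ.ht l + 1 := fun l h1 h2 => by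
    rw [hγ, hγ]
    rcases Nat.lt_or_ge l (p + b) with h5 | h5
    · rw [hd l h1 h5]; omega
    · rw [hu l h5 (by omega)]; omega
  have hdown : ∀ l, p + a ≤ l → l < p + b + a → γ.ht (l + 1) = γ.ht l - 1 := fun l h1 h2 => by
    rw [hγ, hγ]
    rcases Nat.lt_or_ge l (p + b) with h5 | h5
    · rw [hd l (by omega) h5]; omega
    · rw [hu l h5 (by omega)]; omega
  have hin : ∀ x, α.ht x < γ.ht x → p < x ∧ x < p + b + a := fun x hx => by
    rw [hγ] at hx; omega
  have hV : ∀ x, x < N → α.ht x < γ.ht x →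
      (α.ht x = h ∧ α.ht (x + 1) = h + 1 ∧ (1 ≤ x → α.ht (x - 1) = h + 1)) ∨
      ((h : ℤ) < α.ht x ∧
        (α.ht (x + 1) = α.ht x - 1 ∨ (1 ≤ x ∧ α.ht (x - 1) = α.ht x - 1))) := by
    intro x hx hlt
    obtain ⟨h1, h2⟩ := hin x hlt
    rcases lt_trichotomy x (p + b) with h3 | rfl | h3
    · have := hd x h1.le h3
      have := hdv x h1.le h3.le
      omega
    · have h4 := hd (p + b - 1) (by omega) (by omega)
      have h5 := hu (p + b) le_rfl (by omega)
      rw [Nat.sub_add_cancel (by omega)] at h4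
      omega
    · have h4 := hu (x - 1) (by omega) (by omega)
      rw [Nat.sub_add_cancel (by omega)] at h4
      have := huv x h3.le h2.le
      omega
  have hle : ∀ l, α.ht l ≤ γ.ht l := fun l => by rw [hγ]; omega
  have hc : ∀ x y, IsTile α x y → (y : ℤ) < γ.ht x → content α x y + h = y :=
    fun x y => content_of_lt hV
  have hmem : ∀ t : ℕ × ℕ, t ∈ stackTiles p b (h + 1) a ↔
      IsTile α t.1 t.2 ∧ (t.2 : ℤ) < γ.ht t.1 := by
    rintro ⟨x, y⟩
    rw [mem_stackTiles]
    dsimp only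
    constructor
    · rintro ⟨c, h1, h2, h3, h4, h5⟩
      have hp := α.ht_parity (i := x) (by omega)
      have hγx := γ.ht_add_le (l := x) (by omega)
      rw [hγ] at hγx ⊢
      unfold IsTile
      rw [Nat.odd_iff]
      rcases le_total x (p + b) with h6 | h6
      · have := hdv x (by omega) h6
        omega
      · have := huv x h6 (by omega)
        omega
    · rintro ⟨h1, h2⟩
      obtain ⟨h3, h4⟩ := hin x (h1.1.trans h2)
      have hp := α.ht_parity (i := x) (by omega)
      rw [hγ] at h2
      obtain ⟨h7, h8, h9⟩ := h1
      rw [Nat.odd_iff] at h9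
      refine ⟨(h + 1 + p + b + x - y) / 2, ?_⟩
      rcases le_total x (p + b) with h6 | h6
      · have := hdv x (by omega) h6
        omega
      · have := huv x h6 (by omega)
        omega
  refine ⟨γ, hle, ⟨p + b, by omega, by rw [hγ]; omega⟩, fun x y =>
    content_congr hle hc (fun x h1 h2 => ?_) (fun x h1 h2 => ?_), stackTiles p b (h + 1) a,
    ascending_stackTiles _ _ _ _, hmem, ?_⟩
  · obtain ⟨m, m1, m2, m3⟩ := hleft
    obtain ⟨h3, h4⟩ := hin _ h2
    have h5 : x < p + a := by
      by_contra hc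
      have := hdown x (by omega) (by omega)
      omega
    refine ⟨m, ?_, by rw [hγ]; omega, fun l h6 h7 => ?_⟩
    · rcases m1.eq_or_lt with rfl | h6
      · omega
      · omega
    · rcases Nat.lt_or_ge l p with h8 | h8
      · have := m3 l h6 h8
        rw [hγ, hγ]; omega
      · exact hup l h8 (by omega)
  · obtain ⟨m, m1, m2, m3, m4⟩ := hright
    obtain ⟨h3, h4⟩ := hin _ h2
    have h5 : p + a ≤ x := by
      by_contra hc
      have := hup x (by omega) (by omega)
      omega
    refine ⟨m, ?_, by rw [hγ]; omega, fun l h6 h7 => ?_⟩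
    · rcases m1.eq_or_lt with rfl | h6
      · have := huv _ (by omega) (le_refl (p + b + a))
        omega
      · omega
    · rcases Nat.lt_or_ge l (p + b + a) with h8 | h8
      · exact hdown l (by omega) h8
      · have := m4 l h8 h7
        rw [hγ, hγ]; omega
  · rw [tileProd_stackTiles η ω (base := fun _ => Pi.single γ 1) (u := 1) (add_comm 1 h)
      fun t ht => hc _ _ ((hmem t).mp ht).1 ((hmem t).mp ht).2]
    refine stack_single hη hq hb ha hN hup hdown (fun l => by rw [hγ]; omega) ?_ ?_
    · obtain ⟨m, m1, m2, m3⟩ := hleft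
      exact ⟨m, m1, m2, fun l h1 h2 => by have := m3 l h1 h2; omega⟩
    · obtain ⟨m, m1, m2, m3, m4⟩ := hright
      exact ⟨m, m1, m2, m3, fun l h1 h2 => by have := m4 l h1 h2; omega⟩

/-- The trapezoid of tiles above a local minimum `i` between a descent from the left boundary and
an ascent of length `a`, next to a valley that is not higher. -/
lemma exists_peels_trapezoid {η ω : ℂ} (hη : η = 0 ∨ Complex.exp η - Complex.exp (-η) ≠ 0)
    (hω : qnum η (ω + 1) ≠ 0)
    (hq : ∀ k : ℕ, 1 ≤ k → k ≤ N → qnum η k ≠ 0) {α : BallotPath N} {i a : ℕ}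
    (ha : 1 ≤ a) (hN : i + a < N)
    (hd : ∀ l, 0 ≤ l → l < i → α.ht (l + 1) = α.ht l - 1)
    (hu : ∀ l, i ≤ l → l < i + a → α.ht (l + 1) = α.ht l + 1)
    (hright : ∃ m, i + a ≤ m ∧ m ≤ N ∧ α.ht m ≤ α.ht i ∧
      ∀ l, i + a ≤ l → l < m → α.ht (l + 1) = α.ht l - 1) :
    ∃ γ, Peels η ω α γ := by
  have hdv : ∀ l, l ≤ i → α.ht l = α.ht 0 - l := fun l hl =>
    eq_sub_of_descent hd (Nat.zero_le l) hl
  have huv : ∀ l, i ≤ l → l ≤ i + a → α.ht l = α.ht i + (l - i : ℕ) :=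
    fun l => eq_add_of_ascent hu
  have hpb := hdv i le_rfl
  obtain ⟨h, hh⟩ : ∃ h : ℕ, α.ht i = h := ⟨_, (Int.toNat_of_nonneg (α.nonneg _)).symm⟩
  obtain ⟨γ, hγ⟩ := exists_ballotPath (N := N)
    (f := fun l => α.ht l + 2 * ((i + a - max l i : ℕ) : ℤ))
    (fun l => by have := α.nonneg l; omega)
    (fun l hl => by
      have h1 := α.step l hl
      rcases Nat.lt_or_ge l i with h5 | h5
      · have := hd l (Nat.zero_le l) h5; omega
      rcases Nat.lt_or_ge l (i + a) with h6 | h6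
      · have := hu l h5 h6; omega
      · omega)
    (fun l hl => by have := α.tail l hl; omega)
  have hγ : ∀ l, γ.ht l = α.ht l + 2 * ((i + a - max l i : ℕ) : ℤ) := fun l => congrFun hγ l
  have hγ0 : ∀ l, l ≤ i + a → γ.ht l = γ.ht 0 - l := fun l hl => by
    rw [hγ, hγ]
    rcases le_total l i with h5 | h5
    · rw [hdv l h5]; omega
    · rw [huv l h5 hl]; omega
  have hin : ∀ x, α.ht x < γ.ht x → x < i + a := fun x hx => by
    rw [hγ] at hx; omega
  have hV : ∀ x, x < N → α.ht x < γ.ht x →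
      (α.ht x = h ∧ α.ht (x + 1) = h + 1 ∧ (1 ≤ x → α.ht (x - 1) = h + 1)) ∨
      ((h : ℤ) < α.ht x ∧
        (α.ht (x + 1) = α.ht x - 1 ∨ (1 ≤ x ∧ α.ht (x - 1) = α.ht x - 1))) := by
    intro x hx hlt
    have h2 := hin x hlt
    rcases lt_trichotomy x i with h3 | rfl | h3
    · have := hd x (Nat.zero_le x) h3
      have := hdv x h3.le
      omega
    · have h4 := hdv (x - 1) (by omega)
      have h5 := hu x le_rfl (by omega)
      omega
    · have h4 := hu (x - 1) (by omega) (by omega)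
      rw [Nat.sub_add_cancel (by omega)] at h4
      have := huv x h3.le h2.le
      omega
  have hle : ∀ l, α.ht l ≤ γ.ht l := fun l => by rw [hγ]; omega
  have hc : ∀ x y, IsTile α x y → (y : ℤ) < γ.ht x → content α x y + h = y :=
    fun x y => content_of_lt hV
  have hmem : ∀ t : ℕ × ℕ, t ∈ stackTiles 0 i (h + 1) a ++ triTiles (h + 1 + i) a ↔
      IsTile α t.1 t.2 ∧ (t.2 : ℤ) < γ.ht t.1 := by
    rintro ⟨x, y⟩
    rw [List.mem_append, mem_stackTiles, mem_triTiles]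
    dsimp only
    constructor
    · intro hxy
      have hx : x < i + a := by
        rcases hxy with ⟨c, h1, h2, h3, h4, h5⟩ | ⟨c, h1, h2⟩ <;> omega
      have hp := α.ht_parity (i := x) (by omega)
      have hγx := γ.ht_add_le (l := x) (by omega)
      rw [hγ] at hγx ⊢
      unfold IsTile
      rw [Nat.odd_iff]
      rcases le_total x i with h6 | h6
      · have := hdv x h6
        rcases hxy with ⟨c, h1, h2, h3, h4, h5⟩ | ⟨c, h1, h2⟩ <;> omega
      · have := huv x h6 hx.le
        rcases hxy with ⟨c, h1, h2, h3, h4, h5⟩ | ⟨c, h1, h2⟩ <;> omega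
    · rintro ⟨h1, h2⟩
      have h4 := hin x (h1.1.trans h2)
      have hp := α.ht_parity (i := x) (by omega)
      rw [hγ] at h2
      obtain ⟨h7, h8, h9⟩ := h1
      rw [Nat.odd_iff] at h9
      rcases Nat.lt_or_ge y (h + 1 + i + x) with h10 | h10
      · refine Or.inl ⟨(h + 1 + 0 + i + x - y) / 2, ?_⟩
        rcases le_total x i with h6 | h6
        · have := hdv x h6
          omega
        · have := huv x h6 h4.le
          omega
      · refine Or.inr ⟨(y - (h + 1 + i + x)) / 2, ?_⟩
        rcases le_total x i with h6 | h6
        · have := hdv x h6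
          omega
        · have := huv x h6 h4.le
          omega
  refine ⟨γ, hle, ⟨i, by omega, by rw [hγ]; omega⟩, fun x y =>
    content_congr hle hc (fun x h1 h2 => ?_) (fun x h1 h2 => ?_),
    stackTiles 0 i (h + 1) a ++ triTiles (h + 1 + i) a,
    List.pairwise_append.mpr ⟨ascending_stackTiles _ _ _ _, ascending_triTiles _ _,
      fun s hs t ht hn => ?_⟩, hmem, ?_⟩
  · have h4 := hin _ h2
    rw [hγ0 _ h4.le, hγ0 x (by omega)] at h1
    omega
  · obtain ⟨m, m1, m2, m3, m4⟩ := hright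
    have h4 := hin _ h2
    refine ⟨m, ?_, by rw [hγ]; omega, fun l h6 h7 => ?_⟩
    · rcases m1.eq_or_lt with rfl | h6
      · have := huv _ (by omega) (le_refl (i + a))
        omega
      · omega
    · rcases Nat.lt_or_ge l (i + a) with h8 | h8
      · rw [hγ0 _ (by omega : l + 1 ≤ i + a), hγ0 l h8.le]
        push_cast
        ring
      · have := m4 l h8 h7
        rw [hγ, hγ]; omega
  · obtain ⟨c, h1, h2, h3, h4, h5⟩ := mem_stackTiles.mp hs
    obtain ⟨c', h6, h7⟩ := mem_triTiles.mp ht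
    have := hn.1
    omega
  · have hc' : ∀ t ∈ stackTiles 0 i (h + 1) a ++ triTiles (h + 1 + i) a,
        content α t.1 t.2 + h = t.2 :=
      fun t ht => hc _ _ ((hmem t).mp ht).1 ((hmem t).mp ht).2
    rw [tileProd_append, Module.End.mul_apply,
      tileProd_triTiles η ω (u := 1 + i) (by omega)
        fun t ht => hc' t (List.mem_append_right _ ht),
      tileProd_stackTiles η ω (base := fun v => tri η ω N v a (Pi.single γ 1)) (u := 1)
        (add_comm 1 h) fun t ht => hc' t (List.mem_append_left _ ht)]
    refine stack_tri_single hη hω hq ha hN hγ0 (fun l => by rw [hγ]; omega) ?_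
    obtain ⟨m, m1, m2, m3, m4⟩ := hright
    exact ⟨m, m1, m2, m3, fun l h1 h2 => by have := m4 l h1 h2; omega⟩

/-! ### The highest local minimum -/

lemma exists_run_left (P : ℕ → Prop) (i : ℕ) :
    ∃ p ≤ i, (∀ l, p ≤ l → l < i → P l) ∧ (p = 0 ∨ ¬ P (p - 1)) := by
  induction i with
  | zero => exact ⟨0, le_rfl, fun l _ h => by omega, Or.inl rfl⟩
  | succ i ih =>
    by_cases h : P i
    · obtain ⟨p, h1, h2, h3⟩ := ih
      refine ⟨p, by omega, fun l h4 h5 => ?_, h3⟩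
      rcases (Nat.lt_succ_iff.mp h5).eq_or_lt with rfl | h6
      · exact h
      · exact h2 l h4 h6
    · exact ⟨i + 1, le_rfl, fun l _ _ => by omega, Or.inr h⟩

lemma exists_run_right (P : ℕ → Prop) {i n : ℕ} (hi : i ≤ n) :
    ∃ q, i ≤ q ∧ q ≤ n ∧ (∀ l, i ≤ l → l < q → P l) ∧ (q = n ∨ ¬ P q) := by
  induction hi using Nat.decreasingInduction with
  | self => exact ⟨n, le_rfl, le_rfl, fun l _ _ => by omega, Or.inl rfl⟩
  | of_succ i hi ih =>
    by_cases h : P i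
    · obtain ⟨q, h1, h2, h3, h4⟩ := ih
      refine ⟨q, by omega, h2, fun l h5 h6 => ?_, h4⟩
      rcases h5.eq_or_lt with rfl | h7
      · exact h
      · exact h3 l h7 h6
    · exact ⟨i, le_rfl, hi.le, fun l _ _ => by omega, Or.inr h⟩

/-- A path other than the maximal one has a highest local minimum, where the left boundary counts
if the path starts with an ascent. -/
lemma exists_highest_min {α : BallotPath N} (hα : α ≠ maxPath N) :
    ∃ i < N, (α.ht (i + 1) = α.ht i + 1 ∧ (1 ≤ i → α.ht i < α.ht (i - 1))) ∧
      ∀ j < N, α.ht (j + 1) = α.ht j + 1 → (1 ≤ j → α.ht j < α.ht (j - 1)) →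
        α.ht j ≤ α.ht i := by
  have hex : ∃ i < N, α.ht (i + 1) = α.ht i + 1 := by
    by_contra! hc
    refine hα (BallotPath.ext_ht fun l => ?_)
    change α.ht l = ((N - l : ℕ) : ℤ)
    have hd : ∀ l, 0 ≤ l → l < N → α.ht (l + 1) = α.ht l - 1 := fun l _ hl =>
      (α.step l hl).resolve_left (hc l hl)
    have h0 := eq_sub_of_descent hd (Nat.zero_le N) le_rfl
    rw [α.ht_last] at h0
    rcases le_total l N with hl | hl
    · rw [eq_sub_of_descent hd (Nat.zero_le l) hl]; omega
    · rw [α.tail l hl]; omega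
  set s := (Finset.range N).filter fun i =>
    α.ht (i + 1) = α.ht i + 1 ∧ (1 ≤ i → α.ht i < α.ht (i - 1)) with hs
  have hne : s.Nonempty := by
    obtain ⟨h1, h2⟩ := Nat.find_spec hex
    refine ⟨Nat.find hex, Finset.mem_filter.mpr ⟨Finset.mem_range.mpr h1, h2, fun h3 => ?_⟩⟩
    have h4 := Nat.find_min hex (m := Nat.find hex - 1) (by omega)
    have h5 := α.step (Nat.find hex - 1) (by omega)
    rw [Nat.sub_add_cancel h3] at h4 h5
    have h6 : ¬ α.ht (Nat.find hex) = α.ht (Nat.find hex - 1) + 1 := fun h =>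
      h4 ⟨by omega, h⟩
    omega
  obtain ⟨i, hi, hmax⟩ := s.exists_max_image α.ht hne
  obtain ⟨h1, h2⟩ := Finset.mem_filter.mp hi
  exact ⟨i, Finset.mem_range.mp h1, h2, fun j h3 h4 h5 =>
    hmax j (Finset.mem_filter.mpr ⟨Finset.mem_range.mpr h3, h4, h5⟩)⟩

lemma exists_peels {η ω : ℂ} (hη : η = 0 ∨ Complex.exp η - Complex.exp (-η) ≠ 0)
    (hω : qnum η (ω + 1) ≠ 0)
    (hq : ∀ k : ℕ, 1 ≤ k → k ≤ N → qnum η k ≠ 0) {α : BallotPath N} (hα : α ≠ maxPath N) :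
    ∃ γ, Peels η ω α γ := by
  obtain ⟨i, hi, ⟨hi1, hi2⟩, hmax⟩ := exists_highest_min hα
  have step := α.step
  obtain ⟨q, q1, q2, q3, q4⟩ :=
    exists_run_right (fun l => α.ht (l + 1) = α.ht l + 1) hi.le
  have hqv := eq_add_of_ascent q3 q1 le_rfl
  have hqN : q < N := by
    rcases q2.eq_or_lt with rfl | h
    · rw [α.ht_last] at hqv
      have := α.nonneg i
      omega
    · exact h
  have hq1 : ¬ α.ht (q + 1) = α.ht q + 1 := q4.resolve_left hqN.ne
  have hiq : i ≠ q := by rintro rfl; exact hq1 hi1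
  obtain ⟨a, rfl⟩ := Nat.exists_eq_add_of_le q1
  obtain ⟨m, m1, m2, m3, m4⟩ :=
    exists_run_right (fun l => α.ht (l + 1) = α.ht l - 1) hqN.le
  have hqm : i + a ≠ m := by
    rintro rfl
    have := step (i + a) hqN
    have := m4.resolve_left hqN.ne
    omega
  have hm : α.ht m ≤ α.ht i := by
    rcases m4 with rfl | m4
    · rw [α.ht_last]; exact α.nonneg i
    · rcases m2.eq_or_lt with rfl | m2
      · rw [α.ht_last]; exact α.nonneg i
      · refine hmax m m2 ((step m m2).resolve_right m4) fun _ => ?_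
        have := m3 (m - 1) (by omega) (by omega)
        rw [Nat.sub_add_cancel (by omega)] at this
        omega
  obtain ⟨p, p1, p2, p3⟩ := exists_run_left (fun l => α.ht (l + 1) = α.ht l - 1) i
  rcases Nat.eq_zero_or_pos p with rfl | hp
  · exact exists_peels_trapezoid hη hω hq (by omega) hqN p2 q3 ⟨m, m1, m2, hm, m3⟩
  · have p4 := p3.resolve_left (by omega)
    have p5 : α.ht p = α.ht (p - 1) + 1 := by
      have := step (p - 1) (by omega)
      rw [Nat.sub_add_cancel hp] at this p4
      exact this.resolve_right p4
    obtain ⟨b, rfl⟩ := Nat.exists_eq_add_of_le p1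
    have hb : b ≠ 0 := by
      rintro rfl
      have := hi2 (by omega)
      rw [add_zero] at this
      omega
    obtain ⟨n, n1, n2, n3⟩ := exists_run_left (fun l => α.ht (l + 1) = α.ht l + 1) p
    have hnp : n ≠ p := by
      rintro rfl
      have := n3.resolve_left (by omega)
      rw [Nat.sub_add_cancel hp] at this
      exact this p5
    refine exists_peels_rectangle hη hq (by omega) (by omega) hqN p2 q3 ⟨n, n1, ?_, n2⟩
      ⟨m, m1, m2, hm, m3⟩
    refine hmax n (by omega) (n2 n le_rfl (by omega)) fun hn => ?_
    have h1 := n3.resolve_left (by omega)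
    have h2 := step (n - 1) (by omega)
    rw [Nat.sub_add_cancel hn] at h1 h2
    omega

/-- The product of the tiles of `α` turns the coefficient of the maximal path into that of `α`. -/
theorem tileProd_single {η ω : ℂ} (hη : η = 0 ∨ Complex.exp η - Complex.exp (-η) ≠ 0)
    (hω : qnum η (ω + 1) ≠ 0)
    (hq : ∀ k : ℕ, 1 ≤ k → k ≤ N → qnum η k ≠ 0) {α : BallotPath N} {L : List (ℕ × ℕ)}
    (hL : IsTileList α L) :
    tileProd η ω N (content α) L (Pi.single (maxPath N) 1) = Pi.single α 1 := by
  suffices h : ∃ L, IsTileList α L ∧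
      tileProd η ω N (content α) L (Pi.single (maxPath N) 1) = Pi.single α 1 by
    obtain ⟨L', h1, h2⟩ := h
    rw [hL.tileProd_eq η ω h1, h2]
  clear hL
  induction hn : ∑ l ∈ Finset.range N, (N - α.ht l).toNat using Nat.strong_induction_on
    generalizing α with
  | _ n ih =>
    by_cases hα : α = maxPath N
    · subst hα
      refine ⟨[], ⟨List.Pairwise.nil, fun t => ?_⟩, rfl⟩
      simp only [List.not_mem_nil, false_iff]
      rintro ⟨h1, h2, -⟩
      change ((N - t.1 : ℕ) : ℤ) < t.2 at h1
      omega
    · obtain ⟨γ, hle, ⟨l, hl, hlt⟩, hc, R, hR, hmem, hprod⟩ := exists_peels hη hω hq hα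
      have hsum : ∑ l ∈ Finset.range N, (N - γ.ht l).toNat < n := by
        rw [← hn]
        refine Finset.sum_lt_sum (fun l _ => ?_) ⟨l, Finset.mem_range.mpr hl, ?_⟩
        · have := hle l; omega
        · have := γ.ht_add_le hl.le; omega
      obtain ⟨L', h1, h2⟩ := ih _ hsum rfl
      refine ⟨R ++ L', IsTileList.append hle hR hmem h1, ?_⟩
      rw [tileProd_append, Module.End.mul_apply,
        tileProd_congr η ω (fun t ht => hc t.1 t.2 ((h1.2 t).mp ht)), h2, hprod]

/-! ### From linear forms to functions -/

lemma linearCombination_gen (η ω : ℂ) {i u : ℕ} (hi : i < N) (w : DualSpace N)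
    (v : PathSpace N) :
    Finsupp.linearCombination ℂ (tile η ω N i u w) v =
      Finsupp.linearCombination ℂ w (gen η ω N i v) +
        tileConst η ω i u * Finsupp.linearCombination ℂ w v := by
  induction v using Finsupp.induction_linear with
  | zero => simp
  | add v v' h h' => simp only [map_add, h, h']; ring
  | single β c =>
    simp only [gen, Finsupp.linearCombination_single, genKet_eq η ω β hi, map_smul, tile_apply,
      smul_eq_mul]
    ring

/-- On the coefficients of a solution, the (half-)tiles act as on linear forms. -/
lemma tileOp_apply [NeZero N] {η ω δ lam : ℂ}
    (hη : η = 0 ∨ Complex.exp η - Complex.exp (-η) ≠ 0) (hω : qnum η (ω + 1) ≠ 0)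
    {D : Set (Fin N → ℂ)} (hD : IsRegularDomain η ω δ lam D)
    {Ψ : (Fin N → ℂ) → PathSpace N} (hΨ : IsSolution η ω δ lam D Ψ) {i : Fin N} {u : ℕ}
    (hu : qnum η u ≠ 0) {f : Fun N} {w : DualSpace N}
    (hf : ∀ x ∈ D, f x = Finsupp.linearCombination ℂ w (Ψ x)) {x : Fin N → ℂ} (hx : x ∈ D) :
    tileOp η ω δ i u f x =
      Finsupp.linearCombination ℂ (tile η ω N i u w) (Ψ x) := by
  have h1 := hf x hx
  have h2 := hf _ (hD.reflect_mem x hx i)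
  rw [linearCombination_gen η ω i.isLt]
  set A := Finsupp.linearCombination ℂ w (Ψ x) with hA
  set B := Finsupp.linearCombination ℂ w (gen η ω N i (Ψ x)) with hB
  by_cases hi : i = 0
  · subst hi
    rw [← hΨ.left x hx] at h2
    have e : Finsupp.linearCombination ℂ w (Kmat η ω δ N (-x 0) (Ψ x)) =
        kfun η ω (-x 0) δ / kfun η ω (x 0) δ * A +
          -qnum η (2 * x 0) * qnum η (ω + 1) / kfun η ω (x 0) δ * B := by
      simp only [Kmat, LinearMap.add_apply, LinearMap.smul_apply, Module.End.one_apply, map_add,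
        map_smul, smul_eq_mul, neg_neg, mul_neg, qnum_neg]
      rfl
    rw [e] at h2
    have hk := kap_sub_kap_neg η ω δ (2 * x 0)
    rw [kap, kap, mul_div_cancel_left₀ _ two_ne_zero, ← mul_neg,
      mul_div_cancel_left₀ _ two_ne_zero] at hk
    have d1 := hD.two_mul_ne x hx
    have d2 := hD.kfun_ne x hx
    have hc : tileOp η ω δ (0 : Fin N) u f x =
        kfun η ω (x 0) δ / (qnum η (2 * x 0) * qnum η (ω + 1)) * (f x - f (reflect 0 x)) -
          kfun η ω ((u : ℂ) / 2) (ω + ((u % 2 : ℕ) : ℂ)) / (qnum η u * qnum η (ω + 1)) * f x := by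
      rw [tileOp, if_pos rfl]
      rfl
    rw [hc, h1, h2, Fin.val_zero, tileConst, if_pos rfl, kap]
    generalize qnum η (2 * x 0) = z at *
    field_simp at hk ⊢
    linear_combination A * qnum η u * hk
  · have hi0 : (i : ℕ) ≠ 0 := fun h => hi (Fin.ext h)
    rw [← hΨ.bulk x hx i hi] at h2
    have e : Finsupp.linearCombination ℂ w (Rmat η ω N i (x (i - 1) - x i) (Ψ x)) =
        qnum η (1 - (x (i - 1) - x i)) / qnum η (1 + (x (i - 1) - x i)) * A -
          qnum η (x (i - 1) - x i) / qnum η (1 + (x (i - 1) - x i)) * B := by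
      simp only [Rmat, LinearMap.sub_apply, LinearMap.smul_apply, Module.End.one_apply, map_sub,
        map_smul, smul_eq_mul]
      rfl
    rw [e] at h2
    have d1 := hD.sub_ne x hx i hi
    have d2 := hD.one_add_ne x hx i hi
    have hc : tileOp η ω δ i u f x =
        qnum η (x (i - 1) - x i + 1) / qnum η (x (i - 1) - x i) * (f x - f (reflect i x)) -
          qnum η ((u : ℂ) - 1) / qnum η u * f x := by
      rw [tileOp, if_neg hi]
      simp only [hOp, sOp, LinearMap.sub_apply, LinearMap.smul_apply, Module.End.one_apply,
        Module.End.mul_apply, LinearMap.mulLeft_apply, Pi.sub_apply, Pi.smul_apply, Pi.mul_apply,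
        smul_eq_mul, if_neg hi]
      rfl
    have r1 := qnum_add_one_add_sub_one hη (x (i - 1) - x i)
    have r2 := qnum_add_one_add_sub_one hη (u : ℂ)
    have r3 := qnum_neg η (x (i - 1) - x i - 1)
    rw [neg_sub] at r3
    rw [hc, h1, h2, tileConst, if_neg hi0]
    rw [add_comm (1 : ℂ)] at d2 ⊢
    rw [r3]
    field_simp
    linear_combination A * qnum η u * r1 - A * qnum η (x (i - 1) - x i) * r2

lemma prod_tileOp_apply [NeZero N] {η ω δ lam : ℂ}
    (hη : η = 0 ∨ Complex.exp η - Complex.exp (-η) ≠ 0) (hω : qnum η (ω + 1) ≠ 0)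
    {D : Set (Fin N → ℂ)} (hD : IsRegularDomain η ω δ lam D)
    {Ψ : (Fin N → ℂ) → PathSpace N} (hΨ : IsSolution η ω δ lam D Ψ) {c : ℕ → ℕ → ℕ}
    {L : List (Fin N × ℕ)} (hL : ∀ t ∈ L, qnum η (c t.1 t.2) ≠ 0) {f : Fun N} {w : DualSpace N}
    (hf : ∀ x ∈ D, f x = Finsupp.linearCombination ℂ w (Ψ x)) :
    ∀ x ∈ D, (L.map fun t => tileOp η ω δ t.1 (c t.1 t.2)).prod f x =
      Finsupp.linearCombination ℂ
        (tileProd η ω N c (L.map fun t => ((t.1 : ℕ), t.2)) w) (Ψ x) := by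
  induction L with
  | nil => exact hf
  | cons t L ih =>
    intro x hx
    rw [List.map_cons, List.prod_cons, List.map_cons, Module.End.mul_apply]
    exact tileOp_apply hη hω hD hΨ (hL t List.mem_cons_self)
      (ih fun s hs => hL s (List.mem_cons_of_mem t hs)) hx

lemma linearCombination_pi_single (α : BallotPath N) (v : PathSpace N) :
    Finsupp.linearCombination ℂ (Pi.single α 1 : DualSpace N) v = v α := by
  induction v using Finsupp.induction_linear with
  | zero => simp
  | add v v' h h' => simp only [map_add, h, h', Finsupp.add_apply]
  | single β c =>
    rw [Finsupp.linearCombination_single, Finsupp.single_apply, Pi.single_apply, smul_eq_mul]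
    split_ifs <;> simp

lemma IsAdmissibleOrder.isTileList {α : BallotPath N} {L : List (Fin N × ℕ)}
    (hL : IsAdmissibleOrder α L) : IsTileList α (L.map fun t => ((t.1 : ℕ), t.2)) := by
  obtain ⟨h1, h2⟩ := hL
  have hmem : ∀ t, t ∈ L ↔ IsTile α t.1 t.2 := fun t => by
    rw [← Multiset.mem_coe, h1, Finset.mem_val, tiles, Finset.mem_filter, Finset.mem_product,
      Finset.mem_range]
    refine ⟨fun h => h.2, fun h => ⟨⟨Finset.mem_univ _, ?_⟩, h⟩⟩
    have := h.2.1
    omega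
  have hnd : L.Nodup := by
    rw [← Multiset.coe_nodup, h1]
    exact (tiles α).nodup
  refine ⟨List.pairwise_map.mpr ?_, fun t => ?_⟩
  · refine (hnd.and h2).imp_of_mem fun {s t} hs ht hst hn => ?_
    have hs' := (hmem s).mp hs
    have ht' := (hmem t).mp ht
    have o1 := Nat.odd_iff.mp hs'.2.2
    have o2 := Nat.odd_iff.mp ht'.2.2
    by_contra hlt
    dsimp only at hlt
    have h3 := hn.1
    have h4 := hn.2
    dsimp only at h3 h4
    rcases (not_lt.mp hlt).eq_or_lt with h5 | h5
    · refine hst.1 (Prod.ext (Fin.ext ?_) h5.symm)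
      omega
    · have := content_lt_of_near (s := ((s.1 : ℕ), s.2)) (t := ((t.1 : ℕ), t.2)) hs' ht'
        ⟨h4, h3⟩ h5
      exact absurd hst.2 (not_le.mpr this)
  · rw [List.mem_map]
    constructor
    · rintro ⟨s, hs, rfl⟩
      exact (hmem s).mp hs
    · intro h
      have := h.2.1
      exact ⟨(⟨t.1, by omega⟩, t.2), (hmem _).mpr h, rfl⟩

end

end QKZ

theorem theorem2 {N : ℕ} [NeZero N] (η ω δ lam : ℂ)
    (hq : ∀ k : ℕ, 2 ≤ k → k ≤ N → QKZ.qnum η (k : ℂ) ≠ 0)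
    (hω : QKZ.qnum η (ω + 1) ≠ 0)
    (D : Set (Fin N → ℂ)) (hD : QKZ.IsRegularDomain η ω δ lam D)
    (Ψ : (Fin N → ℂ) → QKZ.PathSpace N) (hΨ : QKZ.IsSolution η ω δ lam D Ψ)
    (α : QKZ.BallotPath N) (L : List (Fin N × ℕ)) (hL : QKZ.IsAdmissibleOrder α L) :
    ∀ x ∈ D, Ψ x α = QKZ.Hprod η ω δ α L (fun y => Ψ y (QKZ.maxPath N)) x := by
  intro x hx
  have hη := QKZ.exp_sub_ne_zero_of_qnum_ne hω
  have hq' : ∀ k : ℕ, 1 ≤ k → k ≤ N → QKZ.qnum η k ≠ 0 := fun k h1 h2 => by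
    rcases h1.eq_or_lt with rfl | h3
    · rw [Nat.cast_one, QKZ.qnum_one hη]
      exact one_ne_zero
    · exact hq k h3 h2
  have hT := hL.isTileList
  have hc : ∀ t ∈ L, QKZ.qnum η (QKZ.content α t.1 t.2) ≠ 0 := fun t ht => by
    have h1 := (hT.2 _).mp (List.mem_map_of_mem ht)
    have h2 := QKZ.content_le (α := α) t.1 t.2
    have h3 := h1.2.1
    exact hq' _ (QKZ.content_pos h1) (by dsimp only at h3; omega)
  rw [QKZ.Hprod, QKZ.prod_tileOp_apply hη hω hD hΨ hc
    (fun y _ => (QKZ.linearCombination_pi_single (QKZ.maxPath N) (Ψ y)).symm) x hx,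
    QKZ.tileProd_single hη hω hq' hT, QKZ.linearCombination_pi_single]
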